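/- **Setting.** All series are formal, over $\mathbb{C}$. Write $\mathbf t=(t_1,t_2,\dots)$, $\partial_i=\partial/\partial t_i$, $[z^{-1}]=(z^{-1},z^{-2}/2,z^{-3}/3,\dots)$. A *KP tau function* is a formal power series $\tau(\mathbf t)$, normalized by $\tau(0)=1$, with $$\oint_\infty \tau(\mathbf t-[z^{-1}])\,\tau(\mathbf t'+[z^{-1}])\,e^{\sum_{i\ge1}(t_i-t_i')z^i}\,dz=0 .$$ Its wave function is $\Psi^+(\mathbf t;z)=e^{\sum t_iz^i}\,\tau(\mathbf t-[z^{-1}])/\tau(\mathbf t)$, and the corresponding point of Sato's Grassmannian is $\mathcal W^+=\mathrm{span}_{n\ge 0}\{\partial_x^n\Psi^+(x,0,0,\dots;z)|_{x=0}\}\subset\mathbb{C}((z^{-1}))$. An equation of the KP hierarchy is a differential polynomial equation with constant coefficients in $u$ that is satisfied by $u=\log\tau$ for every KP tau function $\tau$. Let $p\ge2$ and let $\mathcal A_p^+=z+\frac{1}{pz^p}\bigl(z\frac{\partial}{\partial z}-\frac{p-1}{2}\bigr)$. Let $$V_p(u)=\frac{u^{p+1}}{p+1}+\sum_{i=0}^{p-2}\theta_i\frac{u^{i+1}}{i+1},$$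 where $\theta_0,\dots,\theta_{p-2}\in\mathbb{C}[t_1,\dots,t_{p-1}]$ are the (uniquely existing) polynomials such that, with $w=V_p'(u)$ (the prime is $d/du$), $$u=w^{1/p}+\frac1p\sum_{j=1}^{p-1}(p-j)\,t_{p-j}\,w^{-j/p}+O(w^{-1-1/p})\qquad(u\to\infty).$$ Here $(V_p'(u))^{a/p}=u^a(1+\cdots)$ is expanded in powers of $u^{-1}$, and $\mathrm{res}_u$ denotes the coefficient of $u^{-1}$. **Lemma.** Let $\tau$ be a KP tau function whose point $\mathcal W^+$ satisfies $z^p\mathcal W^+\subset\mathcal W^+$ and $\mathcal A_p^+\mathcal W^+\subset\mathcal W^+$, and let $\tau_0^{(p)}(t_1,\dots,t_{p-1})$ be its restriction to $t_i=0$, $i\ge p$ (the topological tau function). Then: 1. $\log\tau_0^{(p)}$ satisfies $$\partial_1\partial_i\log\tau_0^{(p)}=\mathrm{res}_u\,(V_p'(u))^{i/p},\qquad 1\le i\le p-1,$$ and all equations of the KP hierarchy containing just $\partial_1,\dots,\partial_p$ (where $\log\tau_0^{(p)}$ is regarded as independent of $t_p$). These equations determine it: every $f\in\mathbb{C}[[t_1,\dots,t_{p-1}]]$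 satisfying them differs from $\log\tau_0^{(p)}$ by a polynomial of degree at most $1$ in $t_1,\dots,t_{p-1}$. 2. $\log\tau_0^{(p)}$ satisfies $$\partial_i\log\tau_0^{(p)}=-\frac{p}{p+i}\,\mathrm{res}_u\,(V_p'(u))^{\frac{p+i}{p}},\qquad 1\le i\le p-1,$$ and every $f\in\mathbb{C}[[t_1,\dots,t_{p-1}]]$ satisfying these equations differs from $\log\tau_0^{(p)}$ by a constant. 3. In particular $$\log\tau_0^{(2)}=-\tfrac1{12}t_1^3,\qquad \log\tau_0^{(3)}=-\tfrac13t_1^2t_2-\tfrac2{27}t_2^4,$$ $$\log\tau_0^{(4)}=-\tfrac38t_1^2t_3-\tfrac12t_1t_2^2-\tfrac9{16}t_2^2t_3^2-\tfrac{81}{1280}t_3^5 .$$ -/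

import Mathlib

open scoped Nat

noncomputable section

namespace TopTau

/-! ### Formal series

`t_i` (`i ≥ 1`) is the variable `MvPowerSeries.X i` with `i : ℕ+`.  Formal Laurent series in `z⁻¹`
(finitely many positive powers of `z`) are Hahn series in `s = z⁻¹`: the coefficient of `z ^ k` of
`g : LaurentSeries ℂ` is `g.coeff (-k)`. -/

/-- `log F` for a formal power series `F` with constant term `1`,
that is `∑_{n ≥ 1} (-1)^(n-1) (F - 1)^n / n`. -/
def logSeries {σ : Type} (F : MvPowerSeries σ ℂ) : MvPowerSeries σ ℂ :=
  PowerSeries.subst (F - 1) (PowerSeries.log ℂ)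

/-- The Laurent monomial `z ^ k`. -/
def zpow (k : ℤ) : LaurentSeries ℂ := HahnSeries.single (-k) 1

/-- `exp (∑_i c_i t_i)`: the coefficient of `∏ t_i ^ m_i` is `∏ c_i ^ m_i / m_i !`. -/
def expLinear (c : ℕ+ → LaurentSeries ℂ) : MvPowerSeries ℕ+ (LaurentSeries ℂ) :=
  fun m => m.prod fun i k => HahnSeries.C ((k ! : ℂ)⁻¹) * c i ^ k

/-- The series `τ(t + ε [s])`, `[s] = (s, s²/2, s³/3, …)`, in the variables `t_i = X (some i)` and
`s = X none`. -/
def shiftJoint (ε : ℂ) (τ : MvPowerSeries ℕ+ ℂ) : MvPowerSeries (Option ℕ+) ℂ :=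
  MvPowerSeries.subst
    (fun i : ℕ+ => (MvPowerSeries.X (some i) +
      MvPowerSeries.C (ε / ((i : ℕ) : ℂ)) * MvPowerSeries.X none ^ (i : ℕ) :
        MvPowerSeries (Option ℕ+) ℂ)) τ

/-- `τ(t + ε [z⁻¹])` as a power series in `t` whose coefficients are series in `z⁻¹`. -/
def shift (ε : ℂ) (τ : MvPowerSeries ℕ+ ℂ) : MvPowerSeries ℕ+ (LaurentSeries ℂ) :=
  fun m => HahnSeries.ofPowerSeries ℤ ℂ (PowerSeries.mk fun k =>
    MvPowerSeries.coeff (m.mapDomain some + Finsupp.single none k) (shiftJoint ε τ))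

/-- `τ(t) Ψ⁺(t; z) = exp (∑ t_i z^i) τ(t - [z⁻¹])`. -/
def wavePlusNum (τ : MvPowerSeries ℕ+ ℂ) : MvPowerSeries ℕ+ (LaurentSeries ℂ) :=
  expLinear (fun i => zpow (i : ℕ)) * shift (-1) τ

/-- `τ(t) Ψ⁻(t; z) = exp (-∑ t_i z^i) τ(t + [z⁻¹])`. -/
def waveMinusNum (τ : MvPowerSeries ℕ+ ℂ) : MvPowerSeries ℕ+ (LaurentSeries ℂ) :=
  expLinear (fun i => -zpow (i : ℕ)) * shift 1 τ

/-- `τ`, normalized by `τ(0) = 1`, is a formal KP tau function, i.e. satisfies the bilinear identity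
`∮_∞ τ(t - [z⁻¹]) τ(t' + [z⁻¹]) exp (∑ (t_i - t'_i) z^i) dz = 0`.  As `t` and `t'` are independent
variables, the coefficient of `t^m t'^m'` in the integrand is the product below, and its residue is
its coefficient of `z⁻¹`. -/
def IsKPTau (τ : MvPowerSeries ℕ+ ℂ) : Prop :=
  MvPowerSeries.constantCoeff τ = 1 ∧
  ∀ m m' : ℕ+ →₀ ℕ,
    (MvPowerSeries.coeff m (wavePlusNum τ) * MvPowerSeries.coeff m' (waveMinusNum τ)).coeff 1 = 0

/-- The wave function `Ψ⁺(t; z)` (Sato's formula). -/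
def wavePlus (τ : MvPowerSeries ℕ+ ℂ) : MvPowerSeries ℕ+ (LaurentSeries ℂ) :=
  wavePlusNum τ * (MvPowerSeries.map HahnSeries.C τ)⁻¹

/-- The point of Sato's Grassmannian attached to `τ`: the span of the series `D^n Ψ⁺(x, 0; z)`,
`n ≥ 0`, at `x = 0`, where `D = ∂/∂x` and `Ψ⁺(x, 0; z)` is the wave function at
`t = (x, 0, 0, …)`. -/
def planePlus (τ : MvPowerSeries ℕ+ ℂ) : Submodule ℂ (LaurentSeries ℂ) :=
  Submodule.span ℂ (Set.range fun n : ℕ =>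
    (n ! : ℂ) • MvPowerSeries.coeff (Finsupp.single (1 : ℕ+) n) (wavePlus τ))

/-- `z ∂/∂z`, which is `-s ∂/∂s` for `s = z⁻¹`. -/
def zDeriv (g : LaurentSeries ℂ) : LaurentSeries ℂ :=
  -(zpow (-1) * LaurentSeries.derivative ℂ g)

/-- The operator `𝒜_p⁺ = z + (1 / (p z^p)) (z ∂/∂z - (p-1)/2)`. -/
def opA (p : ℕ) (g : LaurentSeries ℂ) : LaurentSeries ℂ :=
  zpow 1 * g +
    HahnSeries.C ((p : ℂ)⁻¹) * zpow (-p) * (zDeriv g - HahnSeries.C (((p : ℂ) - 1) / 2) * g)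

/-- `τ` is the (normalized) KP tau function of a point `W` of the Grassmannian with `z^p W ⊆ W` and
`𝒜_p⁺ W ⊆ W`. -/
def IsInvariantTau (p : ℕ) (τ : MvPowerSeries ℕ+ ℂ) : Prop :=
  IsKPTau τ ∧
  (∀ g ∈ planePlus τ, zpow p * g ∈ planePlus τ) ∧
  (∀ g ∈ planePlus τ, opA p g ∈ planePlus τ)

/-! ### The first `p - 1` times

Series in `t_1, …, t_{p-1}` are indexed by `Fin (p - 1)`; the index `j` stands for `t_{j+1}`. -/

/-- The inclusion of the first `n` times among all times. -/
def timeEmb (n : ℕ) : Fin n ↪ ℕ+ where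
  toFun j := Nat.succPNat j
  inj' _ _ h := Fin.ext (Nat.succPNat_injective h)

/-- The restriction of `τ` to the locus `t_i = 0`, `i ≥ p`. -/
def restrictTau (p : ℕ) (τ : MvPowerSeries ℕ+ ℂ) : MvPowerSeries (Fin (p - 1)) ℂ :=
  MvPowerSeries.killCompl (timeEmb (p - 1)) τ

/-- A series in `t_1, …, t_{p-1}` as a series in all times, not depending on `t_i`, `i ≥ p`. -/
def extendTimes (p : ℕ) (f : MvPowerSeries (Fin (p - 1)) ℂ) : MvPowerSeries ℕ+ ℂ :=
  MvPowerSeries.rename (timeEmb (p - 1)) f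

/-! ### KP equations -/

/-- A differential polynomial in one unknown `u(t_1, t_2, …)` with constant coefficients: the
variable indexed by the list `[i_1, …, i_k]` stands for `∂_{i_1} ⋯ ∂_{i_k} u`. -/
abbrev DiffPoly : Type := MvPolynomial (List ℕ+) ℂ

/-- The value of a differential polynomial at a formal power series `u`. -/
def DiffPoly.evalAt (E : DiffPoly) (u : MvPowerSeries ℕ+ ℂ) : MvPowerSeries ℕ+ ℂ :=
  MvPolynomial.aeval (fun l : List ℕ+ => l.foldr (fun i v => MvPowerSeries.pderiv ℂ i v) u) E

/-- `E = 0` is an equation of the KP hierarchy (written for `u = log τ`): it holds for all KP tau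
functions. -/
def DiffPoly.IsKPEquation (E : DiffPoly) : Prop :=
  ∀ τ : MvPowerSeries ℕ+ ℂ, IsKPTau τ → E.evalAt (logSeries τ) = 0

/-- `E` contains just `∂_1, …, ∂_p`. -/
def DiffPoly.InvolvesOnly (E : DiffPoly) (p : ℕ) : Prop :=
  ∀ l ∈ E.vars, ∀ i ∈ l, (i : ℕ) ≤ p

/-- `f(t_1, …, t_{p-1})` solves all equations of the KP hierarchy containing just
`∂_1, …, ∂_p`. -/
def SolvesKPUpTo (p : ℕ) (f : MvPowerSeries (Fin (p - 1)) ℂ) : Prop :=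
  ∀ E : DiffPoly, E.IsKPEquation → E.InvolvesOnly p → E.evalAt (extendTimes p f) = 0

/-! ### The polynomial `V_p` and fractional powers of its derivative -/

/-- The coefficient ring `ℂ[t_1, …, t_{p-1}]`. -/
abbrev TimePoly (p : ℕ) : Type := MvPolynomial (Fin (p - 1)) ℂ

/-- `V_p(u) = u^(p+1)/(p+1) + ∑_{i=0}^{p-2} θ_i u^(i+1)/(i+1)`. -/
def potential (p : ℕ) (θ : Fin (p - 1) → TimePoly p) : Polynomial (TimePoly p) :=
  Polynomial.C (MvPolynomial.C (((p : ℂ) + 1)⁻¹)) * Polynomial.X ^ (p + 1) +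
    ∑ i : Fin (p - 1),
      Polynomial.C (MvPolynomial.C ((((i : ℕ) : ℂ) + 1)⁻¹) * θ i) * Polynomial.X ^ ((i : ℕ) + 1)

/-- `Q(u)^(a/p)` for a polynomial `Q` which is monic of degree `p`, as a Laurent series in
`u⁻¹` (the coefficient of `u^k` being `coeff (-k)`): it is `u^a (1 + h)^(a/p)`, with
`1 + h = u^(-p) Q(u)` and `(1 + h)^(a/p)` the binomial series. -/
def fracPow {A : Type} [CommRing A] [Algebra ℚ A] (p : ℕ) (Q : Polynomial A) (a : ℤ) :
    LaurentSeries A :=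
  HahnSeries.single (-a) 1 *
    HahnSeries.ofPowerSeries ℤ A
      (PowerSeries.subst (((Polynomial.reflect p Q : Polynomial A) : PowerSeries A) - 1)
        (PowerSeries.binomialSeries A ((a : ℚ) / (p : ℚ))))

/-- The residue at `u = ∞`: the coefficient of `u⁻¹`. -/
def resInf {A : Type} [CommRing A] (g : LaurentSeries A) : A := g.coeff 1

/-- `(V_p'(u))^(a/p)`. -/
def dVPow (p : ℕ) (θ : Fin (p - 1) → TimePoly p) (a : ℤ) : LaurentSeries (TimePoly p) :=
  fracPow p (Polynomial.derivative (potential p θ)) a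

/-- The polynomials `θ_i(t_1, …, t_{p-1})` are the coefficients of `V_p'`: with `w = V_p'(u)`,
`u = w^(1/p) + (1/p) ∑_{i=1}^{p-1} i t_i w^((i-p)/p) + O(w^(-1-1/p))`,
that is, the difference of the two sides contains no power `u^(-k)` with `k ≤ p`. -/
def IsTheta (p : ℕ) (θ : Fin (p - 1) → TimePoly p) : Prop :=
  ∀ k : ℤ, k ≤ p →
    (HahnSeries.single (-1) 1 - dVPow p θ 1 -
      ∑ j : Fin (p - 1),
        HahnSeries.C (MvPolynomial.C ((((j : ℕ) : ℂ) + 1) / p) * MvPolynomial.X j) *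
          dVPow p θ (((j : ℕ) : ℤ) + 1 - p) : LaurentSeries (TimePoly p)).coeff k = 0

/-! ### The two systems of equations -/

/-- `∂_1 ∂_i f = res_u (V_p'(u))^(i/p)`, `1 ≤ i ≤ p - 1` (here `i = j + 1`). -/
def SecondOrderSystem (p : ℕ) (hp : 2 ≤ p) (θ : Fin (p - 1) → TimePoly p)
    (f : MvPowerSeries (Fin (p - 1)) ℂ) : Prop :=
  ∀ j : Fin (p - 1),
    MvPowerSeries.pderiv ℂ (⟨0, by omega⟩ : Fin (p - 1)) (MvPowerSeries.pderiv ℂ j f) =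
      ((resInf (dVPow p θ (((j : ℕ) : ℤ) + 1)) : TimePoly p) : MvPowerSeries (Fin (p - 1)) ℂ)

/-- `∂_i f = -(p/(p+i)) res_u (V_p'(u))^((p+i)/p)`, `1 ≤ i ≤ p - 1` (here `i = j + 1`). -/
def FirstOrderSystem (p : ℕ) (θ : Fin (p - 1) → TimePoly p)
    (f : MvPowerSeries (Fin (p - 1)) ℂ) : Prop :=
  ∀ j : Fin (p - 1),
    MvPowerSeries.pderiv ℂ j f =
      ((MvPolynomial.C (-((p : ℂ) / ((p : ℂ) + (((j : ℕ) : ℂ) + 1)))) *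
        resInf (dVPow p θ ((p : ℤ) + (((j : ℕ) : ℤ) + 1))) : TimePoly p) :
          MvPowerSeries (Fin (p - 1)) ℂ)

end TopTau

end

/-! The argument is a WKB computation on the plane moved by the flows, followed by a change of
variable in residues.

The bilinear identity makes the plane the orthogonal complement of the Taylor coefficients of `τ Ψ⁻`
(`planePlus_eq_resPerp`). Hence it contains the Taylor coefficients of `Ψ⁺` in all times, and the
plane moved by the flows contains no nonzero series in `O(z⁻¹)` (`eq_zero_of_mem_planePlus`).
Equations between series of the moved plane may therefore be checked modulo `O(z⁻¹)`.

Write `θ = z d/dz`, `s = z⁻¹`, and let `χ` be `τ(t - [z⁻¹]) / τ(t)` on the locus. Conjugation by the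
exponential turns `𝒜_p⁺` into `g + p⁻¹ z⁻ᵖ (θ - (p-1)/2)` with `g = z + p⁻¹ ∑ j t_j z^(j-p)`. Its
iterates on `χ` have degrees `0, 1, 2, …`, so `z^p χ` and `(∂_i + z^i) χ` are finite combinations of
them. To first order, `∂_i χ` is `N_i χ` up to a controlled error, where `z^i + N_i` is the
polynomial in `g` with polar part `z^i` (a Faber polynomial). To second order, the relation for `z^p
χ` gives `θ χ` in terms of `X - z^p`, where `X` is the polynomial in `g` approximating `z^p`. The
identity `IsFaber.trace` for `∑ s^j N_j` makes the `N_j` cancel against the flows contained in `τ(t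
- [z⁻¹])`. What remains is that `-∂_i log τ` is the coefficient of `s^i` in `(X - z^p) θ(g)`, for `i
≤ p` (`killCompl_pderiv_logSeries`).

The defining condition of `V_p`, rewritten in the variable `z = V_p'(u)^(1/p)`, says that `X =
V_p'(g)` (`isTheta_iff`). Residues in `u` become residues in `z` by integration by parts and Taylor
expansion (`coeff_one_fracPow`, `coeff_one_fracPow_add`), which gives both systems.

For the KP equations, `z^p W ⊆ W` makes all second derivatives of `log τ` involving `t_p` vanish,
and the residue of `X² dg` shows that `∂_p log τ` vanishes on the locus. So `∂_p log τ = 0`, and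
restriction to the locus preserves every equation in `∂_1, …, ∂_p`. For uniqueness, differential
polynomials are evaluated on all KP tau functions at once. Modulo lower weight or higher order, `∂_i
∂_k log τ` is `(ik/n) ∂_1 ∂_n log τ`, `n = i + k - 1`. Induction on the weight below `2p` expresses
every second derivative along the first `p - 1` times through derivatives containing `∂_p`, which
vanish, or `∂_1` and a further derivative, which are prescribed. The second derivatives then
determine the series up to degree one. -/

noncomputable section

namespace TopTau

/-! ### Laurent series in `s = z⁻¹`: orders, derivations and elimination. -/

section Laurent

variable {A B : Type*} [CommRing A] [CommRing B]

/-- The Laurent series in `s = z⁻¹` of the form `O(s ^ n)`. -/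
def ordGE (A : Type*) [CommRing A] (n : ℤ) : Submodule A (LaurentSeries A) where
  carrier := {f | ∀ k < n, f.coeff k = 0}
  add_mem' hf hg k hk := by simp [hf k hk, hg k hk]
  zero_mem' k _ := rfl
  smul_mem' c f hf k hk := by simp [hf k hk]

theorem ordGE_anti {m n : ℤ} (h : m ≤ n) {f : LaurentSeries A} (hf : f ∈ ordGE A n) :
    f ∈ ordGE A m :=
  fun k hk => hf k (by lia)

theorem ordGE_succ {n : ℤ} {f : LaurentSeries A} (hf : f ∈ ordGE A n) (h : f.coeff n = 0) :
    f ∈ ordGE A (n + 1) := by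
  intro k hk
  rcases (show k < n ∨ k = n by lia) with h' | rfl
  exacts [hf k h', h]

theorem single_mem_ordGE {m n : ℤ} (h : m ≤ n) (a : A) :
    (HahnSeries.single n a : LaurentSeries A) ∈ ordGE A m := by
  intro k hk
  exact HahnSeries.coeff_single_of_ne (by lia)

theorem single_mul_mem_ordGE {m : ℤ} (n : ℤ) (a : A) {f : LaurentSeries A} (hf : f ∈ ordGE A m) :
    HahnSeries.single n a * f ∈ ordGE A (n + m) := by
  intro k hk
  rw [HahnSeries.coeff_single_mul, hf _ (by lia), mul_zero]

theorem ofPowerSeries_coeff_nat (F : PowerSeries A) (n : ℕ) :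
    (HahnSeries.ofPowerSeries ℤ A F).coeff n = PowerSeries.coeff n F :=
  LaurentSeries.coeff_coe_powerSeries F n

theorem ofPowerSeries_coeff_neg (F : PowerSeries A) {k : ℤ} (hk : k < 0) :
    (HahnSeries.ofPowerSeries ℤ A F).coeff k = 0 := by
  rw [PowerSeries.coeff_coe, if_pos hk]

theorem ofPowerSeries_mem (F : PowerSeries A) : HahnSeries.ofPowerSeries ℤ A F ∈ ordGE A 0 :=
  fun _ hk => ofPowerSeries_coeff_neg F hk

theorem exists_eq_single_mul {n : ℤ} {f : LaurentSeries A} (hf : f ∈ ordGE A n) :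
    ∃ F : PowerSeries A, f = HahnSeries.single n 1 * HahnSeries.ofPowerSeries ℤ A F := by
  refine ⟨PowerSeries.mk fun k => f.coeff (n + k), ?_⟩
  ext k
  rw [HahnSeries.coeff_single_mul, one_mul]
  rcases lt_or_ge k n with h | h
  · rw [hf k h, ofPowerSeries_coeff_neg _ (by lia)]
  · obtain ⟨m, hm⟩ := Int.eq_ofNat_of_zero_le (show 0 ≤ k - n by lia)
    rw [hm, ofPowerSeries_coeff_nat, PowerSeries.coeff_mk]
    congr 1
    lia

theorem mul_mem_ordGE {m n : ℤ} {f g : LaurentSeries A} (hf : f ∈ ordGE A m)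
    (hg : g ∈ ordGE A n) : f * g ∈ ordGE A (m + n) := by
  obtain ⟨F, rfl⟩ := exists_eq_single_mul hf
  obtain ⟨G, rfl⟩ := exists_eq_single_mul hg
  rw [mul_mul_mul_comm, HahnSeries.single_mul_single, one_mul, ← map_mul]
  simpa using single_mul_mem_ordGE (m + n) (1 : A) (ofPowerSeries_mem (F * G))

theorem mul_mem_ordGE_of_le {m n k : ℤ} {f g : LaurentSeries A} (hf : f ∈ ordGE A m)
    (hg : g ∈ ordGE A n) (h : k ≤ m + n) : f * g ∈ ordGE A k :=
  ordGE_anti h (mul_mem_ordGE hf hg)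

theorem coeff_mul_lead {m n : ℤ} {f g : LaurentSeries A} (hf : f ∈ ordGE A m)
    (hg : g ∈ ordGE A n) : (f * g).coeff (m + n) = f.coeff m * g.coeff n := by
  obtain ⟨F, rfl⟩ := exists_eq_single_mul hf
  obtain ⟨G, rfl⟩ := exists_eq_single_mul hg
  rw [mul_mul_mul_comm, HahnSeries.single_mul_single, one_mul, ← map_mul]
  simp only [HahnSeries.coeff_single_mul, one_mul, sub_self]
  have h (F : PowerSeries A) : (HahnSeries.ofPowerSeries ℤ A F).coeff 0 =
    PowerSeries.constantCoeff F := by simpa using ofPowerSeries_coeff_nat F 0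
  rw [h, h, h, map_mul]

theorem pow_mem_ordGE {m : ℤ} {f : LaurentSeries A} (hf : f ∈ ordGE A m) (k : ℕ) :
    f ^ k ∈ ordGE A (k * m) := by
  induction k with
  | zero => simpa using single_mem_ordGE (A := A) (le_refl 0) 1
  | succ k ih =>
    rw [pow_succ]
    exact mul_mem_ordGE_of_le ih hf (by push_cast; linarith)

theorem coeff_pow_lead {m : ℤ} {f : LaurentSeries A} (hf : f ∈ ordGE A m) (k : ℕ) :
    (f ^ k).coeff (k * m) = f.coeff m ^ k := by
  induction k with
  | zero => simp
  | succ k ih =>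
    rw [pow_succ, pow_succ, ← ih, ← coeff_mul_lead (pow_mem_ordGE hf k) hf]
    congr 1
    push_cast
    ring

theorem one_mem_ordGE {n : ℤ} (h : n ≤ 0) : (1 : LaurentSeries A) ∈ ordGE A n :=
  single_mem_ordGE h 1

theorem exists_inverse {n : ℤ} {f : LaurentSeries A} (hf : f ∈ ordGE A n) (h1 : f.coeff n = 1) :
    ∃ g ∈ ordGE A (-n), g.coeff (-n) = 1 ∧ f * g = 1 := by
  obtain ⟨F, rfl⟩ := exists_eq_single_mul hf
  have hF : PowerSeries.constantCoeff F = 1 := by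
    have h := ofPowerSeries_coeff_nat F 0
    rw [HahnSeries.coeff_single_mul, one_mul, sub_self] at h1
    simpa [h1] using h.symm
  have hFG : F * PowerSeries.invOfUnit F 1 = 1 := PowerSeries.mul_invOfUnit F 1 (by simp [hF])
  refine ⟨HahnSeries.single (-n) 1 * HahnSeries.ofPowerSeries ℤ A (PowerSeries.invOfUnit F 1),
    ?_, ?_, ?_⟩
  · simpa using single_mul_mem_ordGE (-n) (1 : A) (ofPowerSeries_mem (PowerSeries.invOfUnit F 1))
  · rw [HahnSeries.coeff_single_mul, one_mul, sub_self]
    have h := ofPowerSeries_coeff_nat (PowerSeries.invOfUnit F 1) 0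
    simpa using h
  · rw [mul_mul_mul_comm, HahnSeries.single_mul_single, ← map_mul, hFG]
    simp

theorem mem_ordGE_of_mul {n m : ℤ} {f g : LaurentSeries A} (hf : f ∈ ordGE A n)
    (h1 : f.coeff n = 1) (h : f * g ∈ ordGE A m) : g ∈ ordGE A (m - n) := by
  obtain ⟨f', hf', -, hff'⟩ := exists_inverse hf h1
  have : g = f' * (f * g) := by rw [← mul_assoc, mul_comm f', hff', one_mul]
  rw [this]
  exact mul_mem_ordGE_of_le hf' h (by lia)

/-- The series obtained by applying an additive map, depending on the degree, to each
coefficient. -/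
def mapCoeff (c : ℤ → A →+ A) (f : LaurentSeries A) : LaurentSeries A where
  coeff k := c k (f.coeff k)
  isPWO_support' := f.isPWO_support.mono fun k hk h0 => hk (by
    rw [HahnSeries.coeff] at h0
    simp only [h0, map_zero])

theorem mapCoeff_coeff (c : ℤ → A →+ A) (f : LaurentSeries A) (k : ℤ) :
    (mapCoeff c f).coeff k = c k (f.coeff k) := rfl

theorem mapCoeff_support (c : ℤ → A →+ A) (f : LaurentSeries A) :
    (mapCoeff c f).support ⊆ f.support := fun k hk h0 => hk (by
  simp only [mapCoeff_coeff, h0, map_zero])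

/-- Applying the maps can only shrink supports, so the three convolution sums may be taken over the
same pairs of exponents and compared term by term. -/
theorem mapCoeff_mul {c : ℤ → A →+ A}
    (hc : ∀ i j a b, c (i + j) (a * b) = a * c j b + c i a * b) (f g : LaurentSeries A) :
    mapCoeff c (f * g) = f * mapCoeff c g + mapCoeff c f * g := by
  ext k
  rw [HahnSeries.coeff_add, mapCoeff_coeff, HahnSeries.coeff_mul,
    HahnSeries.coeff_mul_left' f.isPWO_support (mapCoeff_support c f),
    HahnSeries.coeff_mul_right' g.isPWO_support (mapCoeff_support c g), map_sum,
    ← Finset.sum_add_distrib]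
  refine Finset.sum_congr rfl fun ij hij => ?_
  obtain ⟨-, -, rfl⟩ := Finset.mem_antidiagonal.mp hij
  exact hc _ _ _ _

/-- The Euler derivation `z d/dz = - s d/ds`. -/
def euler (A : Type*) [CommRing A] : LaurentSeries A →+ LaurentSeries A where
  toFun := mapCoeff fun k => AddMonoidHom.mulLeft (-(k : A))
  map_zero' := by ext k; simp [mapCoeff_coeff]
  map_add' f g := by ext k; simp [mapCoeff_coeff, mul_add]

theorem euler_mul (f g : LaurentSeries A) : euler A (f * g) = f * euler A g + euler A f * g := by
  refine mapCoeff_mul (fun i j a b => ?_) f g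
  simp only [AddMonoidHom.coe_mulLeft]
  push_cast
  ring

@[simp]
theorem euler_coeff (f : LaurentSeries A) (k : ℤ) :
    (euler A f).coeff k = -(k : A) * f.coeff k := rfl

theorem euler_mem_ordGE {n : ℤ} {f : LaurentSeries A} (hf : f ∈ ordGE A n) :
    euler A f ∈ ordGE A n := fun k hk => by rw [euler_coeff, hf k hk, mul_zero]

theorem euler_single (n : ℤ) (a : A) :
    euler A (HahnSeries.single n a) = HahnSeries.single n (-(n : A) * a) := by
  ext k
  rw [euler_coeff]
  rcases eq_or_ne k n with rfl | h
  · simp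
  · simp [HahnSeries.coeff_single_of_ne h]

theorem euler_C (a : A) : euler A (HahnSeries.C a) = 0 := by
  rw [HahnSeries.C_apply, euler_single]
  simp

theorem euler_one : euler A 1 = 0 := by
  rw [← HahnSeries.C_one, euler_C]

theorem euler_smul (a : A) (f : LaurentSeries A) : euler A (a • f) = a • euler A f := by
  ext k
  simp only [euler_coeff, HahnSeries.coeff_smul, smul_eq_mul]
  ring

theorem euler_pow (f : LaurentSeries A) (n : ℕ) :
    euler A (f ^ n) = n * f ^ (n - 1) * euler A f := by
  induction n with
  | zero => simp [euler_one]
  | succ n ih =>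
    rw [pow_succ, euler_mul, ih]
    rcases n with _ | n
    · simp
    · push_cast
      simp only [pow_succ]
      ring

/-- A derivation of the coefficient ring, applied coefficientwise. -/
def coeffDer {k : Type*} [CommRing k] [Algebra k A] (d : Derivation k A A) :
    LaurentSeries A →+ LaurentSeries A where
  toFun := mapCoeff fun _ => (d : A →ₗ[k] A).toAddMonoidHom
  map_zero' := by ext k; simp [mapCoeff_coeff]
  map_add' f g := by ext k; simp [mapCoeff_coeff]

theorem coeffDer_mul {k : Type*} [CommRing k] [Algebra k A] (d : Derivation k A A)
    (f g : LaurentSeries A) :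
    coeffDer d (f * g) = f * coeffDer d g + coeffDer d f * g :=
  mapCoeff_mul (fun i j a b => by simp [mul_comm]) f g

@[simp]
theorem coeffDer_coeff {k : Type*} [CommRing k] [Algebra k A] (d : Derivation k A A)
    (f : LaurentSeries A) (j : ℤ) : (coeffDer d f).coeff j = d (f.coeff j) := rfl

theorem coeffDer_mem_ordGE {k : Type*} [CommRing k] [Algebra k A] (d : Derivation k A A) {n : ℤ}
    {f : LaurentSeries A} (hf : f ∈ ordGE A n) : coeffDer d f ∈ ordGE A n :=
  fun k hk => by rw [coeffDer_coeff, hf k hk, map_zero]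

theorem coeffDer_single {k : Type*} [CommRing k] [Algebra k A] (d : Derivation k A A) (n : ℤ)
    (a : A) : coeffDer d (HahnSeries.single n a) = HahnSeries.single n (d a) := by
  ext j
  rw [coeffDer_coeff]
  rcases eq_or_ne j n with rfl | h
  · simp
  · simp [HahnSeries.coeff_single_of_ne h]

theorem coeffDer_smul {k : Type*} [CommRing k] [Algebra k A] (d : Derivation k A A) (a : A)
    (f : LaurentSeries A) : coeffDer d (a • f) = a • coeffDer d f + d a • f := by
  ext k
  simp [mul_comm]

theorem coeffDer_euler {k : Type*} [CommRing k] [Algebra k A] (d : Derivation k A A)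
    (f : LaurentSeries A) : coeffDer d (euler A f) = euler A (coeffDer d f) := by
  ext j
  have : d (-(j : A)) = 0 := by rw [map_neg, d.map_intCast, neg_zero]
  simp only [coeffDer_coeff, euler_coeff, Derivation.leibniz, this, smul_eq_mul]
  ring

/-- A ring homomorphism of the coefficients, applied coefficientwise. -/
def coeffHom (ρ : A →+* B) : LaurentSeries A →+* LaurentSeries B where
  toFun f := f.map ρ
  map_one' := HahnSeries.map_one ρ.toMonoidWithZeroHom
  map_mul' f g := HahnSeries.map_mul (ρ : A →ₙ+* B)
  map_zero' := by ext; simp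
  map_add' f g := by ext; simp

@[simp]
theorem coeffHom_coeff (ρ : A →+* B) (f : LaurentSeries A) (j : ℤ) :
    (coeffHom ρ f).coeff j = ρ (f.coeff j) := rfl

theorem coeffHom_single (ρ : A →+* B) (n : ℤ) (a : A) :
    coeffHom ρ (HahnSeries.single n a) = HahnSeries.single n (ρ a) := by
  ext j
  rw [coeffHom_coeff]
  rcases eq_or_ne j n with rfl | h
  · simp
  · simp [HahnSeries.coeff_single_of_ne h]

theorem coeffHom_C (ρ : A →+* B) (a : A) : coeffHom ρ (HahnSeries.C a) = HahnSeries.C (ρ a) :=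
  coeffHom_single ρ 0 a

theorem coeffHom_smul (ρ : A →+* B) (a : A) (f : LaurentSeries A) :
    coeffHom ρ (a • f) = ρ a • coeffHom ρ f := by
  ext j; simp

theorem coeffHom_mem_ordGE (ρ : A →+* B) {n : ℤ} {f : LaurentSeries A} (hf : f ∈ ordGE A n) :
    coeffHom ρ f ∈ ordGE B n := fun k hk => by rw [coeffHom_coeff, hf k hk, map_zero]

theorem coeffHom_euler (ρ : A →+* B) (f : LaurentSeries A) :
    coeffHom ρ (euler A f) = euler B (coeffHom ρ f) := by
  ext j; simp

theorem coeffHom_coeffDer {k : Type*} [CommRing k] [Algebra k A] [Algebra k B] (ρ : A →+* B)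
    (d : Derivation k A A) (d' : Derivation k B B) (h : ∀ a, ρ (d a) = d' (ρ a))
    (f : LaurentSeries A) : coeffHom ρ (coeffDer d f) = coeffDer d' (coeffHom ρ f) := by
  ext j; simp [h]

/-- Elimination against a family of monic series `P k` of degree `k`, keeping track of an exhaustive
family of subrings containing the coefficients. -/
theorem exists_elim_of_mem {P : ℕ → LaurentSeries A} (hP : ∀ k : ℕ, P k ∈ ordGE A (-k))
    (hP1 : ∀ k : ℕ, (P k).coeff (-k) = 1) {S : ℤ → Subring A} (hS : Monotone S)
    (hPS : ∀ (k : ℕ) (j : ℤ), (P k).coeff j ∈ S (k + j)) (n : ℕ) :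
    ∀ d : ℤ, n ≤ d → ∀ F ∈ ordGE A (-n), (∀ j, F.coeff j ∈ S (d + j)) →
      ∃ b : ℕ → A, (∀ k ≤ n, b k ∈ S (d - k)) ∧ b n = F.coeff (-n) ∧
        F - ∑ k ∈ Finset.range (n + 1), b k • P k ∈ ordGE A 1 := by
  have step (n : ℕ) (F : LaurentSeries A) (hF : F ∈ ordGE A (-n)) :
      F - F.coeff (-n) • P n ∈ ordGE A (-n + 1) :=
    ordGE_succ (sub_mem hF (Submodule.smul_mem _ _ (hP n))) (by simp [hP1])
  induction n with
  | zero =>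
    intro d hd F hF hFS
    refine ⟨fun _ => F.coeff 0, fun k hk => ?_, by simp, ?_⟩
    · have : k = 0 := by lia
      subst this
      simpa using hFS 0
    · simpa using step 0 F hF
  | succ n ih =>
    intro d hd F hF hFS
    have hb : F.coeff (-(n + 1 : ℕ)) ∈ S (d - (n + 1 : ℕ)) := hFS _
    obtain ⟨b, hb1, -, hb3⟩ := ih d (by lia) (F - F.coeff (-(n + 1 : ℕ)) • P (n + 1))
      (by convert step (n + 1) F hF using 1; push_cast; ring_nf) (fun j => by
        rw [HahnSeries.coeff_sub, HahnSeries.coeff_smul, smul_eq_mul]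
        refine sub_mem (hFS j) ?_
        -- Below degree `-(n+1)` the series `P (n+1)` has no coefficients. Above it, both factors
        -- lie in `S (d + j)` by monotonicity, the second one because `n + 1 ≤ d`.
        rcases lt_or_ge j (-(n + 1 : ℕ)) with h | h
        · rw [hP _ j h, mul_zero]
          exact zero_mem _
        · exact mul_mem (hS (by lia) hb) (hS (by lia) (hPS (n + 1) j)))
    refine ⟨fun k => if k ≤ n then b k else F.coeff (-(n + 1 : ℕ)), fun k hk => ?_, by simp, ?_⟩
    · dsimp only
      split_ifs with h
      · exact hb1 k h
      · obtain rfl : k = n + 1 := by lia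
        exact hb
    · rw [Finset.sum_range_succ]
      dsimp only
      rw [if_neg (by lia), Finset.sum_congr rfl (g := fun k => b k • P k)]
      · convert hb3 using 1
        abel
      · intro k hk
        rw [if_pos (by simpa [Nat.lt_succ_iff] using hk)]

theorem exists_elim {P : ℕ → LaurentSeries A} (hP : ∀ k : ℕ, P k ∈ ordGE A (-k))
    (hP1 : ∀ k : ℕ, (P k).coeff (-k) = 1) (n : ℕ) {F : LaurentSeries A} (hF : F ∈ ordGE A (-n)) :
    ∃ b : ℕ → A, b n = F.coeff (-n) ∧
      F - ∑ k ∈ Finset.range (n + 1), b k • P k ∈ ordGE A 1 := by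
  obtain ⟨b, -, hb⟩ := exists_elim_of_mem hP hP1 (S := fun _ => ⊤) monotone_const
    (fun _ _ => trivial) n n le_rfl F hF (fun _ => trivial)
  exact ⟨b, hb⟩

/-- The coefficient of the top degree comes only from the last, monic series, so the `b k` vanish
from the top down. -/
theorem eq_zero_of_sum_mem {P : ℕ → LaurentSeries A} (hP : ∀ k : ℕ, P k ∈ ordGE A (-k))
    (hP1 : ∀ k : ℕ, (P k).coeff (-k) = 1) {b : ℕ → A} (n : ℕ)
    (h : ∑ k ∈ Finset.range n, b k • P k ∈ ordGE A 1) : ∀ k < n, b k = 0 := by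
  induction n with
  | zero => intro k hk; lia
  | succ n ih =>
    have hn : b n = 0 := by
      have h0 := h (-n) (by lia)
      rw [Finset.sum_range_succ, HahnSeries.coeff_add, HahnSeries.coeff_sum,
        Finset.sum_eq_zero, zero_add, HahnSeries.coeff_smul, hP1, smul_eq_mul, mul_one] at h0
      · exact h0
      · intro k hk
        rw [HahnSeries.coeff_smul, hP k _ (by have := Finset.mem_range.mp hk; lia), smul_zero]
    rw [Finset.sum_range_succ, hn, zero_smul, add_zero] at h
    intro k hk
    rcases (show k < n ∨ k = n by lia) with h' | rfl
    exacts [ih h k h', hn]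

/-- Integration by parts. The constant term of `f · θ(g)` is the coefficient of `z⁻¹` in `f dg/dz`,
and this is how residues are written below; the constant term of `θ(f g)` vanishes. -/
theorem coeff_zero_mul_euler (f g : LaurentSeries A) :
    (f * euler A g).coeff 0 = -(euler A f * g).coeff 0 := by
  have h := congrArg (fun x : LaurentSeries A => x.coeff 0) (euler_mul f g)
  simp only [euler_coeff, Int.cast_zero, neg_zero, zero_mul, HahnSeries.coeff_add] at h
  linear_combination -h

end Laurent

/-! ### Differentiation of substituted power series. -/

section ChainRule

open MvPowerSeries MvPowerSeries.WithPiTopology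

variable {σ ι k : Type*} [CommRing k]

theorem eq_of_forall_coe [UniformSpace k] {X : Type*} [TopologicalSpace X] [T2Space X]
    {f g : MvPowerSeries σ k → X} (hf : Continuous f) (hg : Continuous g)
    (h : ∀ P : MvPolynomial σ k, f P = g P) : f = g :=
  DenseRange.equalizer denseRange_toMvPowerSeries hf hg (funext h)

theorem continuous_pderiv [TopologicalSpace k] [IsTopologicalSemiring k] (i : σ) :
    Continuous (pderiv k i : MvPowerSeries σ k → MvPowerSeries σ k) := by
  refine continuous_pi fun d => ?_
  change Continuous fun F : MvPowerSeries σ k => coeff d (pderiv k i F)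
  simp_rw [coeff_pderiv]
  exact (continuous_coeff k _).mul continuous_const

/-- If a substitution depends on the variable `j` through the variable `i` only, with derivative
`1`, then differentiation with respect to `j` after substitution is substitution after
differentiation with respect to `i`. -/
theorem pderiv_subst_of_pderiv_eq_single [DecidableEq σ] {a : σ → MvPowerSeries ι k}
    (ha : HasSubst a) (j : ι) (b : MvPowerSeries ι k) (i : σ)
    (h : ∀ l, pderiv k j (a l) = if l = i then b else 0) (F : MvPowerSeries σ k) :
    pderiv k j (subst a F) = b * subst a (pderiv k i F) := by
  -- With discrete coefficients, substitution and differentiation are continuous and polynomials are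
  -- dense, so the identity need only be checked on polynomials.
  let : UniformSpace k := ⊥
  have : DiscreteUniformity k := ⟨rfl⟩
  have : DiscreteTopology k := inferInstance
  refine congrFun (eq_of_forall_coe (f := fun F => pderiv k j (subst a F))
    (g := fun F => b * subst a (pderiv k i F)) ?_ ?_ ?_) F
  · exact (continuous_pderiv j).comp (continuous_subst ha)
  · exact continuous_const.mul ((continuous_subst ha).comp (continuous_pderiv i))
  · intro P
    simp only [pderiv_coe, ← substAlgHom_apply ha, substAlgHom_coe]
    induction P using MvPolynomial.induction_on with
    | C c =>
      rw [MvPolynomial.pderiv_C, map_zero, mul_zero, MvPolynomial.aeval_C,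
        Derivation.map_algebraMap]
    | add P Q hP hQ => simp only [map_add, hP, hQ, mul_add]
    | mul_X P l hP =>
      simp only [map_mul, Derivation.leibniz, MvPolynomial.aeval_X, h, hP, smul_eq_mul, map_add,
        MvPolynomial.pderiv_X, Pi.single_apply]
      rcases eq_or_ne l i with rfl | hl
      · simp; ring
      · simp [hl]; ring

theorem coeff_derivative_eq (P : PowerSeries k) :
    MvPowerSeries.pderiv k () P = PowerSeries.derivative k P := by
  refine PowerSeries.ext fun n => ?_
  rw [PowerSeries.coeff_derivative, PowerSeries.coeff, MvPowerSeries.coeff_pderiv,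
    PowerSeries.coeff, ← Finsupp.single_add]
  simp

end ChainRule

/-! ### The logarithm of a power series with constant term one. -/

section Log

open MvPowerSeries

variable {σ : Type}

theorem hasSubst_sub_one {F : MvPowerSeries σ ℂ} (hF : constantCoeff F = 1) :
    PowerSeries.HasSubst (F - 1) :=
  PowerSeries.HasSubst.of_constantCoeff_zero (by simp [hF])

theorem constantCoeff_logSeries {F : MvPowerSeries σ ℂ} (hF : constantCoeff F = 1) :
    constantCoeff (logSeries F) = 0 :=
  PowerSeries.constantCoeff_subst_eq_zero (by simp [hF]) _ (by simp)

theorem one_add_X_mul_derivative_log :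
    (1 + PowerSeries.X) * PowerSeries.derivative ℂ (PowerSeries.log ℂ) = 1 := by
  rw [PowerSeries.deriv_log]
  ext n
  rw [add_mul, one_mul, map_add]
  rcases n with _ | n
  · simp
  · simp [PowerSeries.coeff_succ_X_mul, pow_succ, PowerSeries.coeff_one]

/-- Substitution of `F - 1` into `(1 + X) log'(1 + X) = 1`, together with the chain rule. Only this
logarithmic derivative and the vanishing constant term of `logSeries` are used later. -/
theorem mul_pderiv_logSeries {F : MvPowerSeries σ ℂ} (hF : constantCoeff F = 1) (i : σ) :
    F * pderiv ℂ i (logSeries F) = pderiv ℂ i F := by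
  have h := pderiv_subst_of_pderiv_eq_single (hasSubst_sub_one hF).const i (pderiv ℂ i F) ()
    (fun l => by simp) (PowerSeries.log ℂ)
  change pderiv ℂ i (logSeries F) = _ at h
  rw [h, coeff_derivative_eq]
  change F * (_ * PowerSeries.subst (F - 1) (PowerSeries.derivative ℂ (PowerSeries.log ℂ))) = _
  have h1 := congrArg (PowerSeries.subst (F - 1)) one_add_X_mul_derivative_log
  rw [PowerSeries.subst_mul (hasSubst_sub_one hF), PowerSeries.subst_add (hasSubst_sub_one hF),
    PowerSeries.subst_X (hasSubst_sub_one hF), ← map_one PowerSeries.C, PowerSeries.subst_C,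
    map_one, add_sub_cancel] at h1
  linear_combination (pderiv ℂ i F) * h1

end Log

/-! ### The shift `τ(t + ε [s])` and its derivative in `s`. -/

section Shift

open MvPowerSeries

/-- The substitution defining `shiftJoint`. -/
def shiftSubst (ε : ℂ) (i : ℕ+) : MvPowerSeries (Option ℕ+) ℂ :=
  X (some i) + C (ε / ((i : ℕ) : ℂ)) * X none ^ (i : ℕ)

/-- A given monomial occurs in the image of `t_i` only if it contains `t_i` or its exponent of `s`
equals `i`, which leaves finitely many `i`. -/
theorem hasSubst_shiftSubst (ε : ℂ) : HasSubst (shiftSubst ε) where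
  const_coeff i := by simp [shiftSubst]
  coeff_zero d := by
    refine Set.Finite.subset (s := {i : ℕ+ | i ∈ d.some.support ∨ (i : ℕ) = d none}) ?_ ?_
    · refine (Finset.finite_toSet d.some.support).union ?_
      refine Set.Subsingleton.finite fun i hi j hj => ?_
      exact PNat.eq (hi.trans hj.symm)
    · intro i hi
      by_contra h
      simp only [Set.mem_ofPred_eq, not_or] at h
      apply hi
      have h1 : coeff d (X (some i) : MvPowerSeries (Option ℕ+) ℂ) = 0 := by
        classical
        rw [coeff_X, if_neg]
        rintro rfl
        exact h.1 (by simp)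
      have h2 : coeff d (X none ^ (i : ℕ) : MvPowerSeries (Option ℕ+) ℂ) = 0 := by
        classical
        rw [coeff_X_pow, if_neg]
        rintro rfl
        exact h.2 (by simp)
      rw [shiftSubst, map_add, h1, coeff_C_mul, h2, mul_zero, add_zero]

theorem shiftJoint_eq (ε : ℂ) (F : MvPowerSeries ℕ+ ℂ) :
    shiftJoint ε F = subst (shiftSubst ε) F := rfl

theorem pderiv_some_shiftSubst (ε : ℂ) (j l : ℕ+) :
    pderiv ℂ (some j) (shiftSubst ε l) = if l = j then 1 else 0 := by
  classical
  rw [shiftSubst, map_add, Derivation.leibniz, pderiv_C, Derivation.leibniz_pow,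
    pderiv_X_of_ne (show none ≠ some j by simp), pderiv_X, Pi.single_apply]
  simp [eq_comm]

theorem pderiv_none_shiftSubst (ε : ℂ) (l : ℕ+) :
    X none * pderiv ℂ none (shiftSubst ε l) = C ε * X none ^ (l : ℕ) := by
  rw [shiftSubst, map_add, Derivation.leibniz, pderiv_C, Derivation.leibniz_pow,
    pderiv_X_of_ne (by simp), pderiv_X_self]
  simp only [smul_eq_mul, nsmul_eq_mul, mul_one, mul_zero, add_zero, zero_add]
  obtain ⟨n, hn⟩ : ∃ n, (l : ℕ) = n + 1 := ⟨l.natPred, (PNat.natPred_add_one l).symm⟩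
  rw [hn, Nat.add_sub_cancel, pow_succ]
  have : C (ε / ((n + 1 : ℕ) : ℂ)) * ((n + 1 : ℕ) : MvPowerSeries (Option ℕ+) ℂ) = C ε := by
    rw [← map_natCast (C (σ := Option ℕ+) (R := ℂ)), ← map_mul]
    congr 1
    field_simp
  linear_combination (X none * X none ^ n) * this

theorem pderiv_some_shiftJoint (ε : ℂ) (j : ℕ+) (F : MvPowerSeries ℕ+ ℂ) :
    pderiv ℂ (some j) (shiftJoint ε F) = shiftJoint ε (pderiv ℂ j F) := by
  rw [shiftJoint_eq, pderiv_subst_of_pderiv_eq_single (hasSubst_shiftSubst ε) (some j) 1 j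
    (fun l => pderiv_some_shiftSubst ε j l), one_mul, shiftJoint_eq]

/-- The Euler derivation in `s`, minus its expression through the derivations in `t_1, …, t_K`. -/
def shiftDefect (ε : ℂ) (K : ℕ) (G : MvPowerSeries (Option ℕ+) ℂ) : MvPowerSeries (Option ℕ+) ℂ :=
  X none * pderiv ℂ none G -
    ∑ j ∈ Finset.range K, C ε * X none ^ (j + 1) * pderiv ℂ (some j.succPNat) G

theorem shiftDefect_mul (ε : ℂ) (K : ℕ) (G H : MvPowerSeries (Option ℕ+) ℂ) :
    shiftDefect ε K (G * H) = G * shiftDefect ε K H + H * shiftDefect ε K G := by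
  simp only [shiftDefect, Derivation.leibniz, smul_eq_mul, mul_add, mul_sub, Finset.mul_sum,
    Finset.sum_add_distrib]
  rw [Finset.sum_congr rfl fun j _ => mul_left_comm _ G _,
    Finset.sum_congr rfl fun j _ => mul_left_comm _ H _]
  ring

/-- On the image of `t_l` the two sides of the defect are both `ε s^l` when `l ≤ K`. For `l > K` the
sum is empty of contributions and the defect is `ε s^l` itself. -/
theorem shiftDefect_shiftSubst (ε : ℂ) (K : ℕ) (l : ℕ+) :
    X none ^ (K + 1) ∣ shiftDefect ε K (shiftSubst ε l) := by
  rw [shiftDefect, pderiv_none_shiftSubst]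
  simp only [pderiv_some_shiftSubst, mul_ite, mul_one, mul_zero]
  rcases Nat.lt_or_ge K l with h | h
  · rw [Finset.sum_eq_zero, sub_zero]
    · exact (pow_dvd_pow _ h).mul_left _
    · intro j hj
      rw [if_neg]
      rintro rfl
      simp at h hj
      lia
  · rw [Finset.sum_eq_single l.natPred]
    · simp
    · intro j _ hj
      rw [if_neg]
      rintro rfl
      simp at hj
    · intro hl
      have := PNat.natPred_add_one l
      simp at hl
      lia

theorem dvd_shiftDefect_coe (ε : ℂ) (K : ℕ) (P : MvPolynomial ℕ+ ℂ) :
    X none ^ (K + 1) ∣ shiftDefect ε K (shiftJoint ε (P : MvPowerSeries ℕ+ ℂ)) := by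
  rw [shiftJoint_eq, subst_coe]
  induction P using MvPolynomial.induction_on with
  | C c =>
    rw [MvPolynomial.aeval_C, shiftDefect, Derivation.map_algebraMap]
    simp only [Derivation.map_algebraMap]
    simp
  | add P Q hP hQ =>
    convert dvd_add hP hQ using 1
    simp only [shiftDefect, map_add, mul_add, Finset.sum_add_distrib]
    ring
  | mul_X P l hP =>
    rw [map_mul, shiftDefect_mul, MvPolynomial.aeval_X]
    exact dvd_add ((shiftDefect_shiftSubst ε K l).mul_left _) (hP.mul_left _)

end Shift

/-! ### Passage of the shift identity from polynomials to series. -/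

section ShiftContinuity

open MvPowerSeries MvPowerSeries.WithPiTopology

theorem coeff_shiftDefect_eq_zero (ε : ℂ) (K : ℕ) (F : MvPowerSeries ℕ+ ℂ) (d : Option ℕ+ →₀ ℕ)
    (hd : d none ≤ K) : coeff d (shiftDefect ε K (shiftJoint ε F)) = 0 := by
  let : UniformSpace ℂ := ⊥
  have : DiscreteUniformity ℂ := ⟨rfl⟩
  have : DiscreteTopology ℂ := inferInstance
  have hc : Continuous fun F => shiftJoint ε F := continuous_subst (hasSubst_shiftSubst ε)
  refine congrFun (eq_of_forall_coe
    (f := fun F => coeff d (shiftDefect ε K (shiftJoint ε F))) (g := fun _ => 0) ?_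
    continuous_const ?_) F
  · refine (continuous_coeff ℂ d).comp ?_
    refine (continuous_const.mul ((continuous_pderiv none).comp hc)).sub
      (continuous_finsetSum _ fun j _ => ?_)
    exact continuous_const.mul ((continuous_pderiv _).comp hc)
  · intro P
    exact X_pow_dvd_iff.mp (dvd_shiftDefect_coe ε K P) d (by lia)

end ShiftContinuity

/-! ### The shift as a Laurent series in `s` over series in `t`. -/

section ShiftLaurent

open MvPowerSeries MvPowerSeries.WithPiTopology

/-- `τ(t + ε [z⁻¹])` as a Laurent series in `z⁻¹` whose coefficients are power series in `t`. -/
def shiftLaurent (ε : ℂ) : MvPowerSeries ℕ+ ℂ →+* LaurentSeries (MvPowerSeries ℕ+ ℂ) :=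
  (HahnSeries.ofPowerSeries ℤ (MvPowerSeries ℕ+ ℂ)).comp
    ((optionEquivLeft ℕ+ ℂ : MvPowerSeries (Option ℕ+) ℂ →+* _).comp
      (substAlgHom (R := ℂ) (hasSubst_shiftSubst ε) : MvPowerSeries ℕ+ ℂ →+* _))

theorem shiftLaurent_apply (ε : ℂ) (F : MvPowerSeries ℕ+ ℂ) :
    shiftLaurent ε F =
      HahnSeries.ofPowerSeries ℤ (MvPowerSeries ℕ+ ℂ) (optionEquivLeft ℕ+ ℂ (shiftJoint ε F)) := by
  rw [shiftJoint_eq, ← substAlgHom_apply (hasSubst_shiftSubst ε)]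
  rfl

theorem shiftLaurent_mem (ε : ℂ) (F : MvPowerSeries ℕ+ ℂ) : shiftLaurent ε F ∈ ordGE _ 0 := by
  rw [shiftLaurent_apply]
  exact ofPowerSeries_mem _

theorem shiftLaurent_coeff_nat (ε : ℂ) (F : MvPowerSeries ℕ+ ℂ) (n : ℕ) :
    (shiftLaurent ε F).coeff n = PowerSeries.coeff n (optionEquivLeft ℕ+ ℂ (shiftJoint ε F)) := by
  rw [shiftLaurent_apply, ofPowerSeries_coeff_nat]

theorem pderiv_coeff_optionEquivLeft (j : ℕ+) (n : ℕ) (G : MvPowerSeries (Option ℕ+) ℂ) :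
    PowerSeries.coeff n (optionEquivLeft ℕ+ ℂ (pderiv ℂ (some j) G)) =
      pderiv ℂ j (PowerSeries.coeff n (optionEquivLeft ℕ+ ℂ G)) := by
  ext m
  rw [coeff_pderiv, coeff_coeff_optionEquivLeft, coeff_coeff_optionEquivLeft, coeff_pderiv]
  have : (m + Finsupp.single j 1).optionElim n = m.optionElim n + Finsupp.single (some j) 1 := by
    ext (_ | x)
    · simp
    · simp [Finsupp.single_apply]
  rw [this]
  simp

theorem euler_coeff_optionEquivLeft (n : ℕ) (G : MvPowerSeries (Option ℕ+) ℂ) :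
    PowerSeries.coeff n (optionEquivLeft ℕ+ ℂ (X none * pderiv ℂ none G)) =
      n * PowerSeries.coeff n (optionEquivLeft ℕ+ ℂ G) := by
  rw [map_mul, optionEquivLeft_X_none]
  rcases n with _ | n
  · simp
  · rw [PowerSeries.coeff_succ_X_mul]
    ext m
    have : (((n + 1 : ℕ) : MvPowerSeries ℕ+ ℂ)) = C ((n + 1 : ℕ) : ℂ) := by simp
    rw [this, coeff_C_mul, coeff_coeff_optionEquivLeft, coeff_coeff_optionEquivLeft, coeff_pderiv]
    have : m.optionElim n + Finsupp.single none 1 = m.optionElim (n + 1) := by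
      ext (_ | x) <;> simp
    rw [this]
    simp [mul_comm]

theorem coeffDer_shiftLaurent (ε : ℂ) (j : ℕ+) (F : MvPowerSeries ℕ+ ℂ) :
    coeffDer (pderiv ℂ j) (shiftLaurent ε F) = shiftLaurent ε (pderiv ℂ j F) := by
  refine HahnSeries.ext (funext fun n => ?_)
  rw [coeffDer_coeff]
  rcases lt_or_ge n 0 with h | h
  · rw [shiftLaurent_mem ε _ n h, shiftLaurent_mem ε _ n h, map_zero]
  · obtain ⟨n, rfl⟩ := Int.eq_ofNat_of_zero_le h
    rw [shiftLaurent_coeff_nat, shiftLaurent_coeff_nat, ← pderiv_some_shiftJoint,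
      pderiv_coeff_optionEquivLeft]

/-- This is the coefficient of `s^n` in `s ∂_s = ε ∑ s^j ∂_j` acting on the shifted series.
Truncation at the first `n` times loses nothing in this degree. -/
theorem shiftLaurent_recursion (ε : ℂ) (F : MvPowerSeries ℕ+ ℂ) (n : ℕ) :
    (n : ℂ) • (shiftLaurent ε F).coeff n =
      ε • ∑ j ∈ Finset.range n, pderiv ℂ j.succPNat ((shiftLaurent ε F).coeff (n - (j + 1) : ℤ)) := by
  have h0 : PowerSeries.coeff n (optionEquivLeft ℕ+ ℂ (shiftDefect ε n (shiftJoint ε F))) = 0 := by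
    ext m
    rw [coeff_coeff_optionEquivLeft, coeff_shiftDefect_eq_zero _ _ _ _ (by simp), map_zero]
  rw [shiftDefect, map_sub, map_sub, euler_coeff_optionEquivLeft, map_sum (optionEquivLeft ℕ+ ℂ),
    map_sum (PowerSeries.coeff n), sub_eq_zero] at h0
  have hn : (n : ℂ) • (shiftLaurent ε F).coeff n =
      n * PowerSeries.coeff n (optionEquivLeft ℕ+ ℂ (shiftJoint ε F)) := by
    rw [shiftLaurent_coeff_nat, smul_eq_C_mul]
    simp
  rw [hn, h0, Finset.smul_sum]
  refine Finset.sum_congr rfl fun j hj => ?_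
  have hj' := Finset.mem_range.mp hj
  rw [map_mul (optionEquivLeft ℕ+ ℂ), map_mul (optionEquivLeft ℕ+ ℂ),
    map_pow (optionEquivLeft ℕ+ ℂ), optionEquivLeft_X_none, optionEquivLeft_C,
    mul_assoc, PowerSeries.coeff_C_mul, smul_eq_C_mul,
    show n = (n - (j + 1)) + (j + 1) by lia, PowerSeries.coeff_X_pow_mul,
    pderiv_coeff_optionEquivLeft, ← shiftLaurent_coeff_nat]
  congr 4
  push_cast
  lia

theorem shiftLaurent_coeff_zero (ε : ℂ) (F : MvPowerSeries ℕ+ ℂ) :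
    (shiftLaurent ε F).coeff 0 = F := by
  let : UniformSpace ℂ := ⊥
  have : DiscreteUniformity ℂ := ⟨rfl⟩
  have : DiscreteTopology ℂ := inferInstance
  have h := shiftLaurent_coeff_nat ε F 0
  rw [Nat.cast_zero] at h
  rw [h]
  refine MvPowerSeries.ext fun m => ?_
  rw [coeff_coeff_optionEquivLeft]
  refine congrFun (eq_of_forall_coe (f := fun F => coeff (m.optionElim 0) (shiftJoint ε F))
    (g := fun F => coeff m F) ?_ (WithPiTopology.continuous_coeff ℂ m) ?_) F
  · exact (WithPiTopology.continuous_coeff ℂ _).comp (continuous_subst (hasSubst_shiftSubst ε))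
  · intro P
    rw [← coeff_coeff_optionEquivLeft, shiftJoint_eq, subst_coe]
    congr 1
    rw [PowerSeries.coeff_zero_eq_constantCoeff_apply]
    induction P using MvPolynomial.induction_on with
    | C c =>
      rw [MvPolynomial.aeval_C, AlgEquiv.commutes, MvPowerSeries.algebraMap_apply,
        MvPolynomial.coe_C]
      exact PowerSeries.constantCoeff_C _
    | add P Q hP hQ => simp only [map_add, hP, hQ, MvPolynomial.coe_add]
    | mul_X P l hP =>
      simp only [map_mul, hP, MvPolynomial.coe_mul, MvPolynomial.aeval_X, MvPolynomial.coe_X]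
      simp [shiftSubst, optionEquivLeft_X_some, optionEquivLeft_X_none]

theorem shift_coeff (ε : ℂ) (F : MvPowerSeries ℕ+ ℂ) (m : ℕ+ →₀ ℕ) (k : ℤ) :
    (coeff m (shift ε F)).coeff k = coeff m ((shiftLaurent ε F).coeff k) := by
  have h : coeff m (shift ε F) = HahnSeries.ofPowerSeries ℤ ℂ (PowerSeries.mk fun k =>
    coeff (m.mapDomain some + Finsupp.single none k) (shiftJoint ε F)) := rfl
  rw [h]
  rcases lt_or_ge k 0 with hk | hk
  · rw [shiftLaurent_mem ε _ k hk, ofPowerSeries_coeff_neg _ hk, map_zero]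
  · obtain ⟨n, rfl⟩ := Int.eq_ofNat_of_zero_le hk
    rw [shiftLaurent_coeff_nat, ofPowerSeries_coeff_nat, PowerSeries.coeff_mk,
      coeff_coeff_optionEquivLeft]
    congr 2
    ext (_ | x)
    · simp [Finsupp.mapDomain_of_notMem_range]
    · rw [Finsupp.add_apply, Finsupp.mapDomain_apply (Option.some_injective _)]
      simp

end ShiftLaurent

/-! ### Vanishing from residue pairings. -/

section Vanishing

variable {A : Type*} [CommRing A]

/-- A series in `O(s)` whose residue pairings with a family of series of all degrees `n ≥ 0` with
regular leading coefficients vanish is zero. -/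
theorem eq_zero_of_pairing {f : LaurentSeries A} (hf : f ∈ ordGE A 1) {ψ : ℕ → LaurentSeries A}
    (hψ : ∀ n : ℕ, ψ n ∈ ordGE A (-n)) (h1 : ∀ n : ℕ, ∀ a, a * (ψ n).coeff (-n) = 0 → a = 0)
    (h : ∀ n, (f * ψ n).coeff 1 = 0) : f = 0 := by
  have key (n : ℕ) : f ∈ ordGE A (n + 1) := by
    induction n with
    | zero => simpa using hf
    | succ n ih =>
      push_cast
      refine ordGE_succ ih (h1 n _ ?_)
      rw [← coeff_mul_lead ih (hψ n), ← h n]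
      congr 1
      lia
  ext k
  exact key k.toNat k (by lia)

end Vanishing

/-! ### Planes moved by the flows. -/

section Plane

open MvPowerSeries

variable {σ : Type*}

/-- Formal Taylor expansion: over `ℂ` each coefficient is, up to a nonzero factor, the value at `0`
of an iterated derivative, which stays in `N`. -/
theorem eq_zero_of_pderiv_stable {N : Set (MvPowerSeries σ ℂ)}
    (h : ∀ r ∈ N, ∀ i, pderiv ℂ i r ∈ N) (h0 : ∀ r ∈ N, constantCoeff r = 0)
    {r : MvPowerSeries σ ℂ} (hr : r ∈ N) : r = 0 := by
  have key (n : ℕ) : ∀ m : σ →₀ ℕ, m.degree = n → ∀ r ∈ N, coeff m r = 0 := by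
    induction n with
    | zero =>
      intro m hm r hr
      rw [Finsupp.degree_eq_zero_iff] at hm
      rw [hm]
      exact h0 r hr
    | succ n ih =>
      intro m hm r hr
      have hm0 : m ≠ 0 := by
        rintro rfl
        simp at hm
      obtain ⟨i, hi⟩ := Finsupp.ne_iff.mp hm0
      have hle : Finsupp.single i 1 ≤ m := by
        rw [Finsupp.single_le_iff]
        exact Nat.one_le_iff_ne_zero.mpr hi
      obtain ⟨m', rfl⟩ := exists_add_of_le hle
      have := ih m' (by simp at hm; lia) _ (h r hr i)
      rw [coeff_pderiv, add_comm m'] at this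
      exact (mul_eq_zero.mp this).resolve_right (by exact_mod_cast Nat.succ_ne_zero (m' i))
  ext m
  exact key _ m rfl r hr

variable (e : σ → ℕ+) (ε : ℂ) (Q : Submodule ℂ (LaurentSeries ℂ))

/-- The operator `∂_i + ε z^(e i)`, that is `∂_i` conjugated by `exp (ε ∑ t_i z^(e i))`. -/
def twist (i : σ) : LaurentSeries (MvPowerSeries σ ℂ) →+ LaurentSeries (MvPowerSeries σ ℂ) :=
  coeffDer (pderiv ℂ i) + AddMonoidHom.mulLeft (HahnSeries.single (-((e i : ℕ) : ℤ)) (C ε))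

theorem twist_apply (i : σ) (f : LaurentSeries (MvPowerSeries σ ℂ)) :
    twist e ε i f =
      coeffDer (pderiv ℂ i) f + HahnSeries.single (-((e i : ℕ) : ℤ)) (C ε) * f := rfl

/-- The value at `t = 0`. -/
abbrev atZero : LaurentSeries (MvPowerSeries σ ℂ) →+* LaurentSeries ℂ :=
  coeffHom (constantCoeff (σ := σ) (R := ℂ))

/-- The series `f` such that all Taylor coefficients of `exp (ε ∑ t_i z^(e i)) f` belong to `Q`. -/
def planeAt : Set (LaurentSeries (MvPowerSeries σ ℂ)) :=
  {f | ∀ w : List σ, atZero (w.foldr (fun i g => twist e ε i g) f) ∈ Q}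

variable {e ε Q}

theorem atZero_mem {f : LaurentSeries (MvPowerSeries σ ℂ)} (hf : f ∈ planeAt e ε Q) :
    atZero f ∈ Q := hf []

theorem twist_mem_planeAt (i : σ) {f : LaurentSeries (MvPowerSeries σ ℂ)}
    (hf : f ∈ planeAt e ε Q) : twist e ε i f ∈ planeAt e ε Q := fun w => by
  simpa [List.foldr_append] using hf (w ++ [i])

/-- `planeAt` is the largest set that is stable under the twisted derivatives and has values at `0`
in `Q`. Membership is always proved by exhibiting a stable set. -/
theorem subset_planeAt {N : Set (LaurentSeries (MvPowerSeries σ ℂ))}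
    (h : ∀ f ∈ N, ∀ i, twist e ε i f ∈ N) (h0 : ∀ f ∈ N, atZero f ∈ Q) : N ⊆ planeAt e ε Q := by
  intro f hf w
  refine h0 _ ?_
  induction w with
  | nil => exact hf
  | cons i w ih => exact h _ ih i

theorem twist_smul (i : σ) (c : MvPowerSeries σ ℂ) (f : LaurentSeries (MvPowerSeries σ ℂ)) :
    twist e ε i (c • f) = c • twist e ε i f + pderiv ℂ i c • f := by
  rw [twist_apply, coeffDer_smul, twist_apply]
  simp only [smul_add, ← HahnSeries.C_mul_eq_smul]
  ring

theorem closure_planeAt_le (N : Set (LaurentSeries (MvPowerSeries σ ℂ)))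
    (h : ∀ f ∈ N, ∀ i, twist e ε i f ∈ AddSubgroup.closure N) (h0 : ∀ f ∈ N, atZero f ∈ Q) :
    (AddSubgroup.closure N : Set (LaurentSeries (MvPowerSeries σ ℂ))) ⊆ planeAt e ε Q := by
  refine subset_planeAt (fun f hf i => ?_) fun f hf => ?_
  · induction hf using AddSubgroup.closure_induction with
    | mem f hf => exact h f hf i
    | zero => rw [map_zero]; exact zero_mem _
    | add f g _ _ hf hg => rw [map_add]; exact add_mem hf hg
    | neg f _ hf => rw [map_neg]; exact neg_mem hf
  · induction hf using AddSubgroup.closure_induction with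
    | mem f hf => exact h0 f hf
    | zero => rw [map_zero]; exact zero_mem _
    | add f g _ _ hf hg => rw [map_add]; exact add_mem hf hg
    | neg f _ hf => rw [map_neg]; exact neg_mem hf

/-- By the Leibniz rule, the additive span of the multiples `c • f` with `f` in the moved plane is
again stable. The moved plane is thus a module over power series in `t`. -/
theorem sum_smul_mem_planeAt {ι : Type*} (s : Finset ι) (c : ι → MvPowerSeries σ ℂ)
    {f : ι → LaurentSeries (MvPowerSeries σ ℂ)} (hf : ∀ i ∈ s, f i ∈ planeAt e ε Q) :
    ∑ i ∈ s, c i • f i ∈ planeAt e ε Q := by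
  refine closure_planeAt_le {g | ∃ c : MvPowerSeries σ ℂ, ∃ f ∈ planeAt e ε Q, g = c • f} ?_ ?_
    (sum_mem fun i hi => AddSubgroup.subset_closure ⟨c i, f i, hf i hi, rfl⟩)
  · rintro _ ⟨c, f, hf, rfl⟩ i
    rw [twist_smul]
    exact add_mem (AddSubgroup.subset_closure ⟨_, _, twist_mem_planeAt i hf, rfl⟩)
      (AddSubgroup.subset_closure ⟨_, _, hf, rfl⟩)
  · rintro _ ⟨c, f, hf, rfl⟩
    rw [atZero, coeffHom_smul]
    exact Submodule.smul_mem _ _ (atZero_mem hf)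

theorem smul_mem_planeAt (c : MvPowerSeries σ ℂ) {f : LaurentSeries (MvPowerSeries σ ℂ)}
    (hf : f ∈ planeAt e ε Q) : c • f ∈ planeAt e ε Q := by
  simpa using sum_smul_mem_planeAt (Finset.univ : Finset Unit) (fun _ => c) (f := fun _ => f)
    (fun _ _ => hf)

theorem sub_mem_planeAt {f g : LaurentSeries (MvPowerSeries σ ℂ)}
    (hf : f ∈ planeAt e ε Q) (hg : g ∈ planeAt e ε Q) : f - g ∈ planeAt e ε Q := by
  have := sum_smul_mem_planeAt (Finset.univ : Finset (Fin 2)) ![1, -1] (f := ![f, g])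
    (e := e) (ε := ε) (Q := Q) (by
      intro i _
      fin_cases i
      exacts [hf, hg])
  have h1 : f - g = f + (-1 : MvPowerSeries σ ℂ) • g := by
    rw [← HahnSeries.C_mul_eq_smul, map_neg, map_one]
    ring
  simpa [Fin.sum_univ_two, h1] using this

/-- The opposite exponentials cancel in the product, so a derivative of such a residue is a sum of
two residues of the same kind. At `t = 0` the residue vanishes by the orthogonality of `Q` and `Q'`.
-/
theorem coeff_one_mul_eq_zero {Q' : Submodule ℂ (LaurentSeries ℂ)}
    (hQ : ∀ q ∈ Q, ∀ q' ∈ Q', (q * q').coeff 1 = 0) {f ψ : LaurentSeries (MvPowerSeries σ ℂ)}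
    (hf : f ∈ planeAt e ε Q) (hψ : ψ ∈ planeAt e (-ε) Q') : (f * ψ).coeff 1 = 0 := by
  have hmem : (f * ψ).coeff 1 ∈ {r | ∃ f ∈ planeAt e ε Q,
    ∃ ψ ∈ planeAt e (-ε) Q', r = (f * ψ).coeff 1} := ⟨f, hf, ψ, hψ, rfl⟩
  refine eq_zero_of_pderiv_stable (N := AddSubgroup.closure {r | ∃ f ∈ planeAt e ε Q,
    ∃ ψ ∈ planeAt e (-ε) Q', r = (f * ψ).coeff 1}) ?_ ?_ (AddSubgroup.subset_closure hmem)
  · intro r hr i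
    induction hr using AddSubgroup.closure_induction with
    | mem r hr =>
      obtain ⟨f, hf, ψ, hψ, rfl⟩ := hr
      have : pderiv ℂ i ((f * ψ).coeff 1) =
          (f * twist e (-ε) i ψ).coeff 1 + (twist e ε i f * ψ).coeff 1 := by
        rw [← coeffDer_coeff, coeffDer_mul, ← HahnSeries.coeff_add, twist_apply, twist_apply,
          map_neg, HahnSeries.single_neg]
        congr 1
        ring
      rw [this]
      exact add_mem (AddSubgroup.subset_closure ⟨_, hf, _, twist_mem_planeAt i hψ, rfl⟩)
        (AddSubgroup.subset_closure ⟨_, twist_mem_planeAt i hf, _, hψ, rfl⟩)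
    | zero => rw [map_zero]; exact zero_mem _
    | add f g _ _ hf hg => rw [map_add]; exact add_mem hf hg
    | neg f _ hf => rw [map_neg]; exact neg_mem hf
  · intro r hr
    induction hr using AddSubgroup.closure_induction with
    | mem r hr =>
      obtain ⟨f, hf, ψ, hψ, rfl⟩ := hr
      rw [← coeffHom_coeff, map_mul]
      exact hQ _ (atZero_mem hf) _ (atZero_mem hψ)
    | zero => rw [map_zero]
    | add f g _ _ hf hg => rw [map_add, hf, hg, add_zero]
    | neg f _ hf => rw [map_neg, hf, neg_zero]

theorem iterate_twist_mem_ordGE {i : σ} (hi : e i = 1) {f : LaurentSeries (MvPowerSeries σ ℂ)}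
    (hf : f ∈ ordGE _ 0) (n : ℕ) :
    (twist e ε i)^[n] f ∈ ordGE _ (-n) ∧
      ((twist e ε i)^[n] f).coeff (-n) = C ε ^ n * f.coeff 0 := by
  induction n with
  | zero => simpa using hf
  | succ n ih =>
    have h1 : HahnSeries.single (-1 : ℤ) (C ε) * (twist e ε i)^[n] f ∈
        ordGE (MvPowerSeries σ ℂ) (-(n + 1 : ℕ)) := by
      convert single_mul_mem_ordGE (-1) (C ε) ih.1 using 1
      push_cast
      ring_nf
    rw [Function.iterate_succ_apply', twist_apply, hi]
    refine ⟨add_mem (coeffDer_mem_ordGE _ (ordGE_anti (by push_cast; lia) ih.1)) h1, ?_⟩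
    rw [HahnSeries.coeff_add, coeffDer_coeff, ih.1 _ (by push_cast; lia), map_zero, zero_add,
      PNat.one_coe, Nat.cast_one, HahnSeries.coeff_single_mul,
      show (-(n + 1 : ℕ) - -1 : ℤ) = -n by push_cast; ring, ih.2, pow_succ]
    ring

theorem iterate_twist_mem_planeAt (i : σ) {f : LaurentSeries (MvPowerSeries σ ℂ)}
    (hf : f ∈ planeAt e ε Q) (n : ℕ) : (twist e ε i)^[n] f ∈ planeAt e ε Q := by
  induction n with
  | zero => exact hf
  | succ n ih =>
    rw [Function.iterate_succ_apply']
    exact twist_mem_planeAt i ih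

/-- The twisted derivatives of `χ` along `t_1` give a dual series of each degree `n ≥ 0`, with
leading coefficient `±χ.coeff 0`, and `f` is orthogonal to all of them. Such a leading coefficient
is not a zero divisor. -/
theorem eq_zero_of_mem_planeAt {Q' : Submodule ℂ (LaurentSeries ℂ)}
    (hQ : ∀ q ∈ Q, ∀ q' ∈ Q', (q * q').coeff 1 = 0) {i : σ} (hi : e i = 1)
    {χ : LaurentSeries (MvPowerSeries σ ℂ)} (hχ : χ ∈ planeAt e (-1) Q') (hχ0 : χ ∈ ordGE _ 0)
    (hχ1 : χ.coeff 0 ≠ 0) {f : LaurentSeries (MvPowerSeries σ ℂ)} (hf : f ∈ planeAt e 1 Q)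
    (hf1 : f ∈ ordGE _ 1) : f = 0 := by
  refine eq_zero_of_pairing hf1 (ψ := fun n => (twist e (-1) i)^[n] χ)
    (fun n => (iterate_twist_mem_ordGE hi hχ0 n).1) (fun n a ha => ?_)
    fun n => coeff_one_mul_eq_zero hQ hf (iterate_twist_mem_planeAt i hχ n)
  rw [(iterate_twist_mem_ordGE hi hχ0 n).2] at ha
  have h2 : (C (-1 : ℂ) : MvPowerSeries σ ℂ) ^ n ≠ 0 :=
    pow_ne_zero _ (by simp [map_neg])
  exact (mul_eq_zero.mp ha).resolve_right (mul_ne_zero h2 hχ1)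

end Plane

/-! ### Restriction to a subset of the times. -/

section Restriction

open MvPowerSeries

variable {σ ι : Type*} (j : σ ↪ ι)

theorem pderiv_killCompl (i : σ) (F : MvPowerSeries ι ℂ) :
    killCompl j (pderiv ℂ (j i) F) = pderiv ℂ i (killCompl j F) := by
  ext m
  rw [coeff_killCompl, coeff_pderiv, coeff_pderiv, coeff_killCompl, Finsupp.embDomain_add,
    Finsupp.embDomain_single, Finsupp.embDomain_apply_self]

/-- The restriction of the times, applied coefficientwise. -/
abbrev restrictLaurent : LaurentSeries (MvPowerSeries ι ℂ) →+* LaurentSeries (MvPowerSeries σ ℂ) :=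
  coeffHom (killCompl (R := ℂ) j : MvPowerSeries ι ℂ →+* MvPowerSeries σ ℂ)

theorem restrictLaurent_coeffDer (i : σ) (f : LaurentSeries (MvPowerSeries ι ℂ)) :
    restrictLaurent j (coeffDer (pderiv ℂ (j i)) f) = coeffDer (pderiv ℂ i) (restrictLaurent j f) :=
  coeffHom_coeffDer _ _ _ (fun a => pderiv_killCompl j i a) f

theorem constantCoeff_killCompl (F : MvPowerSeries ι ℂ) :
    constantCoeff (killCompl j F) = constantCoeff F := by
  rw [← coeff_zero_eq_constantCoeff_apply, coeff_killCompl, Finsupp.embDomain_zero,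
    coeff_zero_eq_constantCoeff_apply]

theorem restrictLaurent_mem_planeAt {e : ι → ℕ+} {ε : ℂ} {Q : Submodule ℂ (LaurentSeries ℂ)}
    {f : LaurentSeries (MvPowerSeries ι ℂ)} (hf : f ∈ planeAt e ε Q) :
    restrictLaurent j f ∈ planeAt (fun i => e (j i)) ε Q := by
  refine subset_planeAt (N := restrictLaurent j '' planeAt e ε Q) ?_ ?_ ⟨f, hf, rfl⟩
  · rintro _ ⟨f, hf, rfl⟩ i
    refine ⟨_, twist_mem_planeAt (j i) hf, ?_⟩
    rw [twist_apply, map_add, restrictLaurent_coeffDer, map_mul, twist_apply, coeffHom_single]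
    congr 3
    exact killCompl_C ε
  · rintro _ ⟨f, hf, rfl⟩
    have : atZero (restrictLaurent j f) = atZero f := by
      ext k
      exact constantCoeff_killCompl j (f.coeff k)
    rw [this]
    exact atZero_mem hf

end Restriction

open MvPowerSeries

/-! ### The exponential of a linear form in the times. -/

section ExpLinear

theorem natCast_add_one_eq (n : ℕ) : (n : LaurentSeries ℂ) + 1 = HahnSeries.C ((n : ℂ) + 1) := by
  rw [map_add, map_natCast, map_one]

theorem coeff_expLinear (c : ℕ+ → LaurentSeries ℂ) (m : ℕ+ →₀ ℕ) :
    coeff m (expLinear c) = m.prod fun i k => HahnSeries.C ((k ! : ℂ)⁻¹) * c i ^ k := rfl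

theorem constantCoeff_expLinear (c : ℕ+ → LaurentSeries ℂ) :
    constantCoeff (expLinear c) = 1 := by
  rw [← coeff_zero_eq_constantCoeff_apply, coeff_expLinear, Finsupp.prod_zero_index]

theorem pderiv_expLinear (c : ℕ+ → LaurentSeries ℂ) (i : ℕ+) :
    pderiv (LaurentSeries ℂ) i (expLinear c) = C (c i) * expLinear c := by
  ext m : 1
  rw [coeff_pderiv, coeff_C_mul, coeff_expLinear, coeff_expLinear,
    ← Finsupp.mul_prod_erase' (m + Finsupp.single i 1) i _ (by simp),
    ← Finsupp.mul_prod_erase' m i _ (by simp)]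
  have h1 : (m + Finsupp.single i 1).erase i = m.erase i := by
    rw [Finsupp.erase_add, Finsupp.erase_single, add_zero]
  have h2 : (m + Finsupp.single i 1 : ℕ+ →₀ ℕ) i = m i + 1 := by simp
  rw [h1, h2, pow_succ]
  have h3 : (HahnSeries.C (((m i + 1)! : ℂ)⁻¹) : LaurentSeries ℂ) * ((m i : LaurentSeries ℂ) + 1) =
      HahnSeries.C (((m i)! : ℂ)⁻¹) := by
    rw [natCast_add_one_eq, ← map_mul, Nat.factorial_succ]
    congr 1
    have : ((m i)! : ℂ) ≠ 0 := by exact_mod_cast Nat.factorial_ne_zero _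
    have : (m i : ℂ) + 1 ≠ 0 := by exact_mod_cast Nat.succ_ne_zero (m i)
    push_cast
    field_simp
  rw [← h3]
  ring

end ExpLinear

/-! ### Exchanging the roles of `t` and `z`. -/

section Outer

variable {σ : Type*}

/-- The interchange of Laurent series in `z⁻¹` over series in `t` with series in `t` over Laurent
series in `z⁻¹`. -/
def outer (F : LaurentSeries (MvPowerSeries σ ℂ)) : MvPowerSeries σ (LaurentSeries ℂ) :=
  fun m => F.map (coeff m : MvPowerSeries σ ℂ →ₗ[ℂ] ℂ)

theorem outer_coeff (F : LaurentSeries (MvPowerSeries σ ℂ)) (m : σ →₀ ℕ) (k : ℤ) :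
    (coeff m (outer F)).coeff k = coeff m (F.coeff k) := rfl

theorem outer_add (F G : LaurentSeries (MvPowerSeries σ ℂ)) :
    outer (F + G) = outer F + outer G := by
  ext m k
  rfl

theorem outer_coeffDer (i : σ) (F : LaurentSeries (MvPowerSeries σ ℂ)) :
    outer (coeffDer (pderiv ℂ i) F) = pderiv (LaurentSeries ℂ) i (outer F) := by
  ext m k
  rw [outer_coeff, coeffDer_coeff, coeff_pderiv, coeff_pderiv, natCast_add_one_eq, mul_comm _ (HahnSeries.C _),
    HahnSeries.C_mul_eq_smul, HahnSeries.coeff_smul, outer_coeff, smul_eq_mul, mul_comm]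

theorem outer_single_mul (n : ℤ) (a : ℂ) (F : LaurentSeries (MvPowerSeries σ ℂ)) :
    outer (HahnSeries.single n (C a) * F) = C (HahnSeries.single n a) * outer F := by
  ext m k
  rw [outer_coeff, coeff_C_mul, HahnSeries.coeff_single_mul, HahnSeries.coeff_single_mul,
    coeff_C_mul, outer_coeff]

theorem outer_smul (c : MvPowerSeries σ ℂ) (F : LaurentSeries (MvPowerSeries σ ℂ)) :
    outer (c • F) = map HahnSeries.C c * outer F := by
  classical
  ext m k
  rw [outer_coeff, HahnSeries.coeff_smul, coeff_mul, smul_eq_mul, coeff_mul, HahnSeries.coeff_sum]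
  refine Finset.sum_congr rfl fun x _ => ?_
  rw [coeff_map, HahnSeries.C_mul_eq_smul, HahnSeries.coeff_smul, outer_coeff, smul_eq_mul]

theorem shift_eq_outer (ε : ℂ) (F : MvPowerSeries ℕ+ ℂ) : shift ε F = outer (shiftLaurent ε F) := by
  ext m k
  rw [shift_coeff, outer_coeff]

theorem pderiv_expLinear_mul_outer (ε : ℂ) (i : ℕ+) (F : LaurentSeries (MvPowerSeries ℕ+ ℂ)) :
    pderiv (LaurentSeries ℂ) i
        (expLinear (fun i => HahnSeries.single (-((i : ℕ) : ℤ)) ε) * outer F) =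
      expLinear (fun i => HahnSeries.single (-((i : ℕ) : ℤ)) ε) * outer (twist id ε i F) := by
  rw [Derivation.leibniz, pderiv_expLinear, twist_apply, outer_add, outer_coeffDer,
    outer_single_mul]
  simp only [smul_eq_mul, id]
  ring

theorem factorial_smul_coeff_single (i : σ) (n : ℕ) (G : MvPowerSeries σ (LaurentSeries ℂ)) :
    (n ! : ℂ) • coeff (Finsupp.single i n) G =
      constantCoeff ((fun G => pderiv (LaurentSeries ℂ) i G)^[n] G) := by
  induction n generalizing G with
  | zero => simp
  | succ n ih =>
    rw [Function.iterate_succ_apply, ← ih, coeff_pderiv, Finsupp.single_eq_same, natCast_add_one_eq,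
      mul_comm _ (HahnSeries.C _), HahnSeries.C_mul_eq_smul, ← mul_smul, ← Finsupp.single_add,
      Nat.factorial_succ]
    push_cast
    rw [mul_comm]

theorem factorial_smul_coeff_expLinear_mul_outer (ε : ℂ) (n : ℕ)
    (F : LaurentSeries (MvPowerSeries ℕ+ ℂ)) :
    (n ! : ℂ) • coeff (Finsupp.single 1 n)
        (expLinear (fun i => HahnSeries.single (-((i : ℕ) : ℤ)) ε) * outer F) =
      atZero ((twist id ε 1)^[n] F) := by
  rw [factorial_smul_coeff_single]
  have : (fun G => pderiv (LaurentSeries ℂ) (1 : ℕ+) G)^[n]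
      (expLinear (fun i => HahnSeries.single (-((i : ℕ) : ℤ)) ε) * outer F) =
      expLinear (fun i => HahnSeries.single (-((i : ℕ) : ℤ)) ε) *
        outer ((twist id ε 1)^[n] F) := by
    induction n with
    | zero => rfl
    | succ n ih =>
      rw [Function.iterate_succ_apply', ih, pderiv_expLinear_mul_outer,
        Function.iterate_succ_apply']
  rw [this, map_mul, constantCoeff_expLinear, one_mul]
  rfl

theorem mem_planeAt_of_coeff_mem {ε : ℂ} {Q : Submodule ℂ (LaurentSeries ℂ)}
    {F : LaurentSeries (MvPowerSeries ℕ+ ℂ)}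
    (h : ∀ m, coeff m (expLinear (fun i => HahnSeries.single (-((i : ℕ) : ℤ)) ε) * outer F) ∈ Q) :
    F ∈ planeAt id ε Q := by
  refine subset_planeAt (N := {F | ∀ m, coeff m
    (expLinear (fun i => HahnSeries.single (-((i : ℕ) : ℤ)) ε) * outer F) ∈ Q}) ?_ ?_ h
  · intro F hF i m
    rw [← pderiv_expLinear_mul_outer, coeff_pderiv, natCast_add_one_eq, mul_comm, HahnSeries.C_mul_eq_smul]
    exact Q.smul_mem _ (hF _)
  · intro F hF
    have := hF 0
    rwa [coeff_zero_eq_constantCoeff_apply, map_mul, constantCoeff_expLinear, one_mul] at this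

end Outer

/-! ### The plane of a KP tau function. -/

section KPTau

variable {τ : MvPowerSeries ℕ+ ℂ}

theorem wavePlusNum_eq (τ : MvPowerSeries ℕ+ ℂ) : wavePlusNum τ =
    expLinear (fun i => HahnSeries.single (-((i : ℕ) : ℤ)) 1) * outer (shiftLaurent (-1) τ) := by
  rw [wavePlusNum, shift_eq_outer]
  rfl

theorem waveMinusNum_eq (τ : MvPowerSeries ℕ+ ℂ) : waveMinusNum τ =
    expLinear (fun i => HahnSeries.single (-((i : ℕ) : ℤ)) (-1)) * outer (shiftLaurent 1 τ) := by
  rw [waveMinusNum, shift_eq_outer]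
  simp only [zpow, HahnSeries.single_neg]

/-- `τ(t - [z⁻¹]) / τ(t)`. -/
def waveLaurent (τ : MvPowerSeries ℕ+ ℂ) : LaurentSeries (MvPowerSeries ℕ+ ℂ) :=
  τ⁻¹ • shiftLaurent (-1) τ

theorem wavePlus_eq (hτ : constantCoeff τ = 1) : wavePlus τ =
    expLinear (fun i => HahnSeries.single (-((i : ℕ) : ℤ)) 1) * outer (waveLaurent τ) := by
  have h : (map HahnSeries.C τ : MvPowerSeries ℕ+ (LaurentSeries ℂ))⁻¹ = map HahnSeries.C τ⁻¹ := by
    rw [MvPowerSeries.inv_eq_iff_mul_eq_one (by simp [hτ]), ← map_mul,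
      MvPowerSeries.inv_mul_cancel _ (by simp [hτ]), map_one]
  rw [wavePlus, wavePlusNum_eq, h, waveLaurent, outer_smul]
  ring

theorem planePlus_eq (hτ : constantCoeff τ = 1) : planePlus τ =
    Submodule.span ℂ (Set.range fun n : ℕ => atZero ((twist id 1 1)^[n] (waveLaurent τ))) := by
  simp only [planePlus, wavePlus_eq hτ, factorial_smul_coeff_expLinear_mul_outer]

theorem waveLaurent_mem (τ : MvPowerSeries ℕ+ ℂ) : waveLaurent τ ∈ ordGE _ 0 :=
  Submodule.smul_mem _ _ (shiftLaurent_mem _ _)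

theorem waveLaurent_coeff_zero (hτ : constantCoeff τ = 1) : (waveLaurent τ).coeff 0 = 1 := by
  rw [waveLaurent, HahnSeries.coeff_smul, shiftLaurent_coeff_zero, smul_eq_mul,
    MvPowerSeries.inv_mul_cancel _ (by simp [hτ])]

/-- The orthogonal complement of a space of Laurent series under the residue pairing. -/
def resPerp (Q : Set (LaurentSeries ℂ)) : Submodule ℂ (LaurentSeries ℂ) where
  carrier := {g | ∀ h ∈ Q, (g * h).coeff 1 = 0}
  add_mem' hf hg h hh := by rw [add_mul, HahnSeries.coeff_add, hf h hh, hg h hh, add_zero]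
  zero_mem' h _ := by rw [zero_mul, HahnSeries.coeff_zero]
  smul_mem' c f hf h hh := by
    rw [← HahnSeries.C_mul_eq_smul, mul_assoc, HahnSeries.C_mul_eq_smul, HahnSeries.coeff_smul,
      hf h hh, smul_zero]

/-- The plane is defined by derivatives in `t_1` alone. This description replaces it by a condition
involving all times, and thereby puts every Taylor coefficient of `Ψ⁺` in the plane. The bilinear
identity is the inclusion of the span in the complement; the converse is a count of degrees on both
sides. -/
theorem planePlus_eq_resPerp (hτ : IsKPTau τ) :
    planePlus τ = resPerp (Set.range fun m => coeff m (waveMinusNum τ)) := by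
  have hv : waveLaurent τ ∈ planeAt id 1
      (resPerp (Set.range fun m => coeff m (waveMinusNum τ))) := by
    refine smul_mem_planeAt _ (mem_planeAt_of_coeff_mem fun m => ?_)
    rintro _ ⟨m', rfl⟩
    rw [← wavePlusNum_eq]
    exact hτ.2 m m'
  have hP (n : ℕ) := iterate_twist_mem_ordGE (e := id) (ε := 1) (i := (1 : ℕ+)) rfl
    (waveLaurent_mem τ) n
  have hvn (n : ℕ) : atZero ((twist id 1 1)^[n] (waveLaurent τ)) ∈
      resPerp (Set.range fun m => coeff m (waveMinusNum τ)) :=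
    atZero_mem (iterate_twist_mem_planeAt 1 hv n)
  rw [planePlus_eq hτ.1]
  refine le_antisymm (Submodule.span_le.mpr ?_) fun g hg => ?_
  · rintro _ ⟨n, rfl⟩
    exact hvn n
  obtain ⟨n, hn⟩ : ∃ n : ℕ, g ∈ ordGE ℂ (-n) := by
    by_cases h : g = 0
    · exact ⟨0, h ▸ zero_mem _⟩
    · refine ⟨g.order.natAbs, fun k hk => HahnSeries.coeff_eq_zero_of_lt_order (by lia)⟩
  -- The spanning series are monic of degrees `0, 1, 2, …`, so a combination of them agrees with `g`
  -- up to `O(s)`.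
  obtain ⟨b, -, hb⟩ := exists_elim (P := fun n => atZero ((twist id 1 1)^[n] (waveLaurent τ)))
    (fun k => coeffHom_mem_ordGE _ (hP k).1)
    (fun k => by
      rw [coeffHom_coeff, (hP k).2, waveLaurent_coeff_zero hτ.1]
      simp) n hn
  have hsum : ∑ k ∈ Finset.range (n + 1), b k • atZero ((twist id 1 1)^[k] (waveLaurent τ)) ∈
      Submodule.span ℂ (Set.range fun n : ℕ => atZero ((twist id 1 1)^[n] (waveLaurent τ))) :=
    sum_mem fun k _ => Submodule.smul_mem _ _ (Submodule.subset_span ⟨k, rfl⟩)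
  have hsum' : ∑ k ∈ Finset.range (n + 1), b k • atZero ((twist id 1 1)^[k] (waveLaurent τ)) ∈
      resPerp (Set.range fun m => coeff m (waveMinusNum τ)) :=
    sum_mem fun k _ => Submodule.smul_mem _ _ (hvn k)
  have hS (n : ℕ) := iterate_twist_mem_ordGE (e := id) (ε := -1) (i := (1 : ℕ+)) rfl
    (shiftLaurent_mem 1 τ) n
  -- The remainder is orthogonal to the `t_1`-derivatives of `τ Ψ⁻` at the origin. These have every
  -- degree `n ≥ 0` and leading coefficient `±1`, because `τ(0) = 1`.
  have h0 := eq_zero_of_pairing hb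
    (ψ := fun n => atZero ((twist id (-1) 1)^[n] (shiftLaurent 1 τ)))
    (fun n => coeffHom_mem_ordGE _ (hS n).1) (fun n a ha => by
      rw [coeffHom_coeff, (hS n).2, shiftLaurent_coeff_zero, map_mul, hτ.1] at ha
      simpa using ha) (fun n => by
      rw [← factorial_smul_coeff_expLinear_mul_outer, ← waveMinusNum_eq,
        ← HahnSeries.C_mul_eq_smul, mul_left_comm, HahnSeries.C_mul_eq_smul, HahnSeries.coeff_smul,
        (sub_mem hg hsum') _ ⟨_, rfl⟩, smul_zero])
  rw [sub_eq_zero.mp h0]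
  exact hsum

theorem waveLaurent_mem_planeAt (hτ : IsKPTau τ) : waveLaurent τ ∈ planeAt id 1 (planePlus τ) := by
  rw [planePlus_eq_resPerp hτ]
  refine smul_mem_planeAt _ (mem_planeAt_of_coeff_mem fun m => ?_)
  rintro _ ⟨m', rfl⟩
  rw [← wavePlusNum_eq]
  exact hτ.2 m m'

theorem shiftLaurent_mem_planeAt (hτ : IsKPTau τ) :
    shiftLaurent 1 τ ∈ planeAt id (-1) (resPerp (planePlus τ)) := by
  refine mem_planeAt_of_coeff_mem fun m g hg => ?_
  rw [planePlus_eq_resPerp hτ] at hg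
  rw [← waveMinusNum_eq, mul_comm]
  exact hg _ ⟨m, rfl⟩

/-- On the locus of any set of times containing `t_1`, the plane moved by the flows contains no
series in `O(z⁻¹)`. -/
theorem eq_zero_of_mem_planePlus {σ : Type} (j : σ ↪ ℕ+) {i : σ} (hi : j i = 1) (hτ : IsKPTau τ)
    {f : LaurentSeries (MvPowerSeries σ ℂ)} (hf : f ∈ planeAt j 1 (planePlus τ))
    (hf1 : f ∈ ordGE _ 1) : f = 0 := by
  have hψ : restrictLaurent j (shiftLaurent 1 τ) ∈ planeAt j (-1) (resPerp (planePlus τ)) :=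
    restrictLaurent_mem_planeAt (e := id) j (shiftLaurent_mem_planeAt hτ)
  have hψ0 : restrictLaurent j (shiftLaurent 1 τ) ∈ ordGE _ 0 :=
    coeffHom_mem_ordGE _ (shiftLaurent_mem 1 τ)
  refine eq_zero_of_mem_planeAt (fun q hq q' hq' => ?_) hi hψ hψ0 ?_ hf hf1
  · rw [mul_comm]
    exact hq' q hq
  · intro h
    have := congrArg constantCoeff h
    rw [coeffHom_coeff, shiftLaurent_coeff_zero, RingHom.coe_coe, constantCoeff_killCompl, hτ.1,
      map_zero] at this
    exact one_ne_zero this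

end KPTau

/-! ### The operators `z^p` and `𝒜_p⁺` on the moved plane. -/

section Invariance

variable {σ : Type*} {e : σ → ℕ+} {ε : ℂ} {Q : Submodule ℂ (LaurentSeries ℂ)}

theorem zpow_mul_mem_planeAt {p : ℕ} (h : ∀ g ∈ Q, zpow p * g ∈ Q)
    {f : LaurentSeries (MvPowerSeries σ ℂ)} (hf : f ∈ planeAt e ε Q) :
    HahnSeries.single (-(p : ℤ)) 1 * f ∈ planeAt e ε Q := by
  refine subset_planeAt (N := (fun f => HahnSeries.single (-(p : ℤ)) 1 * f) '' planeAt e ε Q)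
    ?_ ?_ ⟨f, hf, rfl⟩
  · rintro _ ⟨f, hf, rfl⟩ i
    refine ⟨_, twist_mem_planeAt i hf, ?_⟩
    have h1 : coeffDer (pderiv ℂ i) (HahnSeries.single (-(p : ℤ)) 1) = 0 := by
      rw [coeffDer_single, Derivation.map_one_eq_zero, map_zero]
    rw [twist_apply, twist_apply, coeffDer_mul, h1]
    ring
  · rintro _ ⟨f, hf, rfl⟩
    rw [map_mul, coeffHom_single, map_one]
    exact h _ (atZero_mem hf)

theorem zDeriv_eq (g : LaurentSeries ℂ) : zDeriv g = euler ℂ g := by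
  ext k
  rw [zDeriv, euler_coeff, zpow, HahnSeries.coeff_neg, HahnSeries.coeff_single_mul]
  simp

variable [Fintype σ]

/-- `z + (1/p) ∑ e_j t_j z^(e_j - p)`. -/
def spectral (p : ℕ) (e : σ → ℕ+) : LaurentSeries (MvPowerSeries σ ℂ) :=
  HahnSeries.single (-1) 1 +
    ∑ j, HahnSeries.single ((p : ℤ) - (e j : ℕ)) (C (((e j : ℕ) : ℂ) / p) * X j)

/-- The operator `𝒜_p⁺` conjugated by `exp (∑ t_j z^(e_j))`. -/
def opAt (p : ℕ) (e : σ → ℕ+) (f : LaurentSeries (MvPowerSeries σ ℂ)) :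
    LaurentSeries (MvPowerSeries σ ℂ) :=
  spectral p e * f +
    HahnSeries.single (p : ℤ) (C (p : ℂ)⁻¹) *
      (euler _ f - HahnSeries.C (C (((p : ℂ) - 1) / 2)) * f)

theorem coeffDer_spectral (p : ℕ) (i : σ) : coeffDer (pderiv ℂ i) (spectral p e) =
    HahnSeries.single ((p : ℤ) - (e i : ℕ)) (C (((e i : ℕ) : ℂ) / p)) := by
  classical
  rw [spectral, map_add, coeffDer_single, Derivation.map_one_eq_zero, map_zero, zero_add, map_sum,
    Finset.sum_eq_single i]
  · rw [coeffDer_single, Derivation.leibniz, pderiv_C, pderiv_X_self]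
    simp
  · intro j _ hj
    rw [coeffDer_single, Derivation.leibniz, pderiv_C, pderiv_X_of_ne hj]
    simp
  · simp

/-- The derivative of `spectral` along `t_i` is `(e_i / p) z^(e_i - p)`, which is exactly the
commutator of `p⁻¹ z⁻ᵖ θ` with `z^(e_i)`. -/
theorem twist_opAt (p : ℕ) (i : σ) (f : LaurentSeries (MvPowerSeries σ ℂ)) :
    twist e 1 i (opAt p e f) = opAt p e (twist e 1 i f) := by
  have h1 : coeffDer (pderiv ℂ i) (HahnSeries.single (p : ℤ) (C (p : ℂ)⁻¹)) = 0 := by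
    rw [coeffDer_single, pderiv_C, map_zero]
  have h2 : coeffDer (pderiv ℂ i) (HahnSeries.C (C (((p : ℂ) - 1) / 2))) = 0 := by
    rw [HahnSeries.C_apply, coeffDer_single, pderiv_C, map_zero]
  have h3 : HahnSeries.single ((p : ℤ) - (e i : ℕ)) (C (((e i : ℕ) : ℂ) / p)) =
      HahnSeries.single (p : ℤ) (C (p : ℂ)⁻¹) *
        euler (MvPowerSeries σ ℂ) (HahnSeries.single (-((e i : ℕ) : ℤ)) (C 1)) := by
    rw [euler_single, HahnSeries.single_mul_single, ← sub_eq_add_neg]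
    congr 1
    rw [map_one, mul_one, div_eq_inv_mul, map_mul]
    push_cast
    rw [neg_neg, map_natCast]
  simp only [opAt, twist_apply, map_add, map_sub, coeffDer_mul, coeffDer_spectral, h1, h2, h3,
    coeffDer_euler, euler_mul]
  ring

theorem opAt_mem_planeAt {p : ℕ} (h : ∀ g ∈ Q, opA p g ∈ Q)
    {f : LaurentSeries (MvPowerSeries σ ℂ)} (hf : f ∈ planeAt e 1 Q) :
    opAt p e f ∈ planeAt e 1 Q := by
  refine subset_planeAt (N := opAt p e '' planeAt e 1 Q) ?_ ?_ ⟨f, hf, rfl⟩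
  · rintro _ ⟨f, hf, rfl⟩ i
    exact ⟨_, twist_mem_planeAt i hf, (twist_opAt p i f).symm⟩
  · rintro _ ⟨f, hf, rfl⟩
    have hC : HahnSeries.C (p : ℂ)⁻¹ * HahnSeries.single (p : ℤ) 1 =
        HahnSeries.single (p : ℤ) (p : ℂ)⁻¹ := by
      rw [HahnSeries.C_apply, HahnSeries.single_mul_single, zero_add, mul_one]
    have : atZero (opAt p e f) = opA p (atZero f) := by
      simp only [opAt, opA, spectral, map_add, map_mul, map_sub, map_sum, coeffHom_single,
        coeffHom_euler, coeffHom_C, zDeriv_eq, map_one, constantCoeff_X, constantCoeff_C, mul_zero,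
        map_zero, Finset.sum_const_zero, add_zero, zpow, neg_neg, hC]
    rw [this]
    exact h _ (atZero_mem hf)

end Invariance

/-! ### Polynomials in `g` and Faber expansions. -/

section Faber

variable {A : Type*} [CommRing A] {g : LaurentSeries A}

theorem mem_ordGE_of_sub_mem (hg : g - HahnSeries.single (-1) 1 ∈ ordGE A 1) :
    g ∈ ordGE A (-1) := by
  have := add_mem (ordGE_anti (by lia) hg) (single_mem_ordGE (le_refl (-1)) (1 : A))
  rwa [sub_add_cancel] at this

theorem coeff_eq_one_of_sub_mem (hg : g - HahnSeries.single (-1) 1 ∈ ordGE A 1) :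
    g.coeff (-1) = 1 := by
  have := hg (-1) (by lia)
  rwa [HahnSeries.coeff_sub, HahnSeries.coeff_single_same, sub_eq_zero] at this

theorem pow_mem_ordGE_neg (hg : g ∈ ordGE A (-1)) (k : ℕ) : g ^ k ∈ ordGE A (-k) := by
  simpa using pow_mem_ordGE hg k

theorem coeff_pow_neg (hg : g ∈ ordGE A (-1)) (h1 : g.coeff (-1) = 1) (k : ℕ) :
    (g ^ k).coeff (-k) = 1 := by
  simpa [h1] using coeff_pow_lead hg k

/-- The polynomials in `g`. -/
def polyIn (g : LaurentSeries A) : Subring (LaurentSeries A) :=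
  (Polynomial.eval₂RingHom HahnSeries.C g).range

theorem self_mem_polyIn (g : LaurentSeries A) : g ∈ polyIn g := ⟨Polynomial.X, by simp⟩

theorem C_mem_polyIn (g : LaurentSeries A) (a : A) : HahnSeries.C a ∈ polyIn g :=
  ⟨Polynomial.C a, by simp⟩

theorem smul_mem_polyIn (a : A) {f : LaurentSeries A} (hf : f ∈ polyIn g) : a • f ∈ polyIn g := by
  rw [← HahnSeries.C_mul_eq_smul]
  exact mul_mem (C_mem_polyIn g a) hf

theorem eval₂_C_eq_sum (Q : Polynomial A) (g : LaurentSeries A) {n : ℕ} (hn : Q.natDegree < n) :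
    Q.eval₂ HahnSeries.C g = ∑ k ∈ Finset.range n, Q.coeff k • g ^ k := by
  rw [Polynomial.eval₂_eq_sum_range' _ hn]
  simp only [HahnSeries.C_mul_eq_smul]

theorem eq_zero_of_mem_polyIn (hg : g ∈ ordGE A (-1)) (h1 : g.coeff (-1) = 1) {f : LaurentSeries A}
    (hf : f ∈ polyIn g) (hf1 : f ∈ ordGE A 1) : f = 0 := by
  obtain ⟨Q, rfl⟩ := hf
  rw [Polynomial.coe_eval₂RingHom] at hf1 ⊢
  rw [eval₂_C_eq_sum Q g (Nat.lt_succ_self _)] at hf1 ⊢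
  have := eq_zero_of_sum_mem (pow_mem_ordGE_neg hg) (coeff_pow_neg hg h1) _ hf1
  exact Finset.sum_eq_zero fun k hk => by
    rw [this k (Finset.mem_range.mp hk), ← HahnSeries.C_mul_eq_smul, map_zero, zero_mul]

theorem coeff_zero_euler (f : LaurentSeries A) : (euler A f).coeff 0 = 0 := by
  rw [euler_coeff]
  simp

theorem coeff_zero_pow_mul_euler [IsDomain A] [CharZero A] (g : LaurentSeries A) (k : ℕ) :
    (g ^ k * euler A g).coeff 0 = 0 := by
  have h := coeff_zero_euler (g ^ (k + 1))
  have h2 : euler A (g ^ (k + 1)) = ((k + 1 : ℕ) : A) • (g ^ k * euler A g) := by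
    rw [euler_pow, Nat.add_sub_cancel, ← HahnSeries.C_mul_eq_smul, map_natCast, mul_assoc]
  rw [h2, HahnSeries.coeff_smul, smul_eq_mul] at h
  exact (mul_eq_zero.mp h).resolve_left (by exact_mod_cast Nat.succ_ne_zero k)

/-- A polynomial in `g` times `dg` is exact: `(k+1) g^k θ(g) = θ(g^(k+1))`, and `k + 1` can be
cancelled. -/
theorem coeff_zero_mul_euler_of_mem_polyIn [IsDomain A] [CharZero A] {f : LaurentSeries A}
    (hf : f ∈ polyIn g) : (f * euler A g).coeff 0 = 0 := by
  obtain ⟨Q, rfl⟩ := hf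
  rw [Polynomial.coe_eval₂RingHom, eval₂_C_eq_sum Q g (Nat.lt_succ_self _), Finset.sum_mul,
    HahnSeries.coeff_sum]
  refine Finset.sum_eq_zero fun k _ => ?_
  rw [← HahnSeries.C_mul_eq_smul, mul_assoc, HahnSeries.C_mul_eq_smul, HahnSeries.coeff_smul,
    coeff_zero_pow_mul_euler, smul_zero]

/-- `N j` is the negative part of the `j`-th Faber polynomial of `g`, evaluated at `g`. -/
structure IsFaber (g : LaurentSeries A) (N : ℕ → LaurentSeries A) : Prop where
  mem : ∀ j, N j ∈ ordGE A 1
  mem_polyIn : ∀ j : ℕ, HahnSeries.single (-(j : ℤ)) 1 + N j ∈ polyIn g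

theorem exists_isFaber (hg : g ∈ ordGE A (-1)) (h1 : g.coeff (-1) = 1) : ∃ N, IsFaber g N := by
  have (j : ℕ) : ∃ N ∈ ordGE A 1, HahnSeries.single (-(j : ℤ)) 1 + N ∈ polyIn g := by
    obtain ⟨b, -, hb⟩ := exists_elim (pow_mem_ordGE_neg hg) (coeff_pow_neg hg h1) j
      (single_mem_ordGE (le_refl (-(j : ℤ))) (1 : A))
    refine ⟨_, neg_mem hb, ?_⟩
    rw [neg_sub, add_sub_cancel]
    exact sum_mem fun k _ => smul_mem_polyIn _ (pow_mem (self_mem_polyIn g) k)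
  choose N hN hN' using this
  exact ⟨N, hN, hN'⟩

variable {N : ℕ → LaurentSeries A}

theorem IsFaber.eq_of_mem (hN : IsFaber g N) (hg : g ∈ ordGE A (-1)) (h1 : g.coeff (-1) = 1)
    {j : ℕ} {f : LaurentSeries A} (hf : f ∈ polyIn g)
    (h : f - HahnSeries.single (-(j : ℤ)) 1 ∈ ordGE A 1) :
    f = HahnSeries.single (-(j : ℤ)) 1 + N j := by
  refine sub_eq_zero.mp (eq_zero_of_mem_polyIn hg h1 (sub_mem hf (hN.mem_polyIn j)) ?_)
  rw [← sub_sub]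
  exact sub_mem h (hN.mem j)

theorem IsFaber.zero_eq (hN : IsFaber g N) (hg : g ∈ ordGE A (-1)) (h1 : g.coeff (-1) = 1) :
    N 0 = 0 := by
  have := hN.eq_of_mem hg h1 (j := 0) (f := 1) (one_mem _) (by simp)
  simpa using this

/-- The residue of `(z^j + N_j) dg` vanishes. Its two contributions are `-j g_j` from `z^j` and the
leading coefficient of `N_j` from the leading term of `g`. -/
theorem IsFaber.coeff_one [IsDomain A] [CharZero A] (hN : IsFaber g N)
    (hg : g ∈ ordGE A (-1)) (h1 : g.coeff (-1) = 1) (j : ℕ) : (N j).coeff 1 = j * g.coeff j := by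
  have h := coeff_zero_mul_euler_of_mem_polyIn (hN.mem_polyIn j)
  rw [add_mul, HahnSeries.coeff_add, HahnSeries.coeff_single_mul, euler_coeff] at h
  have h2 := coeff_mul_lead (hN.mem j) (euler_mem_ordGE hg)
  rw [add_neg_cancel, euler_coeff, h1] at h2
  rw [h2] at h
  push_cast at h
  simp only [sub_neg_eq_add, zero_add, one_mul, neg_neg, mul_one] at h
  linear_combination h

theorem coeff_sum_single (n : ℕ) (a : ℕ → A) (c : ℤ) :
    (∑ k ∈ Finset.range n, HahnSeries.single (k : ℤ) (a k)).coeff c =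
      if 0 ≤ c ∧ c < n then a c.toNat else 0 := by
  classical
  rw [HahnSeries.coeff_sum]
  simp only [HahnSeries.coeff_single]
  split_ifs with h
  · rw [Finset.sum_eq_single c.toNat]
    · rw [if_pos (by lia)]
    · intro l _ hl
      rw [if_neg (by lia)]
    · intro hl
      exact absurd (Finset.mem_range.mpr (by lia)) hl
  · refine Finset.sum_eq_zero fun l hl => ?_
    have := Finset.mem_range.mp hl
    rw [if_neg (by lia)]

/-- The part of `h` in `O(s^(j+1))`. -/
def tailFrom (h : LaurentSeries A) (j : ℕ) : LaurentSeries A :=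
  h - ∑ k ∈ Finset.range (j + 1), HahnSeries.single (k : ℤ) (h.coeff k)

theorem tailFrom_coeff {h : LaurentSeries A} (hh : h ∈ ordGE A 0) (j : ℕ) (k : ℤ) :
    (tailFrom h j).coeff k = if k ≤ j then 0 else h.coeff k := by
  rw [tailFrom, HahnSeries.coeff_sub, coeff_sum_single]
  rcases lt_or_ge k 0 with h0 | h0
  · rw [hh k h0, if_neg (by lia), if_pos (by lia), sub_zero]
  · rcases le_or_gt k j with hk | hk
    · rw [if_pos (by lia), if_pos hk, Int.toNat_of_nonneg h0, sub_self]
    · rw [if_neg (by lia), if_neg (by lia), sub_zero]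

theorem tailFrom_mem {h : LaurentSeries A} (hh : h ∈ ordGE A 0) (j : ℕ) :
    tailFrom h j ∈ ordGE A (j + 1) := fun k hk => by
  rw [tailFrom_coeff hh, if_pos (by lia)]

/-- The product of `g` with the `j`-th Faber polynomial is `z^(j+1)` plus known terms of degree at
most `j`. These are removed by lower Faber polynomials and by the constant `j g_j`, which is the
constant term of `g N_j`. -/
theorem IsFaber.recursion [IsDomain A] [CharZero A] (hN : IsFaber g N)
    (hg : g - HahnSeries.single (-1) 1 ∈ ordGE A 1) (j : ℕ) :
    N (j + 1) = g * N j - (j * g.coeff j) • 1 +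
      HahnSeries.single (-(j : ℤ)) 1 * tailFrom (g - HahnSeries.single (-1) 1) j -
      ∑ k ∈ Finset.range (j + 1), (g - HahnSeries.single (-1) 1).coeff k • N (j - k) := by
  set h := g - HahnSeries.single (-1) 1 with hh
  have hg' := mem_ordGE_of_sub_mem hg
  have h1 := coeff_eq_one_of_sub_mem hg
  have hsum : HahnSeries.single (-(j : ℤ)) 1 * tailFrom h j =
      HahnSeries.single (-(j : ℤ)) 1 * g - HahnSeries.single (-((j + 1 : ℕ) : ℤ)) 1 -
        ∑ k ∈ Finset.range (j + 1), h.coeff k • HahnSeries.single (-((j - k : ℕ) : ℤ)) 1 := by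
    rw [tailFrom, mul_sub, Finset.mul_sum, hh, mul_sub, HahnSeries.single_mul_single]
    congr 1
    · rw [one_mul]
      congr 3
      push_cast
      ring
    · refine Finset.sum_congr rfl fun k hk => ?_
      have := Finset.mem_range.mp hk
      rw [HahnSeries.single_mul_single, ← HahnSeries.C_mul_eq_smul, HahnSeries.C_apply,
        HahnSeries.single_mul_single, mul_one, one_mul, zero_add,
        show -(j : ℤ) + k = -((j - k : ℕ) : ℤ) by lia]
  have key := hN.eq_of_mem hg' h1 (j := j + 1)
    (f := g * (HahnSeries.single (-(j : ℤ)) 1 + N j) - (j * g.coeff j) • 1 -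
      ∑ k ∈ Finset.range (j + 1), h.coeff k • (HahnSeries.single (-((j - k : ℕ) : ℤ)) 1 + N (j - k)))
    (sub_mem (sub_mem (mul_mem (self_mem_polyIn g) (hN.mem_polyIn j))
      (smul_mem_polyIn _ (one_mem _))) (sum_mem fun k _ => smul_mem_polyIn _ (hN.mem_polyIn _))) ?_
  · simp only [smul_add, Finset.sum_add_distrib] at key
    rw [hsum]
    linear_combination -key
  · have h2 : g * N j - (j * g.coeff j) • 1 ∈ ordGE A 1 := by
      have h3 := mul_mem_ordGE hg' (hN.mem j)
      rw [neg_add_cancel] at h3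
      refine ordGE_succ (n := 0) (sub_mem h3 (Submodule.smul_mem _ _ (one_mem_ordGE le_rfl))) ?_
      have h4 := coeff_mul_lead hg' (hN.mem j)
      rw [neg_add_cancel, h1, one_mul, hN.coeff_one hg' h1] at h4
      rw [HahnSeries.coeff_sub, h4, HahnSeries.coeff_smul, HahnSeries.coeff_one, if_pos rfl,
        smul_eq_mul, mul_one, sub_self]
    have h5 : HahnSeries.single (-(j : ℤ)) 1 * tailFrom h j ∈ ordGE A 1 := by
      have := single_mul_mem_ordGE (-(j : ℤ)) (1 : A) (tailFrom_mem (ordGE_anti (by lia) hg) j)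
      rwa [neg_add_cancel_left] at this
    have h6 : ∑ k ∈ Finset.range (j + 1), h.coeff k • N (j - k) ∈ ordGE A 1 :=
      sum_mem fun k _ => Submodule.smul_mem _ _ (hN.mem _)
    have h7 := sub_mem (add_mem h2 h5) h6
    rw [hsum] at h7
    convert h7 using 1
    simp only [smul_add, Finset.sum_add_distrib]
    ring

theorem natCast_mul_single (n : ℕ) (k : ℤ) (a : A) :
    (n : LaurentSeries A) * HahnSeries.single k a = HahnSeries.single k (n * a) := by
  rw [← map_natCast HahnSeries.C, HahnSeries.C_apply, HahnSeries.single_mul_single, zero_add]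

theorem natCast_mul_mem_ordGE (n : ℕ) {k : ℤ} {f : LaurentSeries A} (hf : f ∈ ordGE A k) :
    (n : LaurentSeries A) * f ∈ ordGE A k := by
  rw [← nsmul_eq_mul]
  exact nsmul_mem hf n

theorem coeff_natCast_mul (n : ℕ) (f : LaurentSeries A) (k : ℤ) :
    ((n : LaurentSeries A) * f).coeff k = n * f.coeff k := by
  rw [← map_natCast HahnSeries.C, HahnSeries.C_mul_eq_smul, HahnSeries.coeff_smul, smul_eq_mul]

theorem sum_weighted_diff {B : Type*} [CommRing B] (x : ℕ → B) (M : ℕ) :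
    ∑ j ∈ Finset.range (M + 1), (j : B) * (x (j + 1) - x j) =
      M * x (M + 1) + x 0 - ∑ j ∈ Finset.range (M + 1), x j := by
  induction M with
  | zero => simp
  | succ M ih =>
    rw [Finset.sum_range_succ, ih, Finset.sum_range_succ _ (M + 1)]
    push_cast
    ring

/-- The second order term of the Faber expansion:
`2 (∑_j s^j N_j) θ(g) = θ²(g) - θ(g)`, modulo `O(s^p)`. -/
theorem IsFaber.trace [IsDomain A] [CharZero A] (hN : IsFaber g N)
    (hg : g - HahnSeries.single (-1) 1 ∈ ordGE A 1) (M : ℕ) :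
    2 * (∑ j ∈ Finset.range (M + 1), HahnSeries.single (j : ℤ) 1 * N j) * euler A g -
      (euler A (euler A g) - euler A g) ∈ ordGE A (M + 1) := by
  set h := g - HahnSeries.single (-1) 1 with hh
  have hg' := mem_ordGE_of_sub_mem hg
  have h1 := coeff_eq_one_of_sub_mem hg
  have hh0 : h ∈ ordGE A 0 := ordGE_anti (by lia) hg
  have hgh (j : ℕ) : g.coeff j = h.coeff j := by
    rw [hh, HahnSeries.coeff_sub, HahnSeries.coeff_single_of_ne (by lia), sub_zero]
  set z : LaurentSeries A := HahnSeries.single (-1) 1 with hz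
  set n : ℕ → LaurentSeries A := fun j => HahnSeries.single (j : ℤ) 1 * N j with hn
  have hnmem (j : ℕ) : n j ∈ ordGE A (j + 1) := single_mul_mem_ordGE _ _ (hN.mem j)
  have hn0 : n 0 = 0 := by rw [hn]; simp only [hN.zero_eq hg' h1, mul_zero]
  -- This is the recursion multiplied by `s^j` and written for `n j = s^j N_j`. The sum over `j`
  -- with weights `j` gives the claim.
  have hrec (j : ℕ) : z * (n (j + 1) - n j) = h * n j -
      ∑ l ∈ Finset.range (j + 1), n l * HahnSeries.single ((j - l : ℕ) : ℤ) (h.coeff (j - l : ℕ)) +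
      (tailFrom h j - HahnSeries.single (j : ℤ) (j * h.coeff j)) := by
    have e1 : z * n (j + 1) = HahnSeries.single (j : ℤ) 1 * N (j + 1) := by
      rw [hn, hz]
      simp only
      rw [← mul_assoc, HahnSeries.single_mul_single, one_mul]
      congr 3
      push_cast
      ring
    have e2 : ∑ l ∈ Finset.range (j + 1),
        n l * HahnSeries.single ((j - l : ℕ) : ℤ) (h.coeff (j - l : ℕ)) =
        HahnSeries.single (j : ℤ) 1 * ∑ k ∈ Finset.range (j + 1), h.coeff k • N (j - k) := by
      rw [← Finset.sum_flip, Finset.mul_sum]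
      refine Finset.sum_congr rfl fun k hk => ?_
      have := Finset.mem_range.mp hk
      have e3 : j - (j - k) = k := by lia
      have e4 : (HahnSeries.single (j : ℤ) (1 : A)) =
          HahnSeries.single ((j - k : ℕ) : ℤ) 1 * HahnSeries.single (k : ℤ) 1 := by
        rw [HahnSeries.single_mul_single, one_mul,
          show ((j - k : ℕ) : ℤ) + k = j by lia]
      have e5 : HahnSeries.single (k : ℤ) (h.coeff k) =
          HahnSeries.C (h.coeff k) * HahnSeries.single (k : ℤ) 1 := by
        rw [HahnSeries.C_apply, HahnSeries.single_mul_single, zero_add, mul_one]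
      rw [e3, e4, ← HahnSeries.C_mul_eq_smul, e5]
      simp only [hn]
      ring
    have e6 : HahnSeries.single (j : ℤ) 1 * (HahnSeries.single (-(j : ℤ)) 1 * tailFrom h j) =
        tailFrom h j := by
      rw [← mul_assoc, HahnSeries.single_mul_single, add_neg_cancel, one_mul]
      exact one_mul _
    have e7 : HahnSeries.single (j : ℤ) 1 * ((j * g.coeff j) • (1 : LaurentSeries A)) =
        HahnSeries.single (j : ℤ) (j * h.coeff j) := by
      rw [← HahnSeries.C_mul_eq_smul, HahnSeries.C_apply, mul_one, HahnSeries.single_mul_single,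
        one_mul, add_zero, hgh]
    rw [mul_sub, e1, hN.recursion hg, ← hh, e2, mul_sub, mul_add, mul_sub, e6, e7]
    simp only [hn, hh]
    ring
  -- Summation by parts: up to the negligible boundary term this is `-z ∑ n_j`, the part of `∑ n_j
  -- θ(g)` coming from `θ z = z`.
  have hB : ∑ j ∈ Finset.range (M + 1), (j : LaurentSeries A) * (z * (n (j + 1) - n j)) =
      z * (M * n (M + 1)) - z * ∑ j ∈ Finset.range (M + 1), n j := by
    rw [← mul_sub]
    have := sum_weighted_diff n M
    rw [hn0, add_zero] at this
    rw [← this, Finset.mul_sum]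
    refine Finset.sum_congr rfl fun j _ => ?_
    ring
  have hdbl : ∑ j ∈ Finset.range (M + 1), (j : LaurentSeries A) *
      ∑ l ∈ Finset.range (j + 1), n l * HahnSeries.single ((j - l : ℕ) : ℤ) (h.coeff (j - l : ℕ)) =
      ∑ l ∈ Finset.range (M + 1), n l * ∑ k ∈ Finset.range (M + 1 - l),
        HahnSeries.single (k : ℤ) (((l + k : ℕ) : A) * h.coeff k) := by
    simp only [Finset.mul_sum]
    rw [← Finset.sum_range_diag_flip (M + 1) fun l k =>
      n l * HahnSeries.single (k : ℤ) (((l + k : ℕ) : A) * h.coeff k)]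
    refine Finset.sum_congr rfl fun j _ => Finset.sum_congr rfl fun l hl => ?_
    have := Finset.mem_range.mp hl
    rw [show l + (j - l) = j by lia, ← natCast_mul_single]
    ring
  -- In the double sum the weight is `l + k`. The part with `l` cancels `l h n_l` modulo
  -- `O(s^(M+1))`, and the part with `-k` is the Euler derivation of `h`.
  have hC : ∑ j ∈ Finset.range (M + 1), (j : LaurentSeries A) * (h * n j) -
      ∑ l ∈ Finset.range (M + 1), n l * ∑ k ∈ Finset.range (M + 1 - l),
        HahnSeries.single (k : ℤ) (((l + k : ℕ) : A) * h.coeff k) -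
      (∑ j ∈ Finset.range (M + 1), n j) * euler A h ∈ ordGE A (M + 1) := by
    rw [Finset.sum_mul, ← Finset.sum_sub_distrib, ← Finset.sum_sub_distrib]
    refine sum_mem fun l hl => ?_
    have hl' := Finset.mem_range.mp hl
    have : (l : LaurentSeries A) * h - ∑ k ∈ Finset.range (M + 1 - l),
        HahnSeries.single (k : ℤ) (((l + k : ℕ) : A) * h.coeff k) - euler A h ∈
        ordGE A (M + 1 - l) := by
      intro c hc
      rw [HahnSeries.coeff_sub, HahnSeries.coeff_sub, coeff_natCast_mul, coeff_sum_single
        (M + 1 - l) (fun k => ((l + k : ℕ) : A) * h.coeff k), euler_coeff]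
      rcases lt_or_ge c 0 with h0 | h0
      · rw [if_neg (by lia), hh0 c h0]
        ring
      · obtain ⟨c, rfl⟩ := Int.eq_ofNat_of_zero_le h0
        rw [if_pos (by lia), Int.toNat_natCast]
        push_cast
        ring
    convert mul_mem_ordGE_of_le (hnmem l) this (k := M + 1) (by lia) using 1
    ring
  -- At `s^c` the tails contribute `∑_{j<c} j = c(c-1)/2` and the diagonal `-c²`. Twice their sum is
  -- `-(c² + c)`, opposite to the coefficient of `θ² - θ`.
  have hD : 2 * ∑ j ∈ Finset.range (M + 1), (j : LaurentSeries A) *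
      (tailFrom h j - HahnSeries.single (j : ℤ) (j * h.coeff j)) +
      (euler A (euler A h) - euler A h) ∈ ordGE A (M + 1) := by
    intro c hc
    rw [HahnSeries.coeff_add, HahnSeries.coeff_sub, euler_coeff, euler_coeff,
      show (2 : LaurentSeries A) = (2 : ℕ) by norm_num, coeff_natCast_mul]
    simp only [mul_sub, natCast_mul_single, Finset.sum_sub_distrib]
    rw [HahnSeries.coeff_sub, coeff_sum_single (M + 1) fun j => (j : A) * (j * h.coeff j),
      HahnSeries.coeff_sum]
    simp only [coeff_natCast_mul, tailFrom_coeff hh0]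
    rcases lt_or_ge c 0 with h0 | h0
    · rw [if_neg (by lia), Finset.sum_eq_zero fun j _ => by rw [hh0 c h0]; simp, hh0 c h0]
      ring
    · obtain ⟨c, rfl⟩ := Int.eq_ofNat_of_zero_le h0
      rw [if_pos (by lia), Int.toNat_natCast]
      have e1 : ∑ j ∈ Finset.range (M + 1), (j : A) * (if (c : ℤ) ≤ j then 0 else h.coeff c) =
          (∑ j ∈ Finset.range c, (j : A)) * h.coeff c := by
        rw [Finset.sum_mul, ← Finset.sum_subset (Finset.range_subset_range.mpr
          (show c ≤ M + 1 by lia))]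
        · refine Finset.sum_congr rfl fun j hj => ?_
          have := Finset.mem_range.mp hj
          rw [if_neg (by lia)]
        · intro j _ hj
          rw [Finset.mem_range] at hj
          rw [if_pos (by lia), mul_zero]
      have e2 : (∑ j ∈ Finset.range c, (j : A)) * 2 = c * (c - 1) := by
        rcases c with _ | c
        · simp
        · have := Finset.sum_range_id_mul_two (c + 1)
          rw [← Nat.cast_sum]
          have h3 := congrArg (Nat.cast : ℕ → A) this
          rw [Nat.add_sub_cancel] at h3
          push_cast at h3 ⊢
          rw [h3]
          ring
      rw [e1]
      push_cast
      linear_combination h.coeff c * e2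
  have hsum : ∑ j ∈ Finset.range (M + 1), (j : LaurentSeries A) * (z * (n (j + 1) - n j)) =
      ∑ j ∈ Finset.range (M + 1), (j : LaurentSeries A) * (h * n j) -
      ∑ l ∈ Finset.range (M + 1), n l * ∑ k ∈ Finset.range (M + 1 - l),
        HahnSeries.single (k : ℤ) (((l + k : ℕ) : A) * h.coeff k) +
      ∑ j ∈ Finset.range (M + 1), (j : LaurentSeries A) *
        (tailFrom h j - HahnSeries.single (j : ℤ) (j * h.coeff j)) := by
    rw [← hdbl, ← Finset.sum_sub_distrib, ← Finset.sum_add_distrib]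
    refine Finset.sum_congr rfl fun j _ => ?_
    rw [hrec]
    ring
  have hE : z * (M * n (M + 1)) ∈ ordGE A (M + 1) :=
    mul_mem_ordGE_of_le (single_mem_ordGE le_rfl 1) (natCast_mul_mem_ordGE M (hnmem (M + 1)))
      (by push_cast; lia)
  have hz1 : euler A z = z := by
    rw [hz, euler_single]
    simp
  have hgz : g = z + h := by rw [hh]; ring
  have key := sub_mem (natCast_mul_mem_ordGE 2 (sub_mem hE hC)) hD
  convert key using 1
  rw [hgz, map_add, map_add, hz1, hz1]
  rw [Nat.cast_ofNat]
  linear_combination (-2 : LaurentSeries A) * (hB.symm.trans hsum)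

end Faber

/-! ### WKB expansion of the iterates of `g + r z⁻ᵖ (θ - c)`. -/

section WKB

variable {A : Type*} [CommRing A]

theorem C_mul_mem_ordGE (a : A) {k : ℤ} {f : LaurentSeries A} (hf : f ∈ ordGE A k) :
    HahnSeries.C a * f ∈ ordGE A k := by
  rw [HahnSeries.C_mul_eq_smul]
  exact Submodule.smul_mem _ _ hf

/-- The operator `g + r z⁻ᵖ (z d/dz - c)`. -/
def wkbOp (g : LaurentSeries A) (p : ℕ) (r c : A) (f : LaurentSeries A) : LaurentSeries A :=
  g * f + HahnSeries.single (p : ℤ) r * (euler A f - HahnSeries.C c * f)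

variable (g : LaurentSeries A)

/-- The derivative of `X ^ k`, evaluated at `g`. -/
def dpow : ℕ → LaurentSeries A
  | 0 => 0
  | k + 1 => g * dpow k + g ^ k

/-- Half the second derivative of `X ^ k`, evaluated at `g`. -/
def ddpow : ℕ → LaurentSeries A
  | 0 => 0
  | k + 1 => g * ddpow k + dpow g k

variable {g}

theorem euler_pow_eq (k : ℕ) : euler A (g ^ k) = dpow g k * euler A g := by
  induction k with
  | zero => rw [pow_zero, euler_one, dpow, zero_mul]
  | succ k ih => rw [pow_succ, euler_mul, ih, dpow]; ring

theorem euler_dpow (k : ℕ) : euler A (dpow g k) = 2 * ddpow g k * euler A g := by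
  induction k with
  | zero => rw [dpow, map_zero, ddpow, mul_zero, zero_mul]
  | succ k ih => rw [dpow, map_add, euler_mul, ih, euler_pow_eq, ddpow]; ring

theorem dpow_mem (hg : g ∈ ordGE A (-1)) (k : ℕ) : dpow g k ∈ ordGE A (1 - k) := by
  induction k with
  | zero => exact zero_mem _
  | succ k ih =>
    exact add_mem (mul_mem_ordGE_of_le hg ih (by push_cast; lia))
      (ordGE_anti (by push_cast; lia) (pow_mem_ordGE_neg hg k))

theorem ddpow_mem (hg : g ∈ ordGE A (-1)) (k : ℕ) : ddpow g k ∈ ordGE A (2 - k) := by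
  induction k with
  | zero => exact zero_mem _
  | succ k ih =>
    exact add_mem (mul_mem_ordGE_of_le hg ih (by push_cast; lia))
      (ordGE_anti (by push_cast; lia) (dpow_mem hg k))

variable {p : ℕ} {r c : A} {χ : LaurentSeries A}

theorem single_mul_sub_mem {k : ℤ} {f : LaurentSeries A} (hf : f ∈ ordGE A k) :
    HahnSeries.single (p : ℤ) r * (euler A f - HahnSeries.C c * f) ∈ ordGE A (p + k) :=
  single_mul_mem_ordGE _ _ (sub_mem (euler_mem_ordGE hf) (C_mul_mem_ordGE c hf))

theorem wkbOp_mem (hg : g ∈ ordGE A (-1)) {k : ℤ} {f : LaurentSeries A} (hf : f ∈ ordGE A k) :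
    wkbOp g p r c f ∈ ordGE A (k - 1) :=
  add_mem (mul_mem_ordGE_of_le hg hf (by lia)) (ordGE_anti (by lia) (single_mul_sub_mem hf))

/-- The second order WKB expansion of the iterates of `wkbOp`. -/
theorem iterate_wkbOp_sub_mem (hg : g ∈ ordGE A (-1)) (hχ : χ ∈ ordGE A 0) (k : ℕ) :
    (wkbOp g p r c)^[k] χ - (g ^ k * χ +
      dpow g k * (HahnSeries.single (p : ℤ) r * (euler A χ - HahnSeries.C c * χ)) +
      ddpow g k * (HahnSeries.single (p : ℤ) r * (euler A g * χ))) ∈ ordGE A (2 * p + 2 - k) := by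
  induction k with
  | zero => simp [dpow, ddpow]
  | succ k ih =>
    set κ := HahnSeries.single (p : ℤ) r * (euler A χ - HahnSeries.C c * χ) with hκ
    set β := HahnSeries.single (p : ℤ) r * (euler A g * χ) with hβ
    have hκm : κ ∈ ordGE A p := by
      have := single_mul_sub_mem (r := r) (c := c) (p := p) hχ
      rwa [add_zero] at this
    have hβm : β ∈ ordGE A (p - 1) :=
      mul_mem_ordGE_of_le (single_mem_ordGE le_rfl r)
        (mul_mem_ordGE (euler_mem_ordGE hg) hχ) (by lia)
    have h1 := wkbOp_mem (p := p) (r := r) (c := c) hg ih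
    -- A second correction, acting on a term that already carries one, costs `p + 1` further
    -- degrees. It goes into the remainder.
    have h2 := single_mul_sub_mem (p := p) (r := r) (c := c) (mul_mem_ordGE (dpow_mem hg k) hκm)
    have h3 := single_mul_sub_mem (p := p) (r := r) (c := c) (mul_mem_ordGE (ddpow_mem hg k) hβm)
    rw [Function.iterate_succ_apply']
    have h4 := add_mem (add_mem (ordGE_anti (show (2 * p + 2 - (k + 1 : ℕ) : ℤ) ≤ _ by
      push_cast; lia) h1) (ordGE_anti (by push_cast; lia) h2)) (ordGE_anti (by push_cast; lia) h3)
    convert h4 using 1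
    generalize (wkbOp g p r c)^[k] χ = x
    simp only [wkbOp, map_sub, map_add, euler_mul, euler_pow_eq, dpow, ddpow]
    rw [hκ, hβ]
    ring

theorem iterate_wkbOp_sub_pow_mem (hg : g ∈ ordGE A (-1)) (hχ : χ ∈ ordGE A 0) (k : ℕ) :
    (wkbOp g p r c)^[k] χ - g ^ k * χ ∈ ordGE A (p + 1 - k) := by
  have h1 := ordGE_anti (show (p + 1 - k : ℤ) ≤ _ by lia)
    (iterate_wkbOp_sub_mem (p := p) (r := r) (c := c) hg hχ k)
  have h2 := mul_mem_ordGE_of_le (dpow_mem hg k)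
    (single_mul_sub_mem (p := p) (r := r) (c := c) hχ) (show (p + 1 - k : ℤ) ≤ _ by lia)
  have h3 := mul_mem_ordGE_of_le (ddpow_mem hg k) (single_mul_mem_ordGE (p : ℤ) r
    (mul_mem_ordGE (euler_mem_ordGE hg) hχ)) (show (p + 1 - k : ℤ) ≤ _ by lia)
  convert add_mem (add_mem h1 h2) h3 using 1
  ring

theorem iterate_wkbOp_mem (hg : g ∈ ordGE A (-1)) (hχ : χ ∈ ordGE A 0) (k : ℕ) :
    (wkbOp g p r c)^[k] χ ∈ ordGE A (-k) := by
  convert add_mem (ordGE_anti (by lia) (iterate_wkbOp_sub_pow_mem (p := p) (r := r) (c := c) hg hχ k))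
    (mul_mem_ordGE_of_le (pow_mem_ordGE_neg hg k) hχ (show (-k : ℤ) ≤ _ by lia)) using 1
  ring

theorem coeff_iterate_wkbOp (hg : g ∈ ordGE A (-1)) (h1 : g.coeff (-1) = 1) (hχ : χ ∈ ordGE A 0)
    (hχ1 : χ.coeff 0 = 1) (k : ℕ) : ((wkbOp g p r c)^[k] χ).coeff (-k) = 1 := by
  have h := iterate_wkbOp_sub_pow_mem (p := p) (r := r) (c := c) hg hχ k (-k) (by lia)
  have h2 := coeff_mul_lead (pow_mem_ordGE_neg hg k) hχ
  rw [add_zero, coeff_pow_neg hg h1, hχ1, mul_one] at h2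
  rw [HahnSeries.coeff_sub, h2] at h
  exact sub_eq_zero.mp h

theorem sum_smul_mul {n : ℕ} (q : ℕ → A) (x : ℕ → LaurentSeries A) (y : LaurentSeries A) :
    ∑ k ∈ Finset.range n, q k • (x k * y) = (∑ k ∈ Finset.range n, q k • x k) * y := by
  rw [Finset.sum_mul]
  refine Finset.sum_congr rfl fun k _ => ?_
  rw [← HahnSeries.C_mul_eq_smul, ← HahnSeries.C_mul_eq_smul, mul_assoc]

/-- The WKB analysis of the relation `z^p χ = ∑ q_k (wkbOp)^k χ`. -/
theorem wkb_expansion (hg : g - HahnSeries.single (-1) 1 ∈ ordGE A 1) (hχ : χ ∈ ordGE A 0)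
    (hχ1 : χ.coeff 0 = 1) (hr : r * p = 1) (hc : 2 * c = p - 1) {q : ℕ → A}
    (hq : HahnSeries.single (-(p : ℤ)) 1 * χ =
      ∑ k ∈ Finset.range (p + 1), q k • (wkbOp g p r c)^[k] χ) :
    (∑ k ∈ Finset.range (p + 1), q k • g ^ k) - HahnSeries.single (-(p : ℤ)) 1 ∈ ordGE A 1 ∧
    2 * ((∑ k ∈ Finset.range (p + 1), q k • g ^ k) - HahnSeries.single (-(p : ℤ)) 1) *
        euler A g ^ 2 * χ + 2 * euler A g * euler A χ -
      (euler A (euler A g) - euler A g) * χ ∈ ordGE A p := by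
  have hg' := mem_ordGE_of_sub_mem hg
  set κ := HahnSeries.single (p : ℤ) r * (euler A χ - HahnSeries.C c * χ) with hκ
  set β := HahnSeries.single (p : ℤ) r * (euler A g * χ) with hβ
  set X := ∑ k ∈ Finset.range (p + 1), q k • g ^ k with hX
  set Y := ∑ k ∈ Finset.range (p + 1), q k • dpow g k with hY
  set B := ∑ k ∈ Finset.range (p + 1), q k • ddpow g k with hB
  set z : LaurentSeries A := HahnSeries.single (-(p : ℤ)) 1 with hz
  have hκm : κ ∈ ordGE A p := by
      have := single_mul_sub_mem (r := r) (c := c) (p := p) hχ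
      rwa [add_zero] at this
  have hβm : β ∈ ordGE A (p - 1) :=
    mul_mem_ordGE_of_le (single_mem_ordGE le_rfl r)
      (mul_mem_ordGE (euler_mem_ordGE hg') hχ) (by lia)
  have hYm : Y ∈ ordGE A (1 - p) := sum_mem fun k hk => Submodule.smul_mem _ _
    (ordGE_anti (by have := Finset.mem_range.mp hk; lia) (dpow_mem hg' k))
  have hBm : B ∈ ordGE A (2 - p) := sum_mem fun k hk => Submodule.smul_mem _ _
    (ordGE_anti (by have := Finset.mem_range.mp hk; lia) (ddpow_mem hg' k))
  -- Here `X`, `Y`, `B` are a polynomial, its derivative and half its second derivative at `g`. The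
  -- error is worst for the top iterate, where `2p + 2 - p = p + 2`.
  have hE : z * χ - (X * χ + Y * κ + B * β) ∈ ordGE A (p + 2) := by
    rw [hq, hX, hY, hB, ← sum_smul_mul, ← sum_smul_mul, ← sum_smul_mul, ← Finset.sum_add_distrib,
      ← Finset.sum_add_distrib, ← Finset.sum_sub_distrib]
    refine sum_mem fun k hk => ?_
    rw [← smul_add, ← smul_add, ← smul_sub]
    exact Submodule.smul_mem _ _ (ordGE_anti (by have := Finset.mem_range.mp hk; lia)
      (iterate_wkbOp_sub_mem hg' hχ k))
  have hε : X - z ∈ ordGE A 1 := by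
    have h1 : χ * (X - z) ∈ ordGE A 1 := by
      have h2 := add_mem (add_mem (ordGE_anti (show (1 : ℤ) ≤ _ by lia) hE)
        (mul_mem_ordGE_of_le hYm hκm (show (1 : ℤ) ≤ _ by lia)))
        (mul_mem_ordGE_of_le hBm hβm (show (1 : ℤ) ≤ _ by lia))
      convert neg_mem h2 using 1
      ring
    simpa using mem_ordGE_of_mul hχ hχ1 h1
  refine ⟨hε, ?_⟩
  have hθX : euler A X = Y * euler A g := by
    rw [hX, hY, ← sum_smul_mul, map_sum]
    exact Finset.sum_congr rfl fun k _ => by rw [euler_smul, euler_pow_eq]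
  have hθY : euler A Y = 2 * B * euler A g := by
    rw [hY, hB, mul_assoc, ← sum_smul_mul, map_sum, Finset.mul_sum]
    refine Finset.sum_congr rfl fun k _ => ?_
    rw [euler_smul, euler_dpow, ← HahnSeries.C_mul_eq_smul, ← HahnSeries.C_mul_eq_smul]
    ring
  have hθz : euler A z = p * z := by
    rw [hz, euler_single, natCast_mul_single]
    push_cast
    ring_nf
  -- Since `X - z^p` is small, applying `θ` to `X = z^p + (X - z^p)` once and twice evaluates `Y`
  -- and `B` in terms of `g`.
  have hN : Y * euler A g = p * z + euler A (X - z) := by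
    rw [← hθX, map_sub, hθz]
    ring
  have hθN : 2 * B * euler A g ^ 2 + Y * euler A (euler A g) =
      p * (p * z) + euler A (euler A (X - z)) := by
    have h1 := congrArg (euler A) hN
    have h2 : euler A ((p : LaurentSeries A) * z) = p * (p * z) := by
      rw [hz, natCast_mul_single, euler_single, natCast_mul_single]
      push_cast
      ring_nf
    rw [euler_mul, map_add, h2, hθY] at h1
    linear_combination h1
  set S : LaurentSeries A := HahnSeries.single (p : ℤ) r with hS
  have hSz : S * (p * z) = 1 := by
    rw [hS, hz, natCast_mul_single, HahnSeries.single_mul_single, add_neg_cancel, mul_one, hr]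
    rfl
  have he1 : S * euler A (X - z) ∈ ordGE A (p + 1) :=
    single_mul_mem_ordGE _ _ (euler_mem_ordGE hε)
  have he2 : S * euler A (euler A (X - z)) ∈ ordGE A (p + 1) :=
    single_mul_mem_ordGE _ _ (euler_mem_ordGE (euler_mem_ordGE hε))
  have hθg := euler_mem_ordGE hg'
  have hE2 := mul_mem_ordGE_of_le hE (pow_mem_ordGE hθg 2) (show (p : ℤ) ≤ _ by push_cast; lia)
  have hd : euler A χ - HahnSeries.C c * χ ∈ ordGE A 0 :=
    sub_mem (euler_mem_ordGE hχ) (C_mul_mem_ordGE c hχ)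
  have hm1 := mul_mem_ordGE_of_le he1 (mul_mem_ordGE hθg hd) (show (p : ℤ) ≤ _ by lia)
  have hm2 := mul_mem_ordGE_of_le he2 (mul_mem_ordGE hθg hχ) (show (p : ℤ) ≤ _ by lia)
  have hm3 := mul_mem_ordGE_of_le he1 (mul_mem_ordGE (euler_mem_ordGE hθg) hχ)
    (show (p : ℤ) ≤ _ by lia)
  have hcL : 2 * (HahnSeries.C c : LaurentSeries A) = p - 1 := by
    have := congrArg (HahnSeries.C : A →+* LaurentSeries A) hc
    rwa [map_mul, map_sub, map_ofNat, map_natCast, map_one] at this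
  have hfin := neg_mem (sub_mem (add_mem (add_mem (natCast_mul_mem_ordGE 2 hE2)
    (natCast_mul_mem_ordGE 2 hm1)) hm2) hm3)
  convert hfin using 1
  rw [Nat.cast_ofNat, hκ, hβ]
  -- After multiplication by `2 θ(g)²`, the second order term leaves `p θ(g) χ - θ²(g) χ` and the
  -- constant `c` leaves `-2c θ(g) χ`. The choice `2c = p - 1` removes `p`, as is needed to match
  -- the Faber identity.
  linear_combination (-2 * S * (euler A χ - HahnSeries.C c * χ) * euler A g +
      S * euler A (euler A g) * χ) * hN - S * euler A g * χ * hθN +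
    (-2 * (euler A χ - HahnSeries.C c * χ) * euler A g + euler A (euler A g) * χ
      - p * euler A g * χ) * hSz + euler A g * χ * hcL

end WKB

open MvPowerSeries

instance isDomain_mvPowerSeries {σ : Type*} : IsDomain (MvPowerSeries σ ℂ) :=
  NoZeroDivisors.to_isDomain _

instance charZero_mvPowerSeries {σ : Type*} : CharZero (MvPowerSeries σ ℂ) :=
  algebraRat.charZero _

theorem pderiv_comm {σ : Type*} (i j : σ) (F : MvPowerSeries σ ℂ) :
    pderiv ℂ i (pderiv ℂ j F) = pderiv ℂ j (pderiv ℂ i F) := by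
  rcases eq_or_ne i j with rfl | h
  · rfl
  ext m
  simp only [coeff_pderiv, Finsupp.add_apply, Finsupp.single_eq_of_ne h,
    Finsupp.single_eq_of_ne h.symm, add_zero]
  rw [add_right_comm]
  ring

/-! ### Logarithmic derivatives of the tau function from the wave function. -/

section Flows

variable {τ : MvPowerSeries ℕ+ ℂ}

theorem smul_waveLaurent (hτ : constantCoeff τ = 1) :
    τ • waveLaurent τ = shiftLaurent (-1) τ := by
  rw [waveLaurent, ← HahnSeries.C_mul_eq_smul, ← HahnSeries.C_mul_eq_smul, ← mul_assoc, ← map_mul,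
    MvPowerSeries.mul_inv_cancel _ (by simp [hτ]), map_one, one_mul]

theorem euler_shiftLaurent_sub_mem (τ : MvPowerSeries ℕ+ ℂ) (K : ℕ) :
    euler _ (shiftLaurent (-1) τ) - ∑ j ∈ Finset.range K,
      HahnSeries.single ((j : ℤ) + 1) 1 *
        coeffDer (pderiv ℂ j.succPNat) (shiftLaurent (-1) τ) ∈ ordGE _ (K + 1) := by
  intro n hn
  rw [HahnSeries.coeff_sub, euler_coeff, HahnSeries.coeff_sum]
  simp only [HahnSeries.coeff_single_mul, coeffDer_coeff, one_mul]
  rcases lt_or_ge n 0 with h0 | h0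
  · rw [shiftLaurent_mem _ _ n h0, mul_zero, Finset.sum_eq_zero, sub_zero]
    intro j _
    rw [shiftLaurent_mem _ _ _ (by lia), map_zero]
  · obtain ⟨n, rfl⟩ := Int.eq_ofNat_of_zero_le h0
    have h := shiftLaurent_recursion (-1) τ n
    rw [← Finset.sum_subset (Finset.range_subset_range.mpr (show n ≤ K by lia))]
    · rw [neg_one_smul, smul_eq_C_mul, map_natCast] at h
      push_cast
      linear_combination -h
    · intro j _ hj
      rw [Finset.mem_range] at hj
      rw [shiftLaurent_mem _ _ _ (by lia), map_zero]

/-- The shift identity for `τ` after division by `τ`. The derivatives of `log τ` enter because the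
flows also act on the denominator, whereas `θ` does not. -/
theorem euler_waveLaurent_sub_mem (hτ : constantCoeff τ = 1) (K : ℕ) :
    euler _ (waveLaurent τ) - ∑ j ∈ Finset.range K, HahnSeries.single ((j : ℤ) + 1) 1 *
      (coeffDer (pderiv ℂ j.succPNat) (waveLaurent τ) +
        HahnSeries.C (pderiv ℂ j.succPNat (logSeries τ)) * waveLaurent τ) ∈ ordGE _ (K + 1) := by
  have h := C_mul_mem_ordGE τ⁻¹ (euler_shiftLaurent_sub_mem τ K)
  have hinv : HahnSeries.C τ⁻¹ * (HahnSeries.C τ : LaurentSeries (MvPowerSeries ℕ+ ℂ)) = 1 := by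
    rw [← map_mul, MvPowerSeries.inv_mul_cancel _ (by simp [hτ]), map_one]
  convert h using 1
  rw [← smul_waveLaurent hτ, euler_smul, mul_sub, ← HahnSeries.C_mul_eq_smul, ← mul_assoc, hinv,
    one_mul, Finset.mul_sum]
  congr 1
  refine Finset.sum_congr rfl fun j _ => ?_
  have hF : (HahnSeries.C (pderiv ℂ j.succPNat τ) : LaurentSeries (MvPowerSeries ℕ+ ℂ)) =
      HahnSeries.C τ * HahnSeries.C (pderiv ℂ j.succPNat (logSeries τ)) := by
    rw [← map_mul, mul_pderiv_logSeries hτ]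
  rw [HahnSeries.C_mul_eq_smul, coeffDer_smul, ← HahnSeries.C_mul_eq_smul,
    ← HahnSeries.C_mul_eq_smul, ← HahnSeries.C_mul_eq_smul, hF]
  linear_combination -(HahnSeries.single ((j : ℤ) + 1) 1 *
    (coeffDer (pderiv ℂ j.succPNat) (waveLaurent τ) +
        HahnSeries.C (pderiv ℂ j.succPNat (logSeries τ)) * waveLaurent τ)) * hinv

theorem waveLaurent_coeff_one (hτ : constantCoeff τ = 1) :
    (waveLaurent τ).coeff 1 = -pderiv ℂ 1 (logSeries τ) := by
  have h := shiftLaurent_recursion (-1) τ 1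
  have h2 : (shiftLaurent (-1) τ).coeff 1 = -pderiv ℂ 1 τ := by
    simpa [shiftLaurent_coeff_zero, show Nat.succPNat 0 = 1 from rfl] using h
  rw [waveLaurent, HahnSeries.coeff_smul, h2, ← mul_pderiv_logSeries hτ, smul_eq_mul, mul_neg,
    ← mul_assoc, MvPowerSeries.inv_mul_cancel _ (by simp [hτ]), one_mul]

theorem coeff_sum_single_succ_mul {A : Type*} [CommRing A] (K : ℕ) (a : ℕ → A) {n : ℕ}
    (hn : n < K) : (∑ j ∈ Finset.range K, HahnSeries.single ((j : ℤ) + 1) (1 : A) *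
      HahnSeries.C (a j)).coeff (n + 1) = a n := by
  classical
  rw [HahnSeries.coeff_sum, Finset.sum_eq_single n]
  · rw [HahnSeries.coeff_single_mul, sub_self, HahnSeries.C_apply, HahnSeries.coeff_single_same,
      one_mul]
  · intro j _ hj
    rw [HahnSeries.coeff_single_mul, HahnSeries.C_apply, HahnSeries.coeff_single_of_ne (by lia),
      mul_zero]
  · intro h
    exact absurd (Finset.mem_range.mpr hn) h

/-- If the plane is stable under `z^p`, the logarithmic derivative of the tau function along `t_p`
is constant. -/
theorem pderiv_pderiv_logSeries_eq_zero (hτ : IsKPTau τ) {p : ℕ+}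
    (hp : ∀ g ∈ planePlus τ, zpow (p : ℕ) * g ∈ planePlus τ) (n : ℕ+) :
    pderiv ℂ p (pderiv ℂ n (logSeries τ)) = 0 := by
  have hv := waveLaurent_mem_planeAt hτ
  have hv0 := waveLaurent_coeff_zero hτ.1
  -- Both `(∂_p + z^p) χ` and `z^p χ` lie in the moved plane. Their difference `∂_p χ` is in `O(s)`,
  -- because the leading coefficient of `χ` is the constant `1`.
  have h1 : coeffDer (pderiv ℂ p) (waveLaurent τ) = 0 := by
    refine eq_zero_of_mem_planePlus (Function.Embedding.refl ℕ+) (i := 1) rfl hτ ?_ ?_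
    · have := sub_mem_planeAt (twist_mem_planeAt p hv) (zpow_mul_mem_planeAt hp hv)
      rwa [twist_apply, id, map_one, add_sub_cancel_right] at this
    · refine ordGE_succ (n := 0) (coeffDer_mem_ordGE _ (waveLaurent_mem τ)) ?_
      rw [coeffDer_coeff, hv0, Derivation.map_one_eq_zero]
  have h2 := coeffDer_mem_ordGE (pderiv ℂ p) (euler_waveLaurent_sub_mem hτ.1 n)
  have h3 (i : ℕ+) : coeffDer (pderiv ℂ p) (coeffDer (pderiv ℂ i) (waveLaurent τ)) = 0 := by
    ext k : 2
    rw [coeffDer_coeff, coeffDer_coeff, pderiv_comm, ← coeffDer_coeff (pderiv ℂ p), h1]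
    simp
  -- Differentiated along `t_p`, the Euler identity keeps only the derivatives of the coefficients
  -- `∂_j log τ`.
  have h4 : waveLaurent τ * ∑ j ∈ Finset.range (n : ℕ), HahnSeries.single ((j : ℤ) + 1) 1 *
      HahnSeries.C (pderiv ℂ p (pderiv ℂ j.succPNat (logSeries τ))) ∈ ordGE _ ((n : ℕ) + 1) := by
    convert neg_mem h2 using 1
    rw [map_sub, coeffDer_euler, h1, map_zero, zero_sub, neg_neg, map_sum, Finset.mul_sum]
    refine Finset.sum_congr rfl fun j _ => ?_
    rw [coeffDer_mul, map_add, h3, coeffDer_mul, h1, coeffDer_single, HahnSeries.C_apply,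
      HahnSeries.C_apply, coeffDer_single, Derivation.map_one_eq_zero, map_zero]
    ring
  have h5 := mem_ordGE_of_mul (waveLaurent_mem τ) hv0 h4
  have h6 := h5 ((n.natPred : ℕ) + 1) (by have := PNat.natPred_add_one n; lia)
  rw [coeff_sum_single_succ_mul _ _ (by have := PNat.natPred_add_one n; lia)] at h6
  simpa using h6

end Flows

/-! ### First derivatives of `log τ` on the locus. -/

section Locus

variable {p : ℕ} {τ : MvPowerSeries ℕ+ ℂ}

theorem coe_timeEmb (n : ℕ) (i : Fin n) : ((timeEmb n i : ℕ+) : ℕ) = i + 1 := rfl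

/-- `z + (1/p) ∑_j j t_j z^(j-p)`. -/
abbrev locusSpectral (p : ℕ) : LaurentSeries (MvPowerSeries (Fin (p - 1)) ℂ) :=
  spectral p (timeEmb (p - 1))

/-- The restriction of `τ(t - [z⁻¹]) / τ(t)` to the locus `t_i = 0`, `i ≥ p`. -/
def locusWave (p : ℕ) (τ : MvPowerSeries ℕ+ ℂ) : LaurentSeries (MvPowerSeries (Fin (p - 1)) ℂ) :=
  restrictLaurent (timeEmb (p - 1)) (waveLaurent τ)

theorem locusSpectral_sub_mem (p : ℕ) :
    locusSpectral p - HahnSeries.single (-1) 1 ∈ ordGE _ 1 := by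
  rw [locusSpectral, spectral, add_sub_cancel_left]
  refine sum_mem fun j _ => single_mem_ordGE ?_ _
  have := j.2
  rw [coe_timeEmb]
  lia

theorem locusWave_mem (p : ℕ) (τ : MvPowerSeries ℕ+ ℂ) : locusWave p τ ∈ ordGE _ 0 :=
  coeffHom_mem_ordGE _ (waveLaurent_mem τ)

theorem locusWave_coeff_zero (hτ : constantCoeff τ = 1) : (locusWave p τ).coeff 0 = 1 := by
  rw [locusWave, coeffHom_coeff, waveLaurent_coeff_zero hτ, map_one]

theorem locusWave_mem_planeAt (hτ : IsKPTau τ) :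
    locusWave p τ ∈ planeAt (timeEmb (p - 1)) 1 (planePlus τ) :=
  restrictLaurent_mem_planeAt (e := id) (timeEmb (p - 1)) (waveLaurent_mem_planeAt hτ)

theorem wkbOp_eq_opAt (p : ℕ) : wkbOp (locusSpectral p) p (C (p : ℂ)⁻¹) (C (((p : ℂ) - 1) / 2)) =
    opAt p (timeEmb (p - 1)) := rfl

/-- Series in the moved plane are combinations of the iterates of `opAt` on the wave function. -/
theorem exists_eq_sum_iterate_opAt (hp : 2 ≤ p) (hτ : IsInvariantTau p τ) (n : ℕ)
    {f : LaurentSeries (MvPowerSeries (Fin (p - 1)) ℂ)}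
    (hf : f ∈ planeAt (timeEmb (p - 1)) 1 (planePlus τ)) (hfn : f ∈ ordGE _ (-n)) :
    ∃ q : ℕ → MvPowerSeries (Fin (p - 1)) ℂ, f =
      ∑ k ∈ Finset.range (n + 1), q k • (opAt p (timeEmb (p - 1)))^[k] (locusWave p τ) := by
  have hg := locusSpectral_sub_mem p
  have hg' := mem_ordGE_of_sub_mem hg
  obtain ⟨q, -, hq⟩ := exists_elim
    (P := fun k => (opAt p (timeEmb (p - 1)))^[k] (locusWave p τ))
    (fun k => iterate_wkbOp_mem hg' (locusWave_mem p τ) k)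
    (fun k => coeff_iterate_wkbOp hg' (coeff_eq_one_of_sub_mem hg) (locusWave_mem p τ)
      (locusWave_coeff_zero hτ.1.1) k) n hfn
  refine ⟨q, sub_eq_zero.mp (eq_zero_of_mem_planePlus (timeEmb (p - 1))
    (i := ⟨0, by lia⟩) rfl hτ.1 (sub_mem_planeAt hf (sum_smul_mem_planeAt _ _ fun k _ => ?_)) hq)⟩
  clear * - hτ
  induction k with
  | zero => exact locusWave_mem_planeAt hτ.1
  | succ k ih =>
    rw [Function.iterate_succ_apply']
    exact opAt_mem_planeAt hτ.2.2 ih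

/-- The first order action of the flows on the wave function. -/
theorem coeffDer_locusWave_sub_mem (hp : 2 ≤ p) (hτ : IsInvariantTau p τ)
    {N : ℕ → LaurentSeries (MvPowerSeries (Fin (p - 1)) ℂ)} (hN : IsFaber (locusSpectral p) N)
    (i : Fin (p - 1)) :
    coeffDer (pderiv ℂ i) (locusWave p τ) - N (i + 1) * locusWave p τ ∈ ordGE _ (p - i : ℤ) := by
  have hi := i.2
  have hg := locusSpectral_sub_mem p
  have hg' := mem_ordGE_of_sub_mem hg
  have hχ := locusWave_mem p τ
  have hχ0 := locusWave_coeff_zero (p := p) hτ.1.1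
  have hd : coeffDer (pderiv ℂ i) (locusWave p τ) ∈ ordGE _ 1 := by
    refine ordGE_succ (n := 0) (coeffDer_mem_ordGE _ hχ) ?_
    rw [coeffDer_coeff, hχ0, Derivation.map_one_eq_zero]
  have htw : twist (timeEmb (p - 1)) 1 i (locusWave p τ) =
      coeffDer (pderiv ℂ i) (locusWave p τ) +
        HahnSeries.single (-((i + 1 : ℕ) : ℤ)) 1 * locusWave p τ := by
    rw [twist_apply, map_one]
    rfl
  obtain ⟨q, hq⟩ := exists_eq_sum_iterate_opAt hp hτ (i + 1)
    (twist_mem_planeAt i (locusWave_mem_planeAt hτ.1)) (by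
      rw [htw]
      exact add_mem (ordGE_anti (by lia) hd)
        (mul_mem_ordGE_of_le (single_mem_ordGE le_rfl 1) hχ (by lia)))
  set Y := ∑ k ∈ Finset.range (i + 1 + 1), q k • locusSpectral p ^ k with hY
  have h1 : coeffDer (pderiv ℂ i) (locusWave p τ) +
      HahnSeries.single (-((i + 1 : ℕ) : ℤ)) 1 * locusWave p τ - Y * locusWave p τ ∈
      ordGE _ (p - i : ℤ) := by
    rw [← htw, hq, hY, ← sum_smul_mul, ← Finset.sum_sub_distrib]
    refine sum_mem fun k hk => ?_
    have := Finset.mem_range.mp hk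
    rw [← smul_sub, ← wkbOp_eq_opAt]
    exact Submodule.smul_mem _ _ (ordGE_anti (by lia) (iterate_wkbOp_sub_pow_mem hg' hχ k))
  have h2 : locusWave p τ * (Y - HahnSeries.single (-((i + 1 : ℕ) : ℤ)) 1) ∈ ordGE _ 1 := by
    convert sub_mem hd (ordGE_anti (by lia) h1) using 1
    ring
  have h3 : Y ∈ polyIn (locusSpectral p) :=
    sum_mem fun k _ => smul_mem_polyIn _ (pow_mem (self_mem_polyIn _) k)
  -- The polynomial in `g` formed with the coefficients of the expansion differs from `z^(i+1)` by
  -- `O(s)`, so it is the Faber polynomial.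
  have h4 := hN.eq_of_mem hg' (coeff_eq_one_of_sub_mem hg) h3
    (j := i + 1) (by have := mem_ordGE_of_mul hχ hχ0 h2; rwa [sub_zero] at this)
  convert h1 using 1
  rw [h4]
  ring

/-- The coefficient of `s` in `χ` is `-∂_1 log τ`, and that of `N_j` is `j g_j`, so this is the
leading term of the first order expansion of the flow. -/
theorem pderiv_killCompl_pderiv_logSeries (hp : 2 ≤ p) (hτ : IsInvariantTau p τ) (i : Fin (p - 1)) :
    pderiv ℂ i (killCompl (R := ℂ) (timeEmb (p - 1)) (pderiv ℂ 1 (logSeries τ))) =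
      -(((i : ℕ) + 1 : ℕ) * (locusSpectral p).coeff ((i : ℕ) + 1 : ℕ)) := by
  have hg := locusSpectral_sub_mem p
  have hg' := mem_ordGE_of_sub_mem hg
  have h1 := coeff_eq_one_of_sub_mem hg
  obtain ⟨N, hN⟩ := exists_isFaber hg' h1
  have h := coeffDer_locusWave_sub_mem hp hτ hN i 1 (by have := i.2; lia)
  have h2 := coeff_mul_lead (hN.mem (i + 1)) (locusWave_mem p τ)
  rw [add_zero, hN.coeff_one hg' h1, locusWave_coeff_zero hτ.1.1, mul_one] at h2
  rw [HahnSeries.coeff_sub, h2, coeffDer_coeff, locusWave, coeffHom_coeff,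
    waveLaurent_coeff_one hτ.1.1, RingHom.coe_coe, map_neg, map_neg] at h
  linear_combination -h

/-- The first derivatives of `log τ` on the locus, in terms of the spectral curve. -/
theorem killCompl_pderiv_logSeries (hp : 2 ≤ p) (hτ : IsInvariantTau p τ)
    {X : LaurentSeries (MvPowerSeries (Fin (p - 1)) ℂ)} (hX : X ∈ polyIn (locusSpectral p))
    (hX1 : X - HahnSeries.single (-(p : ℤ)) 1 ∈ ordGE _ 1) {n : ℕ} (hn : n < p) :
    killCompl (R := ℂ) (timeEmb (p - 1)) (pderiv ℂ n.succPNat (logSeries τ)) =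
      -((X - HahnSeries.single (-(p : ℤ)) 1) * euler _ (locusSpectral p)).coeff (n + 1) := by
  have hg := locusSpectral_sub_mem p
  have hg' := mem_ordGE_of_sub_mem hg
  have h1 := coeff_eq_one_of_sub_mem hg
  obtain ⟨N, hN⟩ := exists_isFaber hg' h1
  have hχ := locusWave_mem p τ
  have hχ0 := locusWave_coeff_zero (p := p) hτ.1.1
  have hp0 : (p : ℂ) ≠ 0 := by exact_mod_cast (show p ≠ 0 by lia)
  obtain ⟨q, hq⟩ := exists_eq_sum_iterate_opAt hp hτ p
    (zpow_mul_mem_planeAt hτ.2.1 (locusWave_mem_planeAt hτ.1))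
    (mul_mem_ordGE_of_le (single_mem_ordGE le_rfl 1) hχ (by lia))
  obtain ⟨hε, hw⟩ := wkb_expansion hg hχ hχ0
    (by rw [← map_natCast (C (σ := Fin (p - 1)) (R := ℂ)), ← map_mul, inv_mul_cancel₀ hp0, map_one])
    (by
      rw [← map_natCast (C (σ := Fin (p - 1)) (R := ℂ)),
        ← map_one (C (σ := Fin (p - 1)) (R := ℂ)), ← map_ofNat (C (σ := Fin (p - 1)) (R := ℂ)),
        ← map_mul, ← map_sub]
      congr 1
      ring) hq
  set g := locusSpectral p with hgdef
  set χ := locusWave p τ with hχdef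
  set z : LaurentSeries (MvPowerSeries (Fin (p - 1)) ℂ) := HahnSeries.single (-(p : ℤ)) 1
  have hXq : ∑ k ∈ Finset.range (p + 1), q k • g ^ k = X := by
    refine sub_eq_zero.mp (eq_zero_of_mem_polyIn hg' h1 (sub_mem (sum_mem fun k _ =>
      smul_mem_polyIn _ (pow_mem (self_mem_polyIn _) k)) hX) ?_)
    convert sub_mem hε hX1 using 1
    ring
  rw [hXq] at hw
  set T := ∑ j ∈ Finset.range p, HahnSeries.single (j : ℤ) 1 * N j with hT
  have htr : 2 * T * euler _ g - (euler _ (euler _ g) - euler _ g) ∈ ordGE _ p := by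
    have := hN.trace hg (p - 1)
    rwa [show p - 1 + 1 = p by lia, show ((p - 1 : ℕ) : ℤ) + 1 = p by lia] at this
  have hθg := euler_mem_ordGE hg'
  -- The term `θ²(g) - θ(g)` of the WKB relation is `2 T θ(g)` by the Faber identity. Division by `2
  -- θ(g)`, of degree one, gains one order.
  have hlam : (X - z) * euler _ g * χ + euler _ χ - T * χ ∈ ordGE _ (p + 1) := by
    have e1 : euler _ g * (2 * ((X - z) * euler _ g * χ + euler _ χ - T * χ)) ∈ ordGE _ p := by
      convert sub_mem hw (mul_mem_ordGE_of_le htr hχ (show (p : ℤ) ≤ _ by lia)) using 1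
      ring
    have e2 := mem_ordGE_of_mul hθg (by
      rw [euler_coeff, h1]
      simp) e1
    intro k hk
    have e3 := e2 k (by lia)
    rw [show (2 : LaurentSeries (MvPowerSeries (Fin (p - 1)) ℂ)) = (2 : ℕ) by norm_num,
      coeff_natCast_mul] at e3
    exact (mul_eq_zero.mp e3).resolve_left (by norm_num)
  set F : ℕ → MvPowerSeries (Fin (p - 1)) ℂ := fun j =>
    killCompl (R := ℂ) (timeEmb (p - 1)) (pderiv ℂ j.succPNat (logSeries τ)) with hF
  have hflow : euler _ χ - ∑ j ∈ Finset.range p, HahnSeries.single ((j : ℤ) + 1) 1 *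
      (restrictLaurent (timeEmb (p - 1)) (coeffDer (pderiv ℂ j.succPNat) (waveLaurent τ)) +
        HahnSeries.C (F j) * χ) ∈ ordGE _ (p + 1) := by
    have := coeffHom_mem_ordGE (killCompl (R := ℂ) (timeEmb (p - 1)) :
      MvPowerSeries ℕ+ ℂ →+* MvPowerSeries (Fin (p - 1)) ℂ)
      (euler_waveLaurent_sub_mem hτ.1.1 p)
    simp only [map_sub, map_sum, map_mul, map_add, coeffHom_euler, coeffHom_single, coeffHom_C,
      map_one] at this
    exact this
  have hN0 : N 0 = 0 := hN.zero_eq hg' h1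
  have hNsum : ∑ j ∈ Finset.range p, HahnSeries.single ((j : ℤ) + 1) 1 *
      restrictLaurent (timeEmb (p - 1)) (coeffDer (pderiv ℂ j.succPNat) (waveLaurent τ)) - T * χ ∈
      ordGE _ (p + 1) := by
    obtain ⟨m, rfl⟩ : ∃ m, p = m + 1 := ⟨p - 1, by lia⟩
    rw [hT, Finset.sum_range_succ, Finset.sum_range_succ', hN0, mul_zero, add_zero, Finset.sum_mul,
      add_sub_right_comm, ← Finset.sum_sub_distrib]
    -- For the first `p - 1` times the error `O(s^(p-j))` of the flow is multiplied by `s^(j+1)`.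
    -- The last time needs no expansion, as `s^p ∂_p χ` is already `O(s^(p+1))`.
    refine add_mem (sum_mem fun j hj => ?_) ?_
    · have hj' := Finset.mem_range.mp hj
      have h5 := coeffDer_locusWave_sub_mem hp hτ hN ⟨j, hj'⟩
      have h6 := mul_mem_ordGE_of_le (single_mem_ordGE (le_refl ((j : ℤ) + 1)) 1) h5
        (show ((m + 1 : ℕ) : ℤ) + 1 ≤ _ by push_cast; lia)
      convert h6 using 1
      have h7 : restrictLaurent (timeEmb (m + 1 - 1))
          (coeffDer (pderiv ℂ j.succPNat) (waveLaurent τ)) =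
          coeffDer (pderiv ℂ (⟨j, hj'⟩ : Fin (m + 1 - 1))) (locusWave (m + 1) τ) :=
        restrictLaurent_coeffDer (timeEmb (m + 1 - 1)) ⟨j, hj'⟩ (waveLaurent τ)
      rw [h7, mul_sub]
      push_cast
      ring
    · refine mul_mem_ordGE_of_le (single_mem_ordGE le_rfl 1) (coeffHom_mem_ordGE _ (n := 1) ?_)
        (by push_cast; lia)
      refine ordGE_succ (n := 0) (coeffDer_mem_ordGE _ (waveLaurent_mem τ)) ?_
      rw [coeffDer_coeff, waveLaurent_coeff_zero hτ.1.1, Derivation.map_one_eq_zero]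
  -- All terms containing derivatives of `χ` or the `N_j` have cancelled. The invertible factor `χ`
  -- can be divided out.
  have hmain : χ * ((X - z) * euler _ g + ∑ j ∈ Finset.range p,
      HahnSeries.single ((j : ℤ) + 1) 1 * HahnSeries.C (F j)) ∈ ordGE _ (p + 1) := by
    convert sub_mem (sub_mem hlam hflow) hNsum using 1
    simp only [mul_add, Finset.sum_add_distrib, Finset.mul_sum]
    have : ∀ j : ℕ, χ * (HahnSeries.single ((j : ℤ) + 1) 1 * HahnSeries.C (F j)) =
        HahnSeries.single ((j : ℤ) + 1) 1 * (HahnSeries.C (F j) * χ) := fun j => by ring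
    simp only [this]
    ring
  have h8 := mem_ordGE_of_mul hχ hχ0 hmain (n + 1) (by lia)
  rw [HahnSeries.coeff_add, coeff_sum_single_succ_mul _ _ hn] at h8
  linear_combination h8

end Locus

/-! ### Powers of a local coordinate and coefficient extraction. -/

section Powers

variable {A : Type*} [CommRing A]

/-- The integral powers of a Laurent series with leading term `z`. -/
structure IsPowers (Z : ℤ → LaurentSeries A) : Prop where
  zero : Z 0 = 1
  add : ∀ m n, Z (m + n) = Z m * Z n
  mem : ∀ n, Z n ∈ ordGE A (-n)
  lead : ∀ n, (Z n).coeff (-n) = 1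

theorem isPowers_single : IsPowers fun n : ℤ => (HahnSeries.single (-n) 1 : LaurentSeries A) where
  zero := rfl
  add m n := by rw [HahnSeries.single_mul_single, one_mul, neg_add]
  mem n := single_mem_ordGE le_rfl _
  lead n := HahnSeries.coeff_single_same _ _

namespace IsPowers

variable {Z : ℤ → LaurentSeries A} (hZ : IsPowers Z)
include hZ

/-- The first power as a unit. -/
def unit : (LaurentSeries A)ˣ where
  val := Z 1
  inv := Z (-1)
  val_inv := by rw [← hZ.add, add_neg_cancel, hZ.zero]
  inv_val := by rw [← hZ.add, neg_add_cancel, hZ.zero]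

theorem unit_zpow (n : ℤ) : ((hZ.unit ^ n : (LaurentSeries A)ˣ) : LaurentSeries A) = Z n := by
  induction n using Int.induction_on with
  | zero => rw [zpow_zero, hZ.zero]; rfl
  | succ n ih => rw [zpow_add_one, Units.val_mul, ih, hZ.add]; rfl
  | pred n ih => rw [zpow_sub_one, Units.val_mul, ih, sub_eq_add_neg, hZ.add]; rfl

/-- The evaluation of Laurent polynomials. -/
def eval : LaurentPolynomial A →+* LaurentSeries A := LaurentPolynomial.eval₂ HahnSeries.C hZ.unit

theorem eval_C_mul_T (a : A) (n : ℤ) :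
    hZ.eval (LaurentPolynomial.C a * LaurentPolynomial.T n) = HahnSeries.C a * Z n := by
  rw [eval, LaurentPolynomial.eval₂_C_mul_T, hZ.unit_zpow]

theorem eval_T (n : ℤ) : hZ.eval (LaurentPolynomial.T n) = Z n := by
  rw [eval, LaurentPolynomial.eval₂_T, hZ.unit_zpow]

theorem eval_C (a : A) : hZ.eval (LaurentPolynomial.C a) = HahnSeries.C a :=
  LaurentPolynomial.eval₂_C _ _ _

theorem eval_eval₂ (P : Polynomial A) (G : LaurentPolynomial A) :
    hZ.eval (P.eval₂ LaurentPolynomial.C G) = P.eval₂ HahnSeries.C (hZ.eval G) := by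
  rw [Polynomial.hom_eval₂]
  congr 1
  ext1 a
  exact hZ.eval_C a

theorem eval_eq_sum (F : LaurentPolynomial A) :
    hZ.eval F = ∑ n ∈ F.coeff.support, HahnSeries.C (F.coeff n) * Z n := by
  classical
  have h : ∀ s : Finset ℤ, F.coeff.support ⊆ s →
      hZ.eval F = ∑ n ∈ s, HahnSeries.C (F.coeff n) * Z n := by
    induction F using LaurentPolynomial.induction_on' with
    | add F G hF hG =>
      intro s hs
      have h1 := hF (s ∪ (F.coeff.support ∪ G.coeff.support)) (by
        intro x hx; simp only [Finset.mem_union]; exact Or.inr (Or.inl hx))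
      have h2 := hG (s ∪ (F.coeff.support ∪ G.coeff.support)) (by
        intro x hx; simp only [Finset.mem_union]; exact Or.inr (Or.inr hx))
      rw [map_add, h1, h2, ← Finset.sum_add_distrib]
      symm
      refine (Finset.sum_subset Finset.subset_union_left fun x _ hx => ?_).trans
        (Finset.sum_congr rfl fun x _ => ?_)
      · have : (F + G).coeff x = 0 := by
          by_contra h
          exact hx (hs (Finsupp.mem_support_iff.mpr h))
        rw [this, map_zero, zero_mul]
      · rw [AddMonoidAlgebra.coeff_add, Finsupp.add_apply, map_add, add_mul]
    | C_mul_T n a =>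
      intro s hs
      rw [eval_C_mul_T]
      have hc (m : ℤ) : (LaurentPolynomial.C a * LaurentPolynomial.T n).coeff m =
          if n = m then a else 0 := by
        rw [← LaurentPolynomial.single_eq_C_mul_T, AddMonoidAlgebra.coeff_single,
          Finsupp.single_apply]
      by_cases ha : a = 0
      · rw [ha, map_zero, zero_mul, Finset.sum_eq_zero]
        intro m _
        rw [map_zero, zero_mul]
        simp
      · rw [Finset.sum_eq_single n]
        · rw [hc, if_pos rfl]
        · intro m _ hm
          rw [hc, if_neg (Ne.symm hm), map_zero, zero_mul]
        · intro hn
          refine absurd (hs (Finsupp.mem_support_iff.mpr ?_)) hn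
          rwa [hc, if_pos rfl]
  exact h _ subset_rfl

theorem eval_mem {F : LaurentPolynomial A} {n : ℤ} (hF : ∀ m > -n, F.coeff m = 0) :
    hZ.eval F ∈ ordGE A n := by
  rw [hZ.eval_eq_sum]
  refine sum_mem fun m hm => C_mul_mem_ordGE _ (ordGE_anti ?_ (hZ.mem m))
  by_contra h
  exact Finsupp.mem_support_iff.mp hm (hF m (by lia))

/-- The powers have distinct leading degrees, so the largest exponent of `F` is visible in its
value. Together with `eval_mem` this makes the order independent of the system of powers, which
transfers estimates between `z` and `V'(u)^(1/p)`. -/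
theorem coeff_eq_zero_of_eval_mem {F : LaurentPolynomial A} {n : ℤ} (hF : hZ.eval F ∈ ordGE A n) :
    ∀ m > -n, F.coeff m = 0 := by
  classical
  by_contra! ⟨m₀, hm₀, h0⟩
  have hne : F.coeff.support.Nonempty := ⟨m₀, Finsupp.mem_support_iff.mpr h0⟩
  set m := F.coeff.support.max' hne with hm
  have hmm : m₀ ≤ m := Finset.le_max' _ _ (Finsupp.mem_support_iff.mpr h0)
  have hmem : m ∈ F.coeff.support := Finset.max'_mem _ _
  have h1 := hF (-m) (by lia)
  rw [hZ.eval_eq_sum, HahnSeries.coeff_sum, Finset.sum_eq_single_of_mem m hmem,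
    HahnSeries.C_mul_eq_smul, HahnSeries.coeff_smul, hZ.lead, smul_eq_mul, mul_one] at h1
  · exact Finsupp.mem_support_iff.mp hmem h1
  · intro k hk hkm
    have : k ≤ m := Finset.le_max' _ _ hk
    exact C_mul_mem_ordGE _ (hZ.mem k) _ (by lia)

theorem euler_powers (n : ℤ) : euler A (Z n) = HahnSeries.C (n : A) * (Z n * (euler A (Z 1) * Z (-1))) := by
  have hs (n : ℤ) : euler A (Z (n + 1)) =
      Z 1 * euler A (Z n) + Z (n + 1) * (euler A (Z 1) * Z (-1)) := by
    have h1 : Z 1 * Z (-1) = 1 := by rw [← hZ.add, add_neg_cancel, hZ.zero]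
    rw [hZ.add, euler_mul]
    linear_combination -Z n * euler A (Z 1) * h1
  have h1 : Z 1 * Z (-1) = 1 := by rw [← hZ.add, add_neg_cancel, hZ.zero]
  induction n using Int.induction_on with
  | zero => rw [hZ.zero, euler_one]; simp
  | succ n ih =>
    rw [hs, ih, hZ.add]
    push_cast
    rw [map_add, map_one]
    ring
  | pred n ih =>
    have h2 := hs (-n - 1)
    rw [sub_add_cancel, ih] at h2
    have h3 : Z (-n) = Z (-n - 1) * Z 1 := by rw [← hZ.add, sub_add_cancel]
    rw [h3] at h2
    push_cast at h2 ⊢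
    rw [map_sub, map_one]
    linear_combination (-Z (-1)) * h2 + (-euler A (Z (-n - 1)) +
      (HahnSeries.C (-(n : A)) - 1) * Z (-n - 1) * (euler A (Z 1) * Z (-1))) * h1

variable [IsDomain A] [CharZero A]

/-- For `n ≠ 0`, `n` times this product is `θ(Z n)`, which has no constant term. For `n = 0` it is
the logarithmic derivative, with constant term `1`. -/
theorem coeff_zero_mul_logDer (n : ℤ) :
    (Z n * (euler A (Z 1) * Z (-1))).coeff 0 = if n = 0 then 1 else 0 := by
  split_ifs with h
  · rw [h, hZ.zero, one_mul]
    have := coeff_mul_lead (euler_mem_ordGE (hZ.mem 1)) (hZ.mem (-1))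
    rw [show (-1 + -(-1) : ℤ) = 0 by norm_num] at this
    rw [this, hZ.lead, euler_coeff, hZ.lead]
    norm_num
  · have h1 := coeff_zero_euler (Z n)
    rw [hZ.euler_powers, HahnSeries.C_mul_eq_smul, HahnSeries.coeff_smul, smul_eq_mul] at h1
    exact (mul_eq_zero.mp h1).resolve_left (by exact_mod_cast h)

/-- Residues do not depend on the coordinate: coefficients of `F` are recovered from its value at
any system of powers. -/
theorem coeff_zero_eval_mul_logDer (n : ℤ) (F : LaurentPolynomial A) :
    (Z n * (euler A (Z 1) * Z (-1)) * hZ.eval F).coeff 0 = F.coeff (-n) := by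
  have h (k : ℤ) : (Z n * (euler A (Z 1) * Z (-1)) * (HahnSeries.C (F.coeff k) * Z k)).coeff 0 =
      if k = -n then F.coeff k else 0 := by
    have e : Z n * (euler A (Z 1) * Z (-1)) * (HahnSeries.C (F.coeff k) * Z k) =
        HahnSeries.C (F.coeff k) * (Z (n + k) * (euler A (Z 1) * Z (-1))) := by
      rw [hZ.add]
      ring
    rw [e, HahnSeries.C_mul_eq_smul, HahnSeries.coeff_smul, hZ.coeff_zero_mul_logDer, smul_eq_mul,
      mul_ite, mul_one, mul_zero]
    congr 1
    exact propext ⟨fun h => by lia, fun h => by lia⟩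
  rw [hZ.eval_eq_sum, Finset.mul_sum, HahnSeries.coeff_sum]
  simp only [h, Finset.sum_ite_eq']
  split_ifs with h0
  · rfl
  · exact (Finsupp.notMem_support_iff.mp h0).symm

theorem coeff_zero_powers_mul_euler_eval (n : ℤ) (F : LaurentPolynomial A) :
    (Z n * euler A (hZ.eval F)).coeff 0 = -(n * F.coeff (-n)) := by
  rw [coeff_zero_mul_euler, hZ.euler_powers, mul_assoc, HahnSeries.C_mul_eq_smul,
    HahnSeries.coeff_smul, hZ.coeff_zero_eval_mul_logDer, smul_eq_mul]

end IsPowers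

theorem eval_single_coeff (F : LaurentPolynomial A) (k : ℤ) :
    ((isPowers_single (A := A)).eval F).coeff k = F.coeff (-k) := by
  induction F using LaurentPolynomial.induction_on' with
  | add F G hF hG => rw [map_add, HahnSeries.coeff_add, hF, hG]; rfl
  | C_mul_T n a =>
    classical
    rw [IsPowers.eval_C_mul_T, ← LaurentPolynomial.single_eq_C_mul_T, HahnSeries.C_apply,
      HahnSeries.single_mul_single, AddMonoidAlgebra.coeff_single, Finsupp.single_apply,
      HahnSeries.coeff_single]
    rw [zero_add, mul_one]
    congr 1
    exact propext ⟨fun h => by lia, fun h => by lia⟩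

end Powers

/-! ### Taylor expansion and divided differences of polynomials. -/

section Taylor

variable {A : Type*} [CommRing A]

theorem eval₂_derivative_X_pow (x : LaurentSeries A) (k : ℕ) :
    (Polynomial.derivative (Polynomial.X ^ k : Polynomial A)).eval₂ HahnSeries.C x = dpow x k := by
  induction k with
  | zero => simp [dpow]
  | succ k ih =>
    rw [pow_succ', Polynomial.derivative_mul, Polynomial.eval₂_add, Polynomial.eval₂_mul,
      Polynomial.eval₂_mul, ih, dpow]
    simp
    ring

theorem add_pow_sub_mem {x δ : LaurentSeries A} (hx : x ∈ ordGE A (-1)) {m : ℤ} (hm : -1 ≤ m)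
    (hδ : δ ∈ ordGE A m) (k : ℕ) :
    (x + δ) ^ k - x ^ k - dpow x k * δ ∈ ordGE A (2 * m + 2 - k) := by
  induction k with
  | zero => simp [dpow]
  | succ k ih =>
    have h1 := mul_mem_ordGE_of_le (add_mem hx (ordGE_anti hm hδ)) ih
      (show 2 * m + 2 - (k + 1 : ℕ) ≤ _ by push_cast; lia)
    have h2 := mul_mem_ordGE_of_le (mul_mem_ordGE hδ hδ) (dpow_mem hx k)
      (show 2 * m + 2 - (k + 1 : ℕ) ≤ _ by push_cast; lia)
    convert add_mem h1 h2 using 1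
    rw [dpow]
    ring

theorem eval₂_derivative (P : Polynomial A) (x : LaurentSeries A) {n : ℕ} (hn : P.natDegree < n) :
    (Polynomial.derivative P).eval₂ HahnSeries.C x =
      ∑ k ∈ Finset.range n, P.coeff k • dpow x k := by
  conv_lhs => rw [P.as_sum_range' n hn]
  rw [Polynomial.derivative_sum, Polynomial.eval₂_finsetSum]
  refine Finset.sum_congr rfl fun k _ => ?_
  rw [← Polynomial.C_mul_X_pow_eq_monomial, Polynomial.derivative_C_mul, Polynomial.eval₂_mul,
    Polynomial.eval₂_C, eval₂_derivative_X_pow, HahnSeries.C_mul_eq_smul]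

theorem euler_eval₂ (P : Polynomial A) (x : LaurentSeries A) :
    euler A (P.eval₂ HahnSeries.C x) =
      (Polynomial.derivative P).eval₂ HahnSeries.C x * euler A x := by
  rw [eval₂_C_eq_sum P x (Nat.lt_succ_self _), eval₂_derivative P x (Nat.lt_succ_self _), map_sum,
    ← sum_smul_mul]
  exact Finset.sum_congr rfl fun k _ => by rw [euler_smul, euler_pow_eq]

theorem taylor_mem (P : Polynomial A) {d : ℕ} (hd : P.natDegree ≤ d) {x δ : LaurentSeries A}
    (hx : x ∈ ordGE A (-1)) {m : ℤ} (hm : -1 ≤ m) (hδ : δ ∈ ordGE A m) :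
    P.eval₂ HahnSeries.C (x + δ) - P.eval₂ HahnSeries.C x -
      (Polynomial.derivative P).eval₂ HahnSeries.C x * δ ∈ ordGE A (2 * m + 2 - d) := by
  have hd' := Nat.lt_succ_of_le hd
  rw [eval₂_C_eq_sum P _ hd', eval₂_C_eq_sum P _ hd', eval₂_derivative P x hd', ← sum_smul_mul,
    ← Finset.sum_sub_distrib, ← Finset.sum_sub_distrib]
  refine sum_mem fun k hk => ?_
  have := Finset.mem_range.mp hk
  rw [← smul_sub, ← smul_sub]
  exact Submodule.smul_mem _ _ (ordGE_anti (by lia) (add_pow_sub_mem hx hm hδ k))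

/-- The divided difference of a monic polynomial of degree `d`. -/
theorem exists_sub_eq_mul {P : Polynomial A} {d : ℕ} (hd : P.natDegree ≤ d) (h1 : P.coeff d = 1)
    {x y : LaurentSeries A} (hx : x ∈ ordGE A (-1)) (hx1 : x.coeff (-1) = 1)
    (hy : y ∈ ordGE A (-1)) (hy1 : y.coeff (-1) = 1) :
    ∃ K ∈ ordGE A (1 - d), K.coeff (1 - d) = d ∧
      P.eval₂ HahnSeries.C x - P.eval₂ HahnSeries.C y = K * (x - y) := by
  have key (k : ℕ) : ∃ K ∈ ordGE A (1 - k), K.coeff (1 - k) = k ∧ x ^ k - y ^ k = K * (x - y) := by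
    induction k with
    | zero => exact ⟨0, zero_mem _, by simp, by simp⟩
    | succ k ih =>
      obtain ⟨K, hK, hK1, hK2⟩ := ih
      have h2 := coeff_mul_lead hx hK
      have e : (1 - (k + 1 : ℕ) : ℤ) = -k := by push_cast; ring
      rw [show (-1 + (1 - k) : ℤ) = -k by ring, hx1, hK1, one_mul] at h2
      refine ⟨x * K + y ^ k, add_mem (mul_mem_ordGE_of_le hx hK (by push_cast; lia))
        (by rw [e]; exact pow_mem_ordGE_neg hy k), ?_, ?_⟩
      · rw [e, HahnSeries.coeff_add, h2, coeff_pow_neg hy hy1]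
        push_cast
        rfl
      · linear_combination x * hK2
  choose K hK hK1 hK2 using key
  have hd' := Nat.lt_succ_of_le hd
  refine ⟨∑ k ∈ Finset.range (d + 1), P.coeff k • K k, sum_mem fun k hk => ?_, ?_, ?_⟩
  · have := Finset.mem_range.mp hk
    exact Submodule.smul_mem _ _ (ordGE_anti (by lia) (hK k))
  · rw [Finset.sum_range_succ, HahnSeries.coeff_add, HahnSeries.coeff_sum, Finset.sum_eq_zero,
      zero_add, HahnSeries.coeff_smul, h1, one_smul, hK1]
    intro k hk
    have := Finset.mem_range.mp hk
    rw [HahnSeries.coeff_smul, hK k _ (by lia), smul_zero]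
  · rw [eval₂_C_eq_sum P _ hd', eval₂_C_eq_sum P _ hd', ← sum_smul_mul, ← Finset.sum_sub_distrib]
    exact Finset.sum_congr rfl fun k _ => by rw [← smul_sub, hK2]

end Taylor

theorem coeff_one_eq {A : Type*} [CommRing A] (f : LaurentSeries A) :
    f.coeff 1 = (f * euler A (HahnSeries.single (-1) 1)).coeff 0 := by
  rw [euler_single, mul_comm, HahnSeries.coeff_single_mul]
  simp

/-! ### Fractional powers of monic polynomials. -/

section FracPow

variable {A : Type} [CommRing A] [Algebra ℚ A] {p : ℕ} {Q : Polynomial A}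

omit [Algebra ℚ A] in
theorem hasSubst_reflect_sub_one (h1 : Q.coeff p = 1) :
    PowerSeries.HasSubst (((Polynomial.reflect p Q : Polynomial A) : PowerSeries A) - 1) := by
  refine PowerSeries.HasSubst.of_constantCoeff_zero' ?_
  rw [map_sub, map_one, ← PowerSeries.coeff_zero_eq_constantCoeff_apply, Polynomial.coeff_coe,
    Polynomial.coeff_reflect, Polynomial.revAt_zero, h1, sub_self]

omit [Algebra ℚ A] in
theorem ofPowerSeries_coe (P : Polynomial A) :
    HahnSeries.ofPowerSeries ℤ A (P : PowerSeries A) =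
      P.eval₂ HahnSeries.C (HahnSeries.single 1 1) := by
  induction P using Polynomial.induction_on' with
  | add P R hP hR => rw [Polynomial.coe_add, map_add, hP, hR, Polynomial.eval₂_add]
  | monomial n a =>
    rw [Polynomial.eval₂_monomial, ← Polynomial.C_mul_X_pow_eq_monomial, Polynomial.coe_mul,
      Polynomial.coe_C, Polynomial.coe_pow, Polynomial.coe_X, map_mul, map_pow,
      HahnSeries.ofPowerSeries_C, HahnSeries.ofPowerSeries_X]

theorem fracPow_self (hp : p ≠ 0) (hQ : Q.natDegree ≤ p) (h1 : Q.coeff p = 1) :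
    fracPow p Q p = Q.eval₂ HahnSeries.C (HahnSeries.single (-1) 1) := by
  have hs := hasSubst_reflect_sub_one h1
  have e1 : (((p : ℤ) : ℚ) / (p : ℚ)) = ((1 : ℕ) : ℚ) := by
    have : (p : ℚ) ≠ 0 := by exact_mod_cast hp
    push_cast
    field_simp
  have e2 : PowerSeries.subst (((Polynomial.reflect p Q : Polynomial A) : PowerSeries A) - 1)
      (PowerSeries.binomialSeries A (((p : ℤ) : ℚ) / (p : ℚ))) =
      ((Polynomial.reflect p Q : Polynomial A) : PowerSeries A) := by
    rw [e1, PowerSeries.binomialSeries_nat, pow_one, ← PowerSeries.coe_substAlgHom hs, map_add,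
      map_one, PowerSeries.substAlgHom_X, add_sub_cancel]
  let inv : Invertible (HahnSeries.single (-1) (1 : A) : LaurentSeries A) :=
    { invOf := HahnSeries.single 1 1
      invOf_mul_self := by rw [HahnSeries.single_mul_single, one_mul]; rfl
      mul_invOf_self := by rw [HahnSeries.single_mul_single, one_mul]; rfl }
  have e3 := Polynomial.eval₂_reflect_mul_pow HahnSeries.C
    (HahnSeries.single (-1) (1 : A) : LaurentSeries A) p Q hQ
  rw [HahnSeries.single_pow, one_pow, show p • (-1 : ℤ) = -(p : ℤ) by simp, mul_comm] at e3
  rw [fracPow, e2, ofPowerSeries_coe]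
  exact e3

theorem isPowers_fracPow (h1 : Q.coeff p = 1) : IsPowers (fracPow p Q) where
  zero := by
    have e := map_one (PowerSeries.substAlgHom (R := A) (hasSubst_reflect_sub_one h1))
    rw [PowerSeries.coe_substAlgHom] at e
    rw [fracPow, Int.cast_zero, zero_div, PowerSeries.binomialSeries_zero, e, neg_zero]
    exact (one_mul _).trans (map_one (HahnSeries.ofPowerSeries ℤ A))
  add m n := by
    have hs := hasSubst_reflect_sub_one h1
    rw [fracPow, fracPow, fracPow, Int.cast_add, add_div, PowerSeries.binomialSeries_add,
      PowerSeries.subst_mul hs, map_mul, neg_add,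
      show (HahnSeries.single (-m + -n) 1 : LaurentSeries A) =
        HahnSeries.single (-m) 1 * HahnSeries.single (-n) 1 by
      rw [HahnSeries.single_mul_single, one_mul]]
    ring
  mem n := by
    have := single_mul_mem_ordGE (-n) (1 : A) (ofPowerSeries_mem (PowerSeries.subst
      (((Polynomial.reflect p Q : Polynomial A) : PowerSeries A) - 1)
        (PowerSeries.binomialSeries A ((n : ℚ) / (p : ℚ)))))
    rwa [add_zero] at this
  lead n := by
    have hs := hasSubst_reflect_sub_one h1
    rw [fracPow, HahnSeries.coeff_single_mul, sub_self, one_mul]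
    refine (ofPowerSeries_coeff_nat _ 0).trans ?_
    rw [PowerSeries.coeff_zero_eq_constantCoeff_apply]
    have h0 : PowerSeries.constantCoeff
        (((Polynomial.reflect p Q : Polynomial A) : PowerSeries A) - 1) = 0 := by
      rw [map_sub, map_one, ← PowerSeries.coeff_zero_eq_constantCoeff_apply, Polynomial.coeff_coe,
        Polynomial.coeff_reflect, Polynomial.revAt_zero, h1, sub_self]
    have h2 := PowerSeries.constantCoeff_subst_eq_zero h0
      (PowerSeries.binomialSeries A ((n : ℚ) / (p : ℚ)) - 1) (by simp)
    rw [← PowerSeries.coe_substAlgHom hs, map_sub, map_one, PowerSeries.coe_substAlgHom hs,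
      map_sub, map_one, sub_eq_zero] at h2
    exact h2

end FracPow

/-! ### Residues in `u` from coefficients in `z`. -/

section Inversion

variable {A : Type} [CommRing A] [IsDomain A] [CharZero A] [Algebra ℚ A] {p : ℕ}
  {V : Polynomial A} {G : LaurentPolynomial A}

/-- The data of a polynomial `V` of degree `p + 1` with monic derivative, and a Laurent polynomial
`G = T + O(T⁻¹)` without terms `T⁻ⁱ`, `i ≥ p`. -/
structure IsSpectralPair (p : ℕ) (V : Polynomial A) (G : LaurentPolynomial A) : Prop where
  pos : 0 < p
  natDegree_le : V.natDegree ≤ p + 1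
  coeff_derivative : (Polynomial.derivative V).coeff p = 1
  coeff_one : G.coeff 1 = 1
  coeff_zero : G.coeff 0 = 0
  coeff_pos : ∀ n > 1, G.coeff n = 0
  coeff_neg : ∀ n : ℤ, n ≤ -p → G.coeff n = 0

namespace IsSpectralPair

variable (h : IsSpectralPair p V G)
include h

omit [IsDomain A] [CharZero A] in
theorem isPowers : IsPowers (fracPow p (Polynomial.derivative V)) :=
  isPowers_fracPow h.coeff_derivative

omit [IsDomain A] [CharZero A] [Algebra ℚ A] in
theorem natDegree_derivative_le : (Polynomial.derivative V).natDegree ≤ p :=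
  (Polynomial.natDegree_derivative_le V).trans (by have := h.natDegree_le; lia)

omit [IsDomain A] [CharZero A] in
theorem fracPow_eq : fracPow p (Polynomial.derivative V) p =
    (Polynomial.derivative V).eval₂ HahnSeries.C (HahnSeries.single (-1) 1) :=
  fracPow_self h.pos.ne' h.natDegree_derivative_le h.coeff_derivative

omit [IsDomain A] [CharZero A] [Algebra ℚ A] in
theorem eval_mem {Z : ℤ → LaurentSeries A} (hZ : IsPowers Z) :
    hZ.eval G ∈ ordGE A (-1) ∧ (hZ.eval G).coeff (-1) = 1 := by
  refine ⟨hZ.eval_mem fun m hm => h.coeff_pos m (by lia), ?_⟩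
  have : hZ.eval (G - LaurentPolynomial.T 1) ∈ ordGE A 0 := by
    refine hZ.eval_mem fun m hm => ?_
    rw [AddMonoidAlgebra.coeff_sub, Finsupp.sub_apply, LaurentPolynomial.T_apply]
    rcases (show m = 1 ∨ 1 < m by lia) with rfl | hm
    · rw [if_pos rfl, h.coeff_one, sub_self]
    · rw [if_neg (by lia), h.coeff_pos m hm, sub_zero]
  rw [map_sub, hZ.eval_T] at this
  have h1 := this (-1) (by lia)
  rwa [HahnSeries.coeff_sub, hZ.lead, sub_eq_zero] at h1

omit [IsDomain A] [CharZero A] [Algebra ℚ A] in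
theorem eval_single_sub_mem : (isPowers_single (A := A)).eval G - HahnSeries.single (-1) 1 ∈
    ordGE A 1 := by
  have : (isPowers_single (A := A)).eval (G - LaurentPolynomial.T 1) ∈ ordGE A 1 := by
    refine isPowers_single.eval_mem fun m hm => ?_
    rw [AddMonoidAlgebra.coeff_sub, Finsupp.sub_apply, LaurentPolynomial.T_apply]
    rcases (show m = 0 ∨ m = 1 ∨ 1 < m by lia) with rfl | rfl | hm
    · rw [if_neg (by lia), h.coeff_zero, sub_zero]
    · rw [if_pos rfl, h.coeff_one, sub_self]
    · rw [if_neg (by lia), h.coeff_pos m hm, sub_zero]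
  rwa [map_sub, isPowers_single.eval_T] at this

theorem euler_single_mul_fracPow :
    (euler A (HahnSeries.single (-1) 1) * fracPow p (Polynomial.derivative V) p).coeff 0 = 0 := by
  rw [h.fracPow_eq, euler_single, eval₂_C_eq_sum _ _ (Nat.lt_succ_self _),
    HahnSeries.coeff_single_mul, HahnSeries.coeff_sum, Finset.sum_eq_zero, mul_zero]
  intro k _
  rw [HahnSeries.coeff_smul, HahnSeries.single_pow, HahnSeries.coeff_single_of_ne (by simp; lia),
    smul_zero]

/-- The two forms of the condition defining `V`: in the variable `u`, and in the variable
`z = V'(u)^(1/p)`. -/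
theorem sub_mem_iff :
    HahnSeries.single (-1) 1 - h.isPowers.eval G ∈ ordGE A (p + 1) ↔
      (Polynomial.derivative V).eval₂ HahnSeries.C ((isPowers_single (A := A)).eval G) -
        HahnSeries.single (-(p : ℤ)) 1 ∈ ordGE A 1 := by
  set Z := fracPow p (Polynomial.derivative V) with hZdef
  have hZ : IsPowers Z := h.isPowers
  set u : LaurentSeries A := HahnSeries.single (-1) 1 with hu
  set y := hZ.eval G with hy
  have hu' : u ∈ ordGE A (-1) := single_mem_ordGE le_rfl _
  have hu1 : u.coeff (-1) = 1 := HahnSeries.coeff_single_same _ _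
  obtain ⟨hy', hy1⟩ := h.eval_mem hZ
  obtain ⟨K, hK, hK1, hK2⟩ := exists_sub_eq_mul h.natDegree_derivative_le h.coeff_derivative
    hu' hu1 hy' hy1
  set E : LaurentPolynomial A :=
    (Polynomial.derivative V).eval₂ LaurentPolynomial.C G - LaurentPolynomial.T p with hE
  have hEz : (isPowers_single (A := A)).eval E =
      (Polynomial.derivative V).eval₂ HahnSeries.C ((isPowers_single (A := A)).eval G) -
        HahnSeries.single (-(p : ℤ)) 1 := by
    rw [hE, map_sub, IsPowers.eval_eval₂, IsPowers.eval_T]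
  have hEZ : hZ.eval E = -(K * (u - y)) := by
    have hZp : Z p = (Polynomial.derivative V).eval₂ HahnSeries.C u := h.fracPow_eq
    rw [hE, map_sub, IsPowers.eval_eval₂, IsPowers.eval_T, ← hK2, hZp]
    ring
  rw [← hEz]
  constructor
  · intro hδ
    refine IsPowers.eval_mem _ (hZ.coeff_eq_zero_of_eval_mem ?_)
    rw [hEZ]
    exact neg_mem (mul_mem_ordGE_of_le hK hδ (by lia))
  · intro hε
    have hEm : hZ.eval E ∈ ordGE A 1 :=
      hZ.eval_mem (IsPowers.coeff_eq_zero_of_eval_mem _ hε)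
    rw [hEZ, neg_mem_iff] at hEm
    have hp0 : (p : ℚ) ≠ 0 := by exact_mod_cast h.pos.ne'
    have hpA : algebraMap ℚ A (p : ℚ)⁻¹ * (p : A) = 1 := by
      rw [← map_natCast (algebraMap ℚ A), ← map_mul, inv_mul_cancel₀ hp0, map_one]
    have hδ : u - y ∈ ordGE A p := by
      have := mem_ordGE_of_mul (C_mul_mem_ordGE (algebraMap ℚ A (p : ℚ)⁻¹) hK)
        (by rw [HahnSeries.C_mul_eq_smul, HahnSeries.coeff_smul, hK1, smul_eq_mul, hpA])
        (by rw [mul_assoc]; exact C_mul_mem_ordGE _ hEm)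
      rwa [sub_sub_cancel] at this
    -- The order count gives only `O(s^p)`. The coefficient of `s^p` is, up to the factor `p`, the
    -- residue of `(u - y) d V'(u)`. This vanishes because `V'(u)` is a polynomial in `u` and `G`
    -- has no term `T⁻ᵖ`.
    refine ordGE_succ hδ ?_
    have h1 := coeff_mul_lead hδ (euler_mem_ordGE (hZ.mem p))
    rw [add_neg_cancel, euler_coeff, hZ.lead, sub_mul, HahnSeries.coeff_sub] at h1
    have h2 : (y * euler A (Z p)).coeff 0 = 0 := by
      rw [coeff_zero_mul_euler, mul_comm, hZ.coeff_zero_powers_mul_euler_eval, h.coeff_neg _ le_rfl,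
        mul_zero, neg_neg]
    have h3 : (u * euler A (Z p)).coeff 0 = 0 := by
      rw [coeff_zero_mul_euler, h.euler_single_mul_fracPow, neg_zero]
    rw [h2, h3, sub_zero] at h1
    have h4 : ((p : ℤ) : A) ≠ 0 := by exact_mod_cast h.pos.ne'
    refine (mul_eq_zero.mp h1.symm).resolve_right ?_
    simpa using h4

/-- The residues of the fractional powers `V'(u)^(i/p)`, `i ≤ p`. -/
theorem coeff_one_fracPow (hδ : HahnSeries.single (-1) 1 - h.isPowers.eval G ∈ ordGE A (p + 1))
    {i : ℤ} (hi : i ≤ p) :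
    (fracPow p (Polynomial.derivative V) i).coeff 1 = -(i * G.coeff (-i)) := by
  have hZ := h.isPowers
  -- The residue is that of `V'(u)^(i/p) du`. For `i ≤ p` the error in replacing `u` by `y` is too
  -- small to contribute.
  have e : (HahnSeries.single (-1) 1 : LaurentSeries A) =
      hZ.eval G + (HahnSeries.single (-1) 1 - hZ.eval G) := by ring
  rw [coeff_one_eq, e, map_add, mul_add, HahnSeries.coeff_add, hZ.coeff_zero_powers_mul_euler_eval,
    mul_mem_ordGE (hZ.mem i) (euler_mem_ordGE hδ) 0 (by lia), add_zero]

/-- The residues of the fractional powers `V'(u)^((p+i)/p)`, `0 < i < p`. -/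
theorem coeff_one_fracPow_add
    (hδ : HahnSeries.single (-1) 1 - h.isPowers.eval G ∈ ordGE A (p + 1)) {i : ℤ} (hi0 : 0 < i)
    (hi : i < p) :
    (p : A) * (fracPow p (Polynomial.derivative V) (p + i)).coeff 1 =
      ((p : A) + i) * ((((Polynomial.derivative V).eval₂ HahnSeries.C
          ((isPowers_single (A := A)).eval G) - HahnSeries.single (-(p : ℤ)) 1) *
        euler A ((isPowers_single (A := A)).eval G)).coeff i) := by
  set Z := fracPow p (Polynomial.derivative V) with hZdef
  have hZ : IsPowers Z := h.isPowers
  set u : LaurentSeries A := HahnSeries.single (-1) 1 with hu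
  set y := hZ.eval G with hy
  set ω := euler A (Z 1) * Z (-1) with hω
  have hu' : u ∈ ordGE A (-1) := single_mem_ordGE le_rfl _
  have hω0 : ω ∈ ordGE A 0 :=
    mul_mem_ordGE_of_le (euler_mem_ordGE (hZ.mem 1)) (hZ.mem (-1)) (by lia)
  obtain ⟨hy', hy1⟩ := h.eval_mem hZ
  have hZp : Z p = (Polynomial.derivative V).eval₂ HahnSeries.C u := h.fracPow_eq
  have hε := h.sub_mem_iff.mp hδ
  set E : LaurentPolynomial A :=
    (Polynomial.derivative V).eval₂ LaurentPolynomial.C G - LaurentPolynomial.T p with hE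
  have hEz : (isPowers_single (A := A)).eval E =
      (Polynomial.derivative V).eval₂ HahnSeries.C ((isPowers_single (A := A)).eval G) -
        HahnSeries.single (-(p : ℤ)) 1 := by
    rw [hE, map_sub, IsPowers.eval_eval₂, IsPowers.eval_T]
  have hEm : hZ.eval E ∈ ordGE A 1 :=
    hZ.eval_mem (IsPowers.coeff_eq_zero_of_eval_mem _ (hEz ▸ hε))
  have hEZ : hZ.eval E = (Polynomial.derivative V).eval₂ HahnSeries.C y - Z p := by
    rw [hE, map_sub, IsPowers.eval_eval₂, IsPowers.eval_T]
  -- First order Taylor expansion of `V` at `y`, with `V'(y)` replaced by `V'(u)`. Both errors are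
  -- `O(s^(p+2))`, which suffices for `i < p`.
  have hV : (Z i * ω * V.eval₂ HahnSeries.C u).coeff 0 =
      (V.eval₂ LaurentPolynomial.C G).coeff (-i) + (Z (p + i) * ω * (u - y)).coeff 0 := by
    have ht := taylor_mem V h.natDegree_le hy' (by lia) hδ
    rw [add_sub_cancel] at ht
    have e1 : V.eval₂ HahnSeries.C u - V.eval₂ HahnSeries.C y - Z p * (u - y) ∈ ordGE A (p + 2) := by
      convert add_mem (ordGE_anti (by push_cast; lia) ht)
        (mul_mem_ordGE_of_le hEm hδ (show (p + 2 : ℤ) ≤ _ by lia)) using 1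
      rw [hEZ]
      ring
    have e2 := mul_mem_ordGE_of_le (mul_mem_ordGE (hZ.mem i) hω0) e1
      (show (1 : ℤ) ≤ _ by lia) 0 (by lia)
    have e3 := hZ.coeff_zero_eval_mul_logDer i (V.eval₂ LaurentPolynomial.C G)
    rw [IsPowers.eval_eval₂] at e3
    rw [← e3, hZ.add, ← sub_eq_zero, ← sub_sub, ← HahnSeries.coeff_sub, ← HahnSeries.coeff_sub,
      ← e2]
    congr 1
    ring
  -- The correction is the wanted residue again: by parts, the term with `u` gives it, and the term
  -- with `y` vanishes as `G` has no `T^(-p-i)`.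
  have hδω : ((p : A) + i) * (Z (p + i) * ω * (u - y)).coeff 0 = -(Z (p + i)).coeff 1 := by
    have e1 := hZ.euler_powers (p + i)
    have e2 : (euler A (Z (p + i)) * (u - y)).coeff 0 = -(Z (p + i)).coeff 1 := by
      rw [mul_sub, HahnSeries.coeff_sub, ← neg_neg (euler A (Z (p + i)) * u).coeff,
        ← neg_neg (euler A (Z (p + i)) * y).coeff, Pi.neg_apply, Pi.neg_apply, Pi.neg_apply,
        Pi.neg_apply, ← coeff_zero_mul_euler, ← coeff_zero_mul_euler,
        hZ.coeff_zero_powers_mul_euler_eval, h.coeff_neg _ (by lia), coeff_one_eq]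
      ring
    rw [← e2, e1, mul_assoc (HahnSeries.C _), HahnSeries.C_mul_eq_smul, HahnSeries.coeff_smul,
      smul_eq_mul]
    push_cast
    rfl
  have hres : (Z (p + i)).coeff 1 = -(i * (Z i * ω * V.eval₂ HahnSeries.C u).coeff 0) := by
    rw [coeff_one_eq, add_comm, hZ.add, hZp, mul_assoc, ← euler_eval₂, coeff_zero_mul_euler,
      hZ.euler_powers, mul_assoc, HahnSeries.C_mul_eq_smul, HahnSeries.coeff_smul, smul_eq_mul]
  have hVG : (((Polynomial.derivative V).eval₂ HahnSeries.C
      ((isPowers_single (A := A)).eval G) - HahnSeries.single (-(p : ℤ)) 1) *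
        euler A ((isPowers_single (A := A)).eval G)).coeff i =
      -(i * (V.eval₂ LaurentPolynomial.C G).coeff (-i)) := by
    rw [sub_mul, HahnSeries.coeff_sub, ← euler_eval₂, ← IsPowers.eval_eval₂, euler_coeff,
      eval_single_coeff, HahnSeries.coeff_single_mul, euler_coeff, eval_single_coeff,
      h.coeff_neg _ (by lia)]
    ring
  rw [hVG]
  rw [hV] at hres
  -- The residue occurs on both sides, with factors `p + i` and `i`. Solving the linear equation
  -- leaves the factor `p`.
  linear_combination ((p : A) + i) * hres - (i : A) * hδω

end IsSpectralPair

end Inversion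

/-! ### Existence and uniqueness of the coefficients of `V_p'`. -/

section Theta

variable {p : ℕ}

/-- `T + (1/p) ∑_j j t_j T^(j-p)`. -/
def timeCurve (p : ℕ) : LaurentPolynomial (TimePoly p) :=
  LaurentPolynomial.T 1 + ∑ j : Fin (p - 1),
    LaurentPolynomial.C (MvPolynomial.C ((((j : ℕ) : ℂ) + 1) / p) * MvPolynomial.X j) *
      LaurentPolynomial.T (((j : ℕ) : ℤ) + 1 - p)

theorem derivative_potential (θ : Fin (p - 1) → TimePoly p) :
    Polynomial.derivative (potential p θ) =
      Polynomial.X ^ p + ∑ i : Fin (p - 1), Polynomial.C (θ i) * Polynomial.X ^ (i : ℕ) := by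
  have h (n : ℕ) (a : TimePoly p) : Polynomial.derivative
      (Polynomial.C (MvPolynomial.C (((n : ℂ) + 1)⁻¹) * a) * Polynomial.X ^ (n + 1)) =
      Polynomial.C a * Polynomial.X ^ n := by
    have h0 : (MvPolynomial.C (((n : ℂ) + 1)⁻¹) : TimePoly p) * ((n : TimePoly p) + 1) = 1 := by
      rw [← map_natCast (MvPolynomial.C : ℂ →+* TimePoly p),
        ← map_one (MvPolynomial.C : ℂ →+* TimePoly p), ← map_add, ← map_mul,
        inv_mul_cancel₀ (by exact_mod_cast Nat.succ_ne_zero n)]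
    rw [Polynomial.derivative_C_mul_X_pow, Nat.add_sub_cancel]
    congr 2
    push_cast
    linear_combination a * h0
  have h' := h p 1
  rw [mul_one, map_one, one_mul] at h'
  rw [potential, Polynomial.derivative_add, h', Polynomial.derivative_sum]
  simp only [h]

theorem coeff_derivative_potential (θ : Fin (p - 1) → TimePoly p) (n : ℕ) :
    (Polynomial.derivative (potential p θ)).coeff n =
      (if n = p then 1 else 0) + if h : n < p - 1 then θ ⟨n, h⟩ else 0 := by
  rw [derivative_potential, Polynomial.coeff_add, Polynomial.coeff_X_pow, Polynomial.finsetSum_coeff]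
  congr 1
  simp only [Polynomial.coeff_C_mul, Polynomial.coeff_X_pow, mul_ite, mul_one, mul_zero]
  split_ifs with h
  · rw [Finset.sum_eq_single ⟨n, h⟩]
    · rw [if_pos rfl]
    · intro i _ hi
      rw [if_neg]
      rintro rfl
      exact hi rfl
    · simp
  · refine Finset.sum_eq_zero fun i _ => if_neg ?_
    rintro rfl
    exact h i.2

theorem natDegree_potential_le (θ : Fin (p - 1) → TimePoly p) :
    (potential p θ).natDegree ≤ p + 1 := by
  refine Polynomial.natDegree_add_le_of_degree_le (Polynomial.natDegree_C_mul_X_pow_le _ _)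
    (Polynomial.natDegree_sum_le_of_forall_le _ _ fun i _ =>
      (Polynomial.natDegree_C_mul_X_pow_le _ _).trans ?_)
  have := i.2
  lia

theorem coeff_timeCurve (p : ℕ) (n : ℤ) :
    (timeCurve p).coeff n = (if n = 1 then 1 else 0) + ∑ j : Fin (p - 1),
      if n = ((j : ℕ) : ℤ) + 1 - p then
        MvPolynomial.C ((((j : ℕ) : ℂ) + 1) / p) * MvPolynomial.X j else 0 := by
  classical
  rw [timeCurve, AddMonoidAlgebra.coeff_add, Finsupp.add_apply, LaurentPolynomial.T_apply,
    AddMonoidAlgebra.coeff_sum, Finsupp.finsetSum_apply]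
  simp only [← LaurentPolynomial.single_eq_C_mul_T, AddMonoidAlgebra.coeff_single,
    Finsupp.single_apply, eq_comm]

theorem isSpectralPair (hp : 2 ≤ p) (θ : Fin (p - 1) → TimePoly p) :
    IsSpectralPair p (potential p θ) (timeCurve p) where
  pos := by lia
  natDegree_le := natDegree_potential_le θ
  coeff_derivative := by
    rw [coeff_derivative_potential, if_pos rfl, dif_neg (by lia), add_zero]
  coeff_one := by
    rw [coeff_timeCurve, if_pos rfl, Finset.sum_eq_zero, add_zero]
    intro j _
    have := j.2
    rw [if_neg (by lia)]
  coeff_zero := by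
    rw [coeff_timeCurve, if_neg (by lia), Finset.sum_eq_zero, add_zero]
    intro j _
    have := j.2
    rw [if_neg (by lia)]
  coeff_pos n hn := by
    rw [coeff_timeCurve, if_neg (by lia), Finset.sum_eq_zero, add_zero]
    intro j _
    have := j.2
    rw [if_neg (by lia)]
  coeff_neg n hn := by
    rw [coeff_timeCurve, if_neg (by lia), Finset.sum_eq_zero, add_zero]
    intro j _
    have := j.2
    rw [if_neg (by lia)]

theorem eval_timeCurve {Z : ℤ → LaurentSeries (TimePoly p)} (hZ : IsPowers Z) :
    hZ.eval (timeCurve p) = Z 1 + ∑ j : Fin (p - 1),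
      HahnSeries.C (MvPolynomial.C ((((j : ℕ) : ℂ) + 1) / p) * MvPolynomial.X j) *
        Z (((j : ℕ) : ℤ) + 1 - p) := by
  rw [timeCurve, map_add, IsPowers.eval_T, map_sum]
  simp only [IsPowers.eval_C_mul_T]

theorem isTheta_iff_sub_mem (hp : 2 ≤ p) (θ : Fin (p - 1) → TimePoly p) :
    IsTheta p θ ↔ HahnSeries.single (-1) 1 - (isSpectralPair hp θ).isPowers.eval (timeCurve p) ∈
      ordGE _ (p + 1) := by
  rw [eval_timeCurve, ← sub_sub]
  exact ⟨fun h k hk => h k (by lia), fun h k hk => h k (by lia)⟩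

/-- `z + (1/p) ∑_j j t_j z^(j-p)`, with polynomial coefficients. -/
abbrev timeSpectral (p : ℕ) : LaurentSeries (TimePoly p) := isPowers_single.eval (timeCurve p)

theorem timeSpectral_sub_mem (hp : 2 ≤ p) :
    timeSpectral p - HahnSeries.single (-1) 1 ∈ ordGE _ 1 :=
  (isSpectralPair hp 0).eval_single_sub_mem

/-- In the variable `z` the condition is affine in the `θ_i`, whereas in `u` they enter through
fractional powers. -/
theorem isTheta_iff (hp : 2 ≤ p) (θ : Fin (p - 1) → TimePoly p) :
    IsTheta p θ ↔ (Polynomial.derivative (potential p θ)).eval₂ HahnSeries.C (timeSpectral p) -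
        HahnSeries.single (-(p : ℤ)) 1 ∈ ordGE _ 1 := by
  rw [isTheta_iff_sub_mem hp, (isSpectralPair hp θ).sub_mem_iff]

theorem eq_zero_of_eval₂_mem {A : Type*} [CommRing A] {g : LaurentSeries A} (hg : g ∈ ordGE A (-1))
    (h1 : g.coeff (-1) = 1) {P : Polynomial A} (hP : P.eval₂ HahnSeries.C g ∈ ordGE A 1) :
    P = 0 := by
  rw [eval₂_C_eq_sum P g (Nat.lt_succ_self _)] at hP
  have := eq_zero_of_sum_mem (pow_mem_ordGE_neg hg) (coeff_pow_neg hg h1) _ hP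
  ext k
  rcases lt_or_ge k (P.natDegree + 1) with hk | hk
  · rw [this k hk, Polynomial.coeff_zero]
  · rw [Polynomial.coeff_eq_zero_of_natDegree_lt hk, Polynomial.coeff_zero]

/-- Polynomials of degree `m + 1` in `g = z + O(z⁻¹)` of the form `z^(m+1) + O(z⁻¹)` have no
term of degree `m`. -/
theorem coeff_eq_zero_of_sub_sum_mem {A : Type*} [CommRing A] {g : LaurentSeries A}
    (hg : g - HahnSeries.single (-1) 1 ∈ ordGE A 1) {m : ℕ} {b : ℕ → A}
    (hb : HahnSeries.single (-((m + 1 : ℕ) : ℤ)) 1 -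
      ∑ k ∈ Finset.range (m + 1 + 1), b k • g ^ k ∈ ordGE A 1) : b m = 0 := by
  have hg' := mem_ordGE_of_sub_mem hg
  have h1 := coeff_eq_one_of_sub_mem hg
  have h0 := hb (-(m : ℤ)) (by lia)
  have h2 : g ^ (m + 1) - HahnSeries.single (-((m + 1 : ℕ) : ℤ)) 1 ∈ ordGE A (-m + 1) := by
    have e : (HahnSeries.single (-((m + 1 : ℕ) : ℤ)) 1 : LaurentSeries A) =
        HahnSeries.single (-1) 1 ^ (m + 1) := by
      rw [HahnSeries.single_pow, one_pow]
      congr 1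
      simp
    have h3 := add_pow_sub_mem (single_mem_ordGE (le_refl (-1)) (1 : A)) (by lia) hg (m + 1)
    have h4 := mul_mem_ordGE_of_le (dpow_mem (single_mem_ordGE (le_refl (-1)) (1 : A)) (m + 1)) hg
      (show (-m + 1 : ℤ) ≤ _ by push_cast; lia)
    rw [add_sub_cancel, ← e] at h3
    convert add_mem (ordGE_anti (by push_cast; lia) h3) h4 using 1
    abel
  have h3 := h2 (-m) (by lia)
  rw [HahnSeries.coeff_sub, HahnSeries.coeff_single_of_ne (by lia), sub_zero] at h3
  rw [Finset.sum_range_succ, Finset.sum_range_succ, HahnSeries.coeff_sub,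
    HahnSeries.coeff_single_of_ne (by lia), HahnSeries.coeff_add, HahnSeries.coeff_add,
    HahnSeries.coeff_smul, HahnSeries.coeff_smul, h3, coeff_pow_neg hg' h1,
    HahnSeries.coeff_sum, Finset.sum_eq_zero] at h0
  · simpa using h0
  · intro k hk
    have := Finset.mem_range.mp hk
    rw [HahnSeries.coeff_smul, pow_mem_ordGE_neg hg' k _ (by lia), smul_zero]

/-- The `θ_i` are the coefficients of `z^p` in powers of `g` modulo `O(s)`; independence of these
powers gives uniqueness. The power `g^(p-1)` does not occur since `g` has no constant term, in
accordance with the shape of `V_p'`. -/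
theorem existsUnique_isTheta (hp : 2 ≤ p) : ∃! θ : Fin (p - 1) → TimePoly p, IsTheta p θ := by
  have hg := timeSpectral_sub_mem hp
  have hg' := mem_ordGE_of_sub_mem hg
  have h1 := coeff_eq_one_of_sub_mem hg
  refine existsUnique_of_exists_of_unique ?_ ?_
  · obtain ⟨b, hb1, hb⟩ := exists_elim (pow_mem_ordGE_neg hg') (coeff_pow_neg hg' h1) p
      (single_mem_ordGE (le_refl (-(p : ℤ))) (1 : TimePoly p))
    rw [HahnSeries.coeff_single_same] at hb1
    have hbp : b (p - 1) = 0 := by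
      have h := coeff_eq_zero_of_sub_sum_mem hg (m := p - 1) (b := b)
      rw [show p - 1 + 1 = p by lia] at h
      exact h hb
    refine ⟨fun i => b i, (isTheta_iff hp _).mpr ?_⟩
    have hsum : (Polynomial.derivative (potential p fun i : Fin (p - 1) => b i)).eval₂
        HahnSeries.C (timeSpectral p) = ∑ k ∈ Finset.range (p + 1), b k • timeSpectral p ^ k := by
      rw [eval₂_C_eq_sum _ _ (Nat.lt_succ_of_le (isSpectralPair hp _).natDegree_derivative_le)]
      refine Finset.sum_congr rfl fun k hk => ?_
      have := Finset.mem_range.mp hk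
      congr 1
      rw [coeff_derivative_potential]
      rcases (show k = p ∨ k = p - 1 ∨ k < p - 1 by lia) with rfl | rfl | h
      · rw [if_pos rfl, dif_neg (by lia), hb1, add_zero]
      · rw [if_neg (by lia), dif_neg (by lia), hbp, add_zero]
      · rw [if_neg (by lia), dif_pos h, zero_add]
    rw [hsum, ← neg_mem_iff, neg_sub]
    exact hb
  · intro θ θ' hθ hθ'
    have h2 := sub_mem ((isTheta_iff hp θ).mp hθ) ((isTheta_iff hp θ').mp hθ')
    rw [sub_sub_sub_cancel_right, ← Polynomial.eval₂_sub] at h2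
    have h3 := eq_zero_of_eval₂_mem hg' h1 h2
    ext1 i
    have h4 := congrArg (fun P => Polynomial.coeff P (i : ℕ)) h3
    have hi := i.2
    simp only [Polynomial.coeff_sub, coeff_derivative_potential, dif_pos hi,
      Polynomial.coeff_zero] at h4
    linear_combination h4

end Theta

/-! ### The two systems for `log τ` on the locus. -/

section Systems

open MvPowerSeries

variable {p : ℕ} {τ : MvPowerSeries ℕ+ ℂ}

/-- Polynomials in the times as series. -/
abbrev timeCoe (p : ℕ) : TimePoly p →+* MvPowerSeries (Fin (p - 1)) ℂ :=
  MvPolynomial.coeToMvPowerSeries.ringHom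

theorem coeffHom_timeSpectral (p : ℕ) : coeffHom (timeCoe p) (timeSpectral p) = locusSpectral p := by
  rw [timeSpectral, timeCurve, map_add, IsPowers.eval_T, map_sum, map_add, map_sum, locusSpectral,
    spectral, coeffHom_single, map_one]
  congr 1
  refine Finset.sum_congr rfl fun j _ => ?_
  rw [IsPowers.eval_C_mul_T, HahnSeries.C_apply, HahnSeries.single_mul_single, coeffHom_single,
    coe_timeEmb, zero_add, mul_one, map_mul, MvPolynomial.coeToMvPowerSeries.ringHom_apply,
    MvPolynomial.coeToMvPowerSeries.ringHom_apply, MvPolynomial.coe_C, MvPolynomial.coe_X]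
  push_cast
  congr 1
  ring_nf

theorem constantCoeff_restrictTau (p : ℕ) (τ : MvPowerSeries ℕ+ ℂ) :
    constantCoeff (restrictTau p τ) = constantCoeff τ :=
  constantCoeff_killCompl _ _

theorem pderiv_logSeries_restrictTau (hτ : constantCoeff τ = 1) (j : Fin (p - 1)) :
    pderiv ℂ j (logSeries (restrictTau p τ)) =
      killCompl (R := ℂ) (timeEmb (p - 1)) (pderiv ℂ (timeEmb (p - 1) j) (logSeries τ)) := by
  have h0 : constantCoeff (restrictTau p τ) = 1 := (constantCoeff_restrictTau p τ).trans hτ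
  have h1 : restrictTau p τ ≠ 0 := fun h => by simp [h] at h0
  refine mul_left_cancel₀ h1 ?_
  rw [mul_pderiv_logSeries h0, restrictTau, ← map_mul, mul_pderiv_logSeries hτ, pderiv_killCompl]

theorem logSeries_restrictTau (hτ : constantCoeff τ = 1) :
    logSeries (restrictTau p τ) = killCompl (R := ℂ) (timeEmb (p - 1)) (logSeries τ) := by
  have h0 : constantCoeff (restrictTau p τ) = 1 := (constantCoeff_restrictTau p τ).trans hτ
  refine pderiv.ext (fun j => ?_) ?_
  · rw [pderiv_logSeries_restrictTau hτ, pderiv_killCompl]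
  · rw [constantCoeff_logSeries h0, constantCoeff_killCompl, constantCoeff_logSeries hτ]

/-- The first derivatives of `log τ` along the first `p` times, in terms of the spectral curve. -/
theorem killCompl_pderiv_logSeries_eq_coe (hp : 2 ≤ p) {θ : Fin (p - 1) → TimePoly p}
    (hθ : IsTheta p θ) (hτ : IsInvariantTau p τ) {n : ℕ} (hn : n < p) :
    killCompl (R := ℂ) (timeEmb (p - 1)) (pderiv ℂ n.succPNat (logSeries τ)) =
      timeCoe p (-(((Polynomial.derivative (potential p θ)).eval₂ HahnSeries.C (timeSpectral p) -
        HahnSeries.single (-(p : ℤ)) 1) * euler _ (timeSpectral p)).coeff (n + 1)) := by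
  have hX : coeffHom (timeCoe p) ((Polynomial.derivative (potential p θ)).eval₂ HahnSeries.C
      (timeSpectral p)) ∈ polyIn (locusSpectral p) := by
    rw [eval₂_C_eq_sum _ _ (Nat.lt_succ_self _), map_sum]
    refine sum_mem fun k _ => ?_
    rw [coeffHom_smul, map_pow, coeffHom_timeSpectral]
    exact smul_mem_polyIn _ (pow_mem (self_mem_polyIn _) k)
  have hX1 := coeffHom_mem_ordGE (timeCoe p) ((isTheta_iff hp θ).mp hθ)
  rw [map_sub, coeffHom_single, map_one (timeCoe p)] at hX1
  rw [killCompl_pderiv_logSeries hp hτ hX hX1 hn, map_neg, ← coeffHom_coeff, map_mul, map_sub,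
    coeffHom_euler, coeffHom_timeSpectral, coeffHom_single, map_one (timeCoe p)]

theorem firstOrderSystem_logSeries (hp : 2 ≤ p) {θ : Fin (p - 1) → TimePoly p}
    (hθ : IsTheta p θ) (hτ : IsInvariantTau p τ) :
    FirstOrderSystem p θ (logSeries (restrictTau p τ)) := by
  intro j
  have hj := j.2
  rw [pderiv_logSeries_restrictTau hτ.1.1]
  refine (killCompl_pderiv_logSeries_eq_coe hp hθ hτ (show (j : ℕ) < p by lia)).trans ?_
  rw [← MvPolynomial.coeToMvPowerSeries.ringHom_apply]
  congr 1
  have h := (isSpectralPair hp θ).coeff_one_fracPow_add ((isTheta_iff_sub_mem hp θ).mp hθ)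
    (show (0 : ℤ) < (j : ℕ) + 1 by lia) (by lia)
  rw [resInf, dVPow]
  set r := (fracPow p (Polynomial.derivative (potential p θ)) (p + ((j : ℕ) + 1))).coeff 1
  set x := (((Polynomial.derivative (potential p θ)).eval₂ HahnSeries.C (timeSpectral p) -
        HahnSeries.single (-(p : ℤ)) 1) * euler _ (timeSpectral p)).coeff ((j : ℕ) + 1)
  have h0 : ((p : ℂ) + (((j : ℕ) : ℂ) + 1)) ≠ 0 := by
    have : p + ((j : ℕ) + 1) ≠ 0 := by lia
    exact_mod_cast this
  have h1 : (MvPolynomial.C (((p : ℂ) + (((j : ℕ) : ℂ) + 1))⁻¹) : TimePoly p) *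
      ((p : TimePoly p) + (((j : ℕ) : TimePoly p) + 1)) = 1 := by
    rw [← map_natCast (MvPolynomial.C : ℂ →+* TimePoly p),
      ← map_natCast (MvPolynomial.C : ℂ →+* TimePoly p),
      ← map_one (MvPolynomial.C : ℂ →+* TimePoly p), ← map_add, ← map_add, ← map_mul,
      inv_mul_cancel₀ h0]
  have h2 : (MvPolynomial.C (-((p : ℂ) / ((p : ℂ) + (((j : ℕ) : ℂ) + 1)))) : TimePoly p) =
      -((p : TimePoly p) * MvPolynomial.C (((p : ℂ) + (((j : ℕ) : ℂ) + 1))⁻¹)) := by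
    rw [div_eq_mul_inv, map_neg, map_mul, map_natCast]
  rw [h2]
  push_cast at h
  linear_combination MvPolynomial.C (((p : ℂ) + (((j : ℕ) : ℂ) + 1))⁻¹) * h + x * h1

theorem secondOrderSystem_logSeries (hp : 2 ≤ p) {θ : Fin (p - 1) → TimePoly p}
    (hθ : IsTheta p θ) (hτ : IsInvariantTau p τ) :
    SecondOrderSystem p hp θ (logSeries (restrictTau p τ)) := by
  intro j
  have hj := j.2
  have h := (isSpectralPair hp θ).coeff_one_fracPow ((isTheta_iff_sub_mem hp θ).mp hθ)
    (show ((j : ℕ) : ℤ) + 1 ≤ p by lia)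
  rw [resInf, dVPow, h, pderiv_comm, pderiv_logSeries_restrictTau hτ.1.1]
  refine (pderiv_killCompl_pderiv_logSeries hp hτ j).trans ?_
  rw [← coeffHom_timeSpectral, coeffHom_coeff, eval_single_coeff,
    ← MvPolynomial.coeToMvPowerSeries.ringHom_apply, map_neg (timeCoe p), map_mul (timeCoe p),
    map_intCast]
  push_cast
  rfl

theorem eq_add_C_of_pderiv_eq {σ : Type*} {f g : MvPowerSeries σ ℂ}
    (h : ∀ j, pderiv ℂ j f = pderiv ℂ j g) : ∃ a : ℂ, f = g + C a := by
  refine ⟨constantCoeff f - constantCoeff g, pderiv.ext (fun j => ?_) ?_⟩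
  · rw [map_add, pderiv_C, add_zero, h]
  · rw [map_add, constantCoeff_C]
    ring

end Systems

/-! ### KP equations on the locus. -/

section KP

open MvPowerSeries

theorem mem_range_mapDomain_iff {σ ι : Type*} (j : σ ↪ ι) (m : ι →₀ ℕ) :
    m ∈ Set.range (Finsupp.mapDomain j) ↔ ∀ i, m i ≠ 0 → i ∈ Set.range j := by
  constructor
  · rintro ⟨n, rfl⟩ i hi
    by_contra h
    rw [← Finsupp.embDomain_eq_mapDomain] at hi
    exact hi (Finsupp.embDomain_of_notMem_range _ _ _ h)
  · intro h
    refine ⟨m.comapDomain j j.injective.injOn, ?_⟩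
    refine Finsupp.mapDomain_comapDomain _ j.injective _ fun i hi => h i ?_
    simpa using hi

theorem pderiv_rename_apply {σ ι : Type*} (j : σ ↪ ι) (i : σ) (F : MvPowerSeries σ ℂ) :
    pderiv ℂ (j i) (rename j F) = rename j (pderiv ℂ i F) := by
  classical
  ext m
  rw [coeff_pderiv]
  by_cases hm : m ∈ Set.range (Finsupp.mapDomain j)
  · obtain ⟨m, rfl⟩ := hm
    rw [← Finsupp.embDomain_eq_mapDomain, coeff_embDomain_rename, coeff_pderiv, ← Finsupp.embDomain_single, ← Finsupp.embDomain_add,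
      coeff_embDomain_rename, Finsupp.embDomain_apply_self]
  · rw [coeff_rename_eq_zero, coeff_rename_eq_zero, zero_mul]
    · exact hm
    · intro h
      rw [mem_range_mapDomain_iff] at h hm
      exact hm fun k hk => h k (by simp [hk])

theorem pderiv_rename_of_notMem {σ ι : Type*} (j : σ ↪ ι) {i : ι} (hi : i ∉ Set.range j)
    (F : MvPowerSeries σ ℂ) : pderiv ℂ i (rename j F) = 0 := by
  classical
  ext m
  rw [coeff_pderiv, coeff_rename_eq_zero, zero_mul, map_zero]
  intro h
  rw [mem_range_mapDomain_iff] at h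
  exact hi (h i (by simp))

variable {p : ℕ} {τ : MvPowerSeries ℕ+ ℂ}

/-- Along the locus, `log τ` does not depend on the `p`-th time to first order. -/
theorem killCompl_pderiv_logSeries_last (hp : 2 ≤ p) (hτ : IsInvariantTau p τ) :
    killCompl (R := ℂ) (timeEmb (p - 1)) (pderiv ℂ (p - 1).succPNat (logSeries τ)) = 0 := by
  obtain ⟨θ, hθ, -⟩ := existsUnique_isTheta hp
  rw [killCompl_pderiv_logSeries_eq_coe hp hθ hτ (by lia)]
  have hε := (isTheta_iff hp θ).mp hθ
  set g := timeSpectral p with hg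
  set Y := (Polynomial.derivative (potential p θ)).eval₂ HahnSeries.C g with hY
  -- The residue of `Y² dg` is zero. With `Y = z^p + (Y - z^p)`, the squares of both summands have
  -- zero residue, and the cross term is twice the coefficient sought.
  have hYp : Y ∈ polyIn g := ⟨_, rfl⟩
  have h1 := coeff_zero_mul_euler_of_mem_polyIn (mul_mem hYp hYp)
  have hgm := mem_ordGE_of_sub_mem (timeSpectral_sub_mem hp)
  have h2 : ((Y - HahnSeries.single (-(p : ℤ)) 1) * (Y - HahnSeries.single (-(p : ℤ)) 1) *
      euler _ g).coeff 0 = 0 :=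
    mul_mem_ordGE (mul_mem_ordGE hε hε) (euler_mem_ordGE hgm) 0 (by lia)
  have h3 : (HahnSeries.single (-(p : ℤ)) 1 * (HahnSeries.single (-(p : ℤ)) 1 *
      euler _ g)).coeff 0 = 0 := by
    rw [HahnSeries.coeff_single_mul, HahnSeries.coeff_single_mul, euler_coeff, hg,
      eval_single_coeff, (isSpectralPair hp θ).coeff_neg _ (by lia)]
    simp
  have h4 : (HahnSeries.single (-(p : ℤ)) 1 * ((Y - HahnSeries.single (-(p : ℤ)) 1) *
      euler _ g)).coeff 0 =
      ((Y - HahnSeries.single (-(p : ℤ)) 1) * euler _ g).coeff (((p - 1 : ℕ) : ℤ) + 1) := by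
    rw [HahnSeries.coeff_single_mul, one_mul]
    congr 1
    lia
  have h5 : Y * Y * euler _ g = HahnSeries.single (-(p : ℤ)) 1 * (HahnSeries.single (-(p : ℤ)) 1 *
      euler _ g) + (HahnSeries.single (-(p : ℤ)) 1 * ((Y - HahnSeries.single (-(p : ℤ)) 1) *
      euler _ g) + HahnSeries.single (-(p : ℤ)) 1 * ((Y - HahnSeries.single (-(p : ℤ)) 1) *
      euler _ g)) + (Y - HahnSeries.single (-(p : ℤ)) 1) * (Y - HahnSeries.single (-(p : ℤ)) 1) *
      euler _ g := by ring
  rw [h5, HahnSeries.coeff_add, HahnSeries.coeff_add, HahnSeries.coeff_add, h2, h3, h4, zero_add,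
    add_zero, ← two_mul] at h1
  rw [(mul_eq_zero.mp h1).resolve_left two_ne_zero, neg_zero, map_zero]

/-- Its derivatives vanish by stability under `z^p`, so it is constant, and the constant is zero by
its value on the locus. -/
theorem pderiv_logSeries_eq_zero (hp : 2 ≤ p) (hτ : IsInvariantTau p τ) :
    pderiv ℂ (p - 1).succPNat (logSeries τ) = 0 := by
  have h : (((p - 1).succPNat : ℕ+) : ℕ) = p := by
    rw [Nat.succPNat_coe]
    lia
  refine pderiv.ext (fun j => ?_) ?_
  · rw [pderiv_comm, pderiv_pderiv_logSeries_eq_zero hτ.1 (by rw [h]; exact hτ.2.1), map_zero]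
  · rw [← constantCoeff_killCompl (timeEmb (p - 1)), killCompl_pderiv_logSeries_last hp hτ,
      map_zero, map_zero]

/-- The iterated derivative `∂_{i_1} ⋯ ∂_{i_k} u`. -/
abbrev iterPderiv (u : MvPowerSeries ℕ+ ℂ) (l : List ℕ+) : MvPowerSeries ℕ+ ℂ :=
  l.foldr (fun i v => pderiv ℂ i v) u

theorem pderiv_iterPderiv (u : MvPowerSeries ℕ+ ℂ) (i : ℕ+) (l : List ℕ+) :
    pderiv ℂ i (iterPderiv u l) = iterPderiv (pderiv ℂ i u) l := by
  induction l with
  | nil => rfl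
  | cons j l ih =>
    change pderiv ℂ i (pderiv ℂ j (iterPderiv u l)) = pderiv ℂ j (iterPderiv (pderiv ℂ i u) l)
    rw [pderiv_comm, ih]

theorem iterPderiv_zero (l : List ℕ+) : iterPderiv 0 l = 0 := by
  induction l with
  | nil => rfl
  | cons j l ih =>
    change pderiv ℂ j (iterPderiv 0 l) = 0
    rw [ih, map_zero]

theorem iterPderiv_extendTimes (hp : 2 ≤ p) {u : MvPowerSeries ℕ+ ℂ}
    (hu : pderiv ℂ (p - 1).succPNat u = 0) (l : List ℕ+) (hl : ∀ i ∈ l, (i : ℕ) ≤ p) :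
    iterPderiv (extendTimes p (killCompl (R := ℂ) (timeEmb (p - 1)) u)) l =
      extendTimes p (killCompl (R := ℂ) (timeEmb (p - 1)) (iterPderiv u l)) := by
  induction l with
  | nil => rfl
  | cons i l ih =>
    have hi := hl i (by simp)
    have hi' := i.pos
    change pderiv ℂ i (iterPderiv _ l) = extendTimes p (killCompl _ (pderiv ℂ i (iterPderiv u l)))
    rw [ih fun k hk => hl k (by simp [hk])]
    rcases hi.lt_or_eq with h | h
    · have e : i = timeEmb (p - 1) ⟨i - 1, by lia⟩ := by
        refine PNat.eq ?_
        rw [coe_timeEmb]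
        change (i : ℕ) = i - 1 + 1
        lia
      rw [e, pderiv_killCompl, extendTimes, pderiv_rename_apply, extendTimes]
    · have e : i = (p - 1).succPNat := by
        refine PNat.eq ?_
        rw [Nat.succPNat_coe]
        lia
      rw [e, pderiv_iterPderiv, hu, iterPderiv_zero, map_zero, extendTimes,
        pderiv_rename_of_notMem, extendTimes, map_zero]
      rintro ⟨j, hj⟩
      have h1 := congrArg PNat.val hj
      have := j.2
      have h2 := coe_timeEmb (p - 1) j
      have h3 := Nat.succPNat_coe (p - 1)
      change ((timeEmb (p - 1) j : ℕ+) : ℕ) = _ at h1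
      lia

theorem solvesKPUpTo_logSeries (hp : 2 ≤ p) (hτ : IsInvariantTau p τ) :
    SolvesKPUpTo p (logSeries (restrictTau p τ)) := by
  intro E hE hEp
  have h := hE τ hτ.1
  rw [logSeries_restrictTau hτ.1.1]
  have h2 : E.evalAt (extendTimes p (killCompl (R := ℂ) (timeEmb (p - 1)) (logSeries τ))) =
      ((rename (timeEmb (p - 1))).comp (killCompl (R := ℂ) (timeEmb (p - 1)))).comp
        (MvPolynomial.aeval (iterPderiv (logSeries τ))) E := by
    refine MvPolynomial.hom_congr_vars
      (f₁ := (MvPolynomial.aeval (iterPderiv (extendTimes p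
        (killCompl (R := ℂ) (timeEmb (p - 1)) (logSeries τ))))).toRingHom)
      (f₂ := (((rename (timeEmb (p - 1))).comp (killCompl (R := ℂ) (timeEmb (p - 1)))).comp
        (MvPolynomial.aeval (iterPderiv (logSeries τ)))).toRingHom) ?_ ?_ rfl
    · ext x
      simp
    · intro l hl _
      simpa [extendTimes] using
        iterPderiv_extendTimes hp (pderiv_logSeries_eq_zero hp hτ) l (hEp l hl)
  rw [h2, AlgHom.comp_apply]
  exact (congrArg _ h).trans (map_zero _)

end KP

/-! ### KP equations as relations holding for all tau functions. -/

section Universal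

open MvPowerSeries

/-- Families of power series indexed by the KP tau functions. -/
abbrev TauFamily : Type := {τ : MvPowerSeries ℕ+ ℂ // IsKPTau τ} → MvPowerSeries ℕ+ ℂ

/-- The derivation `∂_i` of families. -/
def famDer (i : ℕ+) : Derivation ℂ TauFamily TauFamily :=
  Derivation.mk' { toFun := fun F τ => pderiv ℂ i (F τ)
                   map_add' := fun F G => by ext1 τ; simp
                   map_smul' := fun c F => by ext1 τ; simp }
    fun F G => by
      ext1 τ
      simp [Derivation.leibniz]

theorem famDer_apply (i : ℕ+) (F : TauFamily) (τ) : famDer i F τ = pderiv ℂ i (F τ) := rfl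

/-- The family of derivatives `∂_{i_1} ⋯ ∂_{i_k} log τ`. -/
def famLog (l : List ℕ+) : TauFamily := fun τ => iterPderiv (logSeries τ.1) l

theorem famDer_famLog (i : ℕ+) (l : List ℕ+) : famDer i (famLog l) = famLog (i :: l) := rfl

theorem iterPderiv_perm (u : MvPowerSeries ℕ+ ℂ) {l l' : List ℕ+} (h : l.Perm l') :
    iterPderiv u l = iterPderiv u l' := by
  induction h with
  | nil => rfl
  | cons i _ ih => exact congrArg (pderiv ℂ i) ih
  | swap i j l => exact pderiv_comm j i _
  | trans _ _ h1 h2 => exact h1.trans h2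

theorem famLog_perm {l l' : List ℕ+} (h : l.Perm l') : famLog l = famLog l' :=
  funext fun τ => iterPderiv_perm (logSeries τ.1) h

/-- The weight of a list of times. -/
def listWeight (l : List ℕ+) : ℤ := (l.map fun i : ℕ+ => ((i : ℕ) : ℤ)).sum

theorem listWeight_cons (i : ℕ+) (l : List ℕ+) : listWeight (i :: l) = (i : ℕ) + listWeight l := by
  simp [listWeight]

theorem listWeight_perm {l l' : List ℕ+} (h : l.Perm l') : listWeight l = listWeight l' :=
  List.Perm.sum_eq (h.map fun i : ℕ+ => ((i : ℕ) : ℤ))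

/-- The families generated by the derivatives of order at least two and weight at most `m`. -/
def weightAlg (m : ℤ) : Subalgebra ℂ TauFamily :=
  Algebra.adjoin ℂ {F | ∃ l, F = famLog l ∧ 2 ≤ l.length ∧ listWeight l ≤ m}

/-- The families generated by the derivatives of order at least two and weight less than `m` and
those of order at least three and weight at most `m`. -/
def weightAlg' (m : ℤ) : Subalgebra ℂ TauFamily :=
  Algebra.adjoin ℂ {F | ∃ l, F = famLog l ∧
    (2 ≤ l.length ∧ listWeight l < m ∨ 3 ≤ l.length ∧ listWeight l ≤ m)}

theorem famLog_mem_weightAlg {l : List ℕ+} {m : ℤ} (h : 2 ≤ l.length) (h' : listWeight l ≤ m) :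
    famLog l ∈ weightAlg m :=
  Algebra.subset_adjoin ⟨l, rfl, h, h'⟩

theorem weightAlg_mono : Monotone weightAlg := fun _ _ h =>
  Algebra.adjoin_mono fun _ ⟨l, h1, h2, h3⟩ => ⟨l, h1, h2, h3.trans h⟩

theorem weightAlg_le {m n : ℤ} (h : m < n) : weightAlg m ≤ weightAlg' n :=
  Algebra.adjoin_mono fun _ ⟨l, h1, h2, h3⟩ => ⟨l, h1, Or.inl ⟨h2, h3.trans_lt h⟩⟩

theorem weightAlg'_le (m : ℤ) : weightAlg' m ≤ weightAlg m :=
  Algebra.adjoin_mono fun _ ⟨l, h1, h2⟩ => ⟨l, h1, by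
    rcases h2 with ⟨h2, h3⟩ | ⟨h2, h3⟩
    · exact ⟨h2, h3.le⟩
    · exact ⟨by lia, h3⟩⟩

theorem derivation_mem_of_mem_adjoin {B : Type*} [CommRing B] [Algebra ℂ B] (d : Derivation ℂ B B)
    {s : Set B} {T : Subalgebra ℂ B} (hs : ∀ x ∈ s, x ∈ T ∧ d x ∈ T) {x : B}
    (hx : x ∈ Algebra.adjoin ℂ s) : d x ∈ T := by
  have hT : Algebra.adjoin ℂ s ≤ T := Algebra.adjoin_le fun x hx => (hs x hx).1
  induction hx using Algebra.adjoin_induction with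
  | mem x hx => exact (hs x hx).2
  | algebraMap c => simp
  | add x y _ _ hx hy => rw [map_add]; exact add_mem hx hy
  | mul x y hx hy hdx hdy =>
    rw [d.leibniz, smul_eq_mul, smul_eq_mul]
    exact add_mem (mul_mem (hT hx) hdy) (mul_mem (hT hy) hdx)

/-- By the Leibniz rule, the differentiated generator has order at least three and weight at most `i
+ m`. The other factors have weight at most `m`, which is below `i + m`. -/
theorem famDer_mem_weightAlg' (i : ℕ+) {m : ℤ} {F : TauFamily} (hF : F ∈ weightAlg m) :
    famDer i F ∈ weightAlg' (i + m) := by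
  refine derivation_mem_of_mem_adjoin (famDer i) ?_ hF
  rintro _ ⟨l, rfl, h1, h2⟩
  have := i.pos
  refine ⟨Algebra.subset_adjoin ⟨l, rfl, Or.inl ⟨h1, by lia⟩⟩,
    Algebra.subset_adjoin ⟨i :: l, rfl, Or.inr ⟨?_, ?_⟩⟩⟩
  · simpa using h1
  · rw [listWeight_cons]
    lia

/-- The coefficients of `(∂_i log τ)(t - [z⁻¹])`. -/
def famShift (i : ℕ+) (n : ℕ) : TauFamily :=
  fun τ => (shiftLaurent (-1) (pderiv ℂ i (logSeries τ.1))).coeff n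

theorem famShift_zero (i : ℕ+) : famShift i 0 = famLog [i] :=
  funext fun τ => shiftLaurent_coeff_zero (-1) (pderiv ℂ i (logSeries τ.1))

theorem famShift_recursion (i : ℕ+) (n : ℕ) : (n : ℂ) • famShift i n =
    -∑ j ∈ Finset.range n, famDer j.succPNat (famShift i (n - (j + 1))) := by
  ext1 τ
  have h := shiftLaurent_recursion (-1) (pderiv ℂ i (logSeries τ.1)) n
  rw [neg_one_smul] at h
  refine h.trans ?_
  rw [Pi.neg_apply, Finset.sum_apply]
  congr 1
  refine Finset.sum_congr rfl fun j hj => ?_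
  have := Finset.mem_range.mp hj
  rw [famDer_apply, famShift]
  congr 3
  lia

/-- Only the last term of the recursion differentiates `∂_i log τ` itself, giving a second
derivative. The other terms differentiate shift coefficients of positive index. -/
theorem famShift_mem (i : ℕ+) (n : ℕ) : famShift i (n + 1) ∈ weightAlg (i + (n + 1 : ℕ)) ∧
    ((n + 1 : ℕ) : ℂ) • famShift i (n + 1) + famLog [n.succPNat, i] ∈
      weightAlg' (i + (n + 1 : ℕ)) := by
  induction n using Nat.strong_induction_on with
  | _ n ih =>
    have h2 : ((n + 1 : ℕ) : ℂ) • famShift i (n + 1) + famLog [n.succPNat, i] ∈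
        weightAlg' (i + (n + 1 : ℕ)) := by
      rw [famShift_recursion, Finset.sum_range_succ, Nat.sub_self, famShift_zero, famDer_famLog,
        neg_add, neg_add_cancel_right]
      refine neg_mem (sum_mem fun j hj => ?_)
      have hj' := Finset.mem_range.mp hj
      have h := (ih (n - (j + 1)) (by lia)).1
      rw [show n - (j + 1) + 1 = n + 1 - (j + 1) by lia] at h
      convert famDer_mem_weightAlg' j.succPNat h using 2
      rw [Nat.succPNat_coe]
      lia
    refine ⟨?_, h2⟩
    have h3 : famLog [n.succPNat, i] ∈ weightAlg (i + (n + 1 : ℕ)) := by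
      refine famLog_mem_weightAlg (by simp) ?_
      simp [listWeight]
      lia
    have h4 := sub_mem (weightAlg'_le _ h2) h3
    rw [add_sub_cancel_right] at h4
    have h5 := (weightAlg (i + (n + 1 : ℕ))).smul_mem h4 (((n + 1 : ℕ) : ℂ)⁻¹)
    rwa [smul_smul, inv_mul_cancel₀ (Nat.cast_ne_zero.mpr n.succ_ne_zero), one_smul] at h5

/-- The logarithmic derivative `∂_i log Ψ⁺ - z^i` of the wave function. -/
def famWaveDer (i : ℕ+) : LaurentSeries TauFamily :=
  HahnSeries.ofPowerSeries ℤ TauFamily (PowerSeries.mk fun n => if n = 0 then 0 else famShift i n)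

theorem famWaveDer_coeff (i : ℕ+) (n : ℕ) :
    (famWaveDer i).coeff (n + 1) = famShift i (n + 1) := by
  have := ofPowerSeries_coeff_nat
    (PowerSeries.mk fun n => if n = 0 then 0 else famShift i n : PowerSeries TauFamily) (n + 1)
  rw [PowerSeries.coeff_mk, if_neg (by lia)] at this
  exact_mod_cast this

theorem famWaveDer_mem (i : ℕ+) : famWaveDer i ∈ ordGE _ 1 := by
  refine ordGE_succ (n := 0) (ofPowerSeries_mem _) ?_
  have := ofPowerSeries_coeff_nat
    (PowerSeries.mk fun n => if n = 0 then 0 else famShift i n : PowerSeries TauFamily) 0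
  rw [PowerSeries.coeff_mk, if_pos rfl] at this
  exact this

theorem famWaveDer_coeff_mem (i : ℕ+) (k : ℤ) : (famWaveDer i).coeff k ∈ weightAlg (i + k) := by
  rcases lt_or_ge k 1 with hk | hk
  · rw [famWaveDer_mem i k hk]
    exact zero_mem _
  · obtain ⟨n, rfl⟩ : ∃ n : ℕ, k = n + 1 := ⟨(k - 1).toNat, by lia⟩
    rw [famWaveDer_coeff]
    exact_mod_cast (famShift_mem i n).1

/-- Evaluation of families at a tau function. -/
abbrev famEval {τ : MvPowerSeries ℕ+ ℂ} (hτ : IsKPTau τ) :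
    LaurentSeries TauFamily →+* LaurentSeries (MvPowerSeries ℕ+ ℂ) :=
  coeffHom (Pi.evalRingHom _ (⟨τ, hτ⟩ : {τ : MvPowerSeries ℕ+ ℂ // IsKPTau τ}))

variable {τ : MvPowerSeries ℕ+ ℂ} (hτ : IsKPTau τ)

theorem famEval_famWaveDer (i : ℕ+) : famEval hτ (famWaveDer i) =
    shiftLaurent (-1) (pderiv ℂ i (logSeries τ)) - HahnSeries.C (pderiv ℂ i (logSeries τ)) := by
  ext k : 2
  rw [coeffHom_coeff, HahnSeries.coeff_sub, HahnSeries.C_apply]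
  rcases lt_or_ge k 1 with hk | hk
  · rw [famWaveDer_mem i k hk, map_zero]
    rcases (show k < 0 ∨ k = 0 by lia) with hk | rfl
    · rw [shiftLaurent_mem _ _ k hk, HahnSeries.coeff_single_of_ne hk.ne, sub_zero]
    · rw [shiftLaurent_coeff_zero, HahnSeries.coeff_single_same, sub_self]
  · obtain ⟨n, rfl⟩ : ∃ n : ℕ, k = n + 1 := ⟨(k - 1).toNat, by lia⟩
    rw [famWaveDer_coeff, HahnSeries.coeff_single_of_ne (by lia), sub_zero]
    change (shiftLaurent (-1) (pderiv ℂ i (logSeries τ))).coeff ((n + 1 : ℕ) : ℤ) = _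
    rw [Nat.cast_succ]

include hτ in
theorem coeffDer_waveLaurent (i : ℕ+) : coeffDer (pderiv ℂ i) (waveLaurent τ) =
    famEval hτ (famWaveDer i) * waveLaurent τ := by
  have h0 : τ ≠ 0 := fun h => by simpa [h] using hτ.1
  have h1 := smul_waveLaurent hτ.1
  have h2 := congrArg (coeffDer (pderiv ℂ i)) h1
  rw [coeffDer_smul, coeffDer_shiftLaurent, ← mul_pderiv_logSeries hτ.1, map_mul, ← h1,
    mul_smul] at h2
  have h3 : τ • coeffDer (pderiv ℂ i) (waveLaurent τ) =
      τ • (famEval hτ (famWaveDer i) * waveLaurent τ) := by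
    rw [famEval_famWaveDer]
    simp only [← HahnSeries.C_mul_eq_smul] at h2 ⊢
    linear_combination h2
  ext k : 2
  have h4 := congrArg (fun F => HahnSeries.coeff F k) h3
  simp only [HahnSeries.coeff_smul, smul_eq_mul] at h4
  exact mul_left_cancel₀ h0 h4

/-- The quotients `∂_1^k Ψ⁺ / Ψ⁺`. -/
def famPow : ℕ → LaurentSeries TauFamily
  | 0 => 1
  | k + 1 => coeffDer (famDer 1) (famPow k) +
      (HahnSeries.single (-1) 1 * famPow k + famWaveDer 1 * famPow k)

theorem famEval_famPow (k : ℕ) :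
    famEval hτ (famPow k) * waveLaurent τ = (twist id 1 1)^[k] (waveLaurent τ) := by
  induction k with
  | zero => rw [famPow, map_one, one_mul]; rfl
  | succ k ih =>
    rw [Function.iterate_succ_apply', ← ih, twist_apply, coeffDer_mul, coeffDer_waveLaurent hτ,
      famPow, map_add, map_add, map_mul, map_mul, coeffHom_single, map_one,
      coeffHom_coeffDer _ (famDer 1) (pderiv ℂ 1) fun _ => rfl, map_one (C (σ := ℕ+) (R := ℂ))]
    simp only [id, PNat.one_coe, Nat.cast_one]
    ring

theorem famPow_mem (k : ℕ) : famPow k ∈ ordGE _ (-k) ∧ (famPow k).coeff (-k) = 1 := by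
  induction k with
  | zero =>
    refine ⟨one_mem_ordGE (by simp), ?_⟩
    rw [famPow, Nat.cast_zero, neg_zero, HahnSeries.coeff_one, if_pos rfl]
  | succ k ih =>
    have h1 : coeffDer (famDer 1) (famPow k) ∈ ordGE _ (-k) := coeffDer_mem_ordGE _ ih.1
    have h2 := mul_mem_ordGE (famWaveDer_mem 1) ih.1
    have h3 := single_mul_mem_ordGE (-1) 1 ih.1
    refine ⟨add_mem (ordGE_anti (by push_cast; lia) h1) (add_mem
      (ordGE_anti (by push_cast; lia) h3) (ordGE_anti (by push_cast; lia) h2)), ?_⟩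
    rw [famPow, HahnSeries.coeff_add, HahnSeries.coeff_add, h1 _ (by push_cast; lia),
      h2 _ (by push_cast; lia), HahnSeries.coeff_single_mul, zero_add, add_zero, one_mul, ← ih.2]
    congr 1
    push_cast
    ring

theorem mem_of_coeff_mul_mem {B : Type*} [CommRing B] {T : Subring B} {f g : LaurentSeries B} {k : ℤ}
    (h : ∀ i j, i + j = k → f.coeff i * g.coeff j ∈ T) : (f * g).coeff k ∈ T := by
  rw [HahnSeries.coeff_mul]
  exact sum_mem fun ij hij => h _ _ (by simpa using (Finset.mem_antidiagonal.mp hij).2.2)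

theorem famPow_coeff_mem (k : ℕ) (j : ℤ) : (famPow k).coeff j ∈ weightAlg (k + j) := by
  induction k generalizing j with
  | zero =>
    rw [famPow, HahnSeries.coeff_one]
    split_ifs
    · exact one_mem _
    · exact zero_mem _
  | succ k ih =>
    rw [famPow, HahnSeries.coeff_add, HahnSeries.coeff_add]
    refine add_mem ?_ (add_mem ?_ ?_)
    · have h := weightAlg'_le _ (famDer_mem_weightAlg' 1 (ih j))
      rw [coeffDer_coeff]
      convert h using 2
      push_cast
      ring
    · rw [HahnSeries.coeff_single_mul, one_mul]
      convert ih (j - -1) using 2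
      push_cast
      ring
    · refine mem_of_coeff_mul_mem (T := (weightAlg ((k + 1 : ℕ) + j)).toSubring) fun a b hab => ?_
      rcases lt_or_ge a 1 with ha | ha
      · rw [famWaveDer_mem 1 a ha, zero_mul]
        exact zero_mem _
      rcases lt_or_ge b (-k) with hb | hb
      · rw [(famPow_mem k).1 b hb, mul_zero]
        exact zero_mem _
      · exact mul_mem (weightAlg_mono (by push_cast; lia) (famWaveDer_coeff_mem 1 a))
          (weightAlg_mono (by push_cast; lia) (ih b))

/-- Expanding `(∂_1 + z + φ)^k` applied to `1`, with `φ = ∂_1 log Ψ⁺ - z`, the linear term without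
derivatives is `k z^(k-1) φ`. Every other term contains a derivative or a product of factors of
smaller weight. -/
theorem famPow_coeff_sub_mem (k : ℕ) (j : ℤ) :
    (famPow k).coeff j - k • (famWaveDer 1).coeff (k + j - 1) ∈ weightAlg' (k + j) := by
  induction k generalizing j with
  | zero =>
    rw [famPow, HahnSeries.coeff_one, zero_smul, sub_zero]
    split_ifs
    · exact one_mem _
    · exact zero_mem _
  | succ k ih =>
    have h1 : (coeffDer (famDer 1) (famPow k)).coeff j ∈ weightAlg' ((k + 1 : ℕ) + j) := by
      rw [coeffDer_coeff]
      convert famDer_mem_weightAlg' 1 (famPow_coeff_mem k j) using 2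
      push_cast
      ring
    have h2 := ih (j + 1)
    have h3 : (famWaveDer 1 * (famPow k - HahnSeries.single (-(k : ℤ)) 1)).coeff j ∈
        weightAlg' ((k + 1 : ℕ) + j) := by
      refine mem_of_coeff_mul_mem (T := (weightAlg' ((k + 1 : ℕ) + j)).toSubring) fun a b hab => ?_
      rcases lt_or_ge a 1 with ha | ha
      · rw [famWaveDer_mem 1 a ha, zero_mul]
        exact zero_mem _
      rw [HahnSeries.coeff_sub]
      rcases lt_trichotomy b (-k) with hb | rfl | hb
      · rw [(famPow_mem k).1 b hb, HahnSeries.coeff_single_of_ne hb.ne, sub_zero, mul_zero]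
        exact zero_mem _
      · rw [(famPow_mem k).2, HahnSeries.coeff_single_same, sub_self, mul_zero]
        exact zero_mem _
      · rw [HahnSeries.coeff_single_of_ne hb.ne', sub_zero]
        exact mul_mem (weightAlg_le (by push_cast; lia) (famWaveDer_coeff_mem 1 a))
          (weightAlg_le (by push_cast; lia) (famPow_coeff_mem k b))
    rw [mul_sub, HahnSeries.coeff_sub, HahnSeries.coeff_mul_single, mul_one] at h3
    rw [show (k : ℤ) + (j + 1) = (k + 1 : ℕ) + j by push_cast; ring] at h2
    convert add_mem h1 (add_mem h2 h3) using 1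
    rw [famPow, HahnSeries.coeff_add, HahnSeries.coeff_add, HahnSeries.coeff_single_mul, one_mul,
      succ_nsmul, show j - -(k : ℤ) = ((k + 1 : ℕ) : ℤ) + j - 1 by push_cast; ring,
      show j - -1 = j + 1 by ring]
    abel

/-- `∂_i Ψ⁺` is a differential operator in `∂_1` of order `i` applied to `Ψ⁺`. Its leading
coefficient is `1`, so only the top order contributes a linear term of full weight. -/
theorem famWaveDer_sub_mem (i : ℕ+) {k : ℤ} (hk : 1 ≤ k) :
    (famWaveDer i).coeff k - (i : ℕ) • (famWaveDer 1).coeff (i + k - 1) ∈ weightAlg' (i + k) := by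
  obtain ⟨b, hb, hb1, hbm⟩ := exists_elim_of_mem (fun k => (famPow_mem k).1)
    (fun k => (famPow_mem k).2) (S := fun m => (weightAlg m).toSubring)
    (fun _ _ h => weightAlg_mono h) famPow_coeff_mem i (i : ℕ) le_rfl
    (HahnSeries.single (-((i : ℕ) : ℤ)) 1) (single_mem_ordGE le_rfl 1) (fun j => by
      rw [HahnSeries.coeff_single]
      split_ifs
      · exact one_mem _
      · exact zero_mem _)
  rw [HahnSeries.coeff_single_same] at hb1
  have key : famWaveDer i = (∑ k ∈ Finset.range (i + 1), b k • famPow k) -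
      HahnSeries.single (-((i : ℕ) : ℤ)) 1 := by
    have hmem : HahnSeries.single (-((i : ℕ) : ℤ)) 1 + famWaveDer i -
        ∑ k ∈ Finset.range (i + 1), b k • famPow k ∈ ordGE _ 1 := by
      rw [add_sub_right_comm]
      exact add_mem hbm (famWaveDer_mem i)
    -- The coefficients of the operator are chosen once for the whole family. For each tau function
    -- the difference, multiplied by the wave function, is in the moved plane and in `O(s)`.
    have h0 (τ : MvPowerSeries ℕ+ ℂ) (hτ : IsKPTau τ) :
        famEval hτ (HahnSeries.single (-((i : ℕ) : ℤ)) 1 + famWaveDer i -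
          ∑ k ∈ Finset.range (i + 1), b k • famPow k) = 0 := by
      have hw := waveLaurent_mem_planeAt hτ
      have h2 : famEval hτ (HahnSeries.single (-((i : ℕ) : ℤ)) 1 + famWaveDer i -
          ∑ k ∈ Finset.range (i + 1), b k • famPow k) * waveLaurent τ = 0 := by
        refine eq_zero_of_mem_planePlus (Function.Embedding.refl ℕ+) (i := 1) rfl hτ ?_
          (mul_mem_ordGE_of_le (coeffHom_mem_ordGE _ hmem) (waveLaurent_mem τ) (by simp))
        have h3 := sub_mem_planeAt (twist_mem_planeAt i hw) (sum_smul_mem_planeAt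
          (Finset.range (i + 1)) (fun k => b k ⟨τ, hτ⟩)
          (fun k _ => iterate_twist_mem_planeAt 1 hw k))
        change _ ∈ planeAt id 1 (planePlus τ)
        convert h3 using 1
        rw [twist_apply, coeffDer_waveLaurent hτ, map_sub, map_add, map_sum, sub_mul, add_mul,
          Finset.sum_mul, coeffHom_single, map_one, map_one (C (σ := ℕ+) (R := ℂ)), add_comm]
        congr 1
        refine Finset.sum_congr rfl fun k _ => ?_
        rw [← famEval_famPow hτ, coeffHom_smul, ← HahnSeries.C_mul_eq_smul,
          ← HahnSeries.C_mul_eq_smul, mul_assoc]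
        rfl
      have hw0 := waveLaurent_coeff_zero hτ.1
      ext k : 2
      exact mem_ordGE_of_mul (n := 0) (m := k + 1) (waveLaurent_mem τ) hw0
        (by rw [mul_comm, h2]; exact zero_mem _) k (by lia)
    have h1 : HahnSeries.single (-((i : ℕ) : ℤ)) 1 + famWaveDer i -
        ∑ k ∈ Finset.range (i + 1), b k • famPow k = 0 := by
      ext k : 2
      funext τ
      have := congrArg (fun F => HahnSeries.coeff F k) (h0 τ.1 τ.2)
      simp only [coeffHom_coeff] at this
      exact this
    rw [sub_eq_zero] at h1
    rw [← h1, add_sub_cancel_left]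
  have hi := i.pos
  rw [key, HahnSeries.coeff_sub, HahnSeries.coeff_single_of_ne (by lia), sub_zero,
    Finset.sum_range_succ, hb1, one_smul, HahnSeries.coeff_add, HahnSeries.coeff_sum, add_sub_assoc]
  refine add_mem (sum_mem fun n hn => ?_) (famPow_coeff_sub_mem i k)
  have hn' := Finset.mem_range.mp hn
  rw [HahnSeries.coeff_smul, smul_eq_mul]
  rcases Nat.eq_zero_or_pos n with rfl | hn0
  · rw [famPow, HahnSeries.coeff_one, if_neg (by lia), mul_zero]
    exact zero_mem _
  · exact mul_mem (weightAlg_le (by lia) (hb n hn'.le))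
      (weightAlg_le (by lia) (famPow_coeff_mem n k))

/-- The KP equations modulo terms of lower weight or higher order. -/
theorem famLog_pair_sub_mem (i k : ℕ+) (n : ℕ+) (h : (n : ℕ) + 1 = i + k) :
    famLog [k, i] - (((i : ℕ) : ℂ) * (k : ℕ) / (n : ℕ)) • famLog [n, 1] ∈ weightAlg' (i + k) := by
  obtain ⟨k, rfl⟩ : ∃ k' : ℕ, k = k'.succPNat := ⟨k.natPred, (PNat.succPNat_natPred k).symm⟩
  obtain ⟨n, rfl⟩ : ∃ n' : ℕ, n = n'.succPNat := ⟨n.natPred, (PNat.succPNat_natPred n).symm⟩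
  simp only [Nat.succPNat_coe, Nat.succ_eq_add_one] at h ⊢
  have h1 := famWaveDer_sub_mem i (k := ((k + 1 : ℕ) : ℤ)) (by lia)
  have h2 := (famShift_mem i k).2
  have h3 := (famShift_mem 1 n).2
  rw [show ((i : ℕ) : ℤ) + ((k + 1 : ℕ) : ℤ) - 1 = n + 1 by lia, Nat.cast_succ, famWaveDer_coeff,
    famWaveDer_coeff] at h1
  rw [show (((1 : ℕ+) : ℕ) : ℤ) + ((n + 1 : ℕ) : ℤ) = (i : ℕ) + ((k + 1 : ℕ) : ℤ) by
    rw [PNat.one_coe]; lia] at h3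
  have hn : ((n + 1 : ℕ) : ℂ) ≠ 0 := Nat.cast_ne_zero.mpr n.succ_ne_zero
  set T := weightAlg' ((i : ℕ) + ((k + 1 : ℕ) : ℤ))
  have h4 := sub_mem (sub_mem h2 (T.smul_mem h1 ((k + 1 : ℕ) : ℂ)))
    (T.smul_mem h3 (((i : ℕ) : ℂ) * ((k + 1 : ℕ) : ℂ) / ((n + 1 : ℕ) : ℂ)))
  convert h4 using 1
  rw [← Nat.cast_smul_eq_nsmul ℂ (i : ℕ), smul_sub, smul_add, smul_smul, smul_smul,
    div_mul_cancel₀ _ hn, mul_comm ((k + 1 : ℕ) : ℂ)]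
  abel

end Universal

/-! ### Elimination of second derivatives and uniqueness. -/

section Reduction

open MvPowerSeries

/-- Lists of times at most `p`, containing `p` or having at least two entries, one of them `1`. -/
def IsBasic (p : ℕ) (l : List ℕ+) : Prop :=
  (∀ i ∈ l, (i : ℕ) ≤ p) ∧ ((∃ i ∈ l, (i : ℕ) = p) ∨ 1 ∈ l ∧ 2 ≤ l.length)

/-- The families generated by the derivatives along basic lists. -/
def basicAlg (p : ℕ) : Subalgebra ℂ TauFamily :=
  Algebra.adjoin ℂ {F | ∃ l, F = famLog l ∧ IsBasic p l}

variable {p : ℕ}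

theorem famDer_mem_basicAlg {i : ℕ+} (hi : (i : ℕ) ≤ p) {F : TauFamily} (hF : F ∈ basicAlg p) :
    famDer i F ∈ basicAlg p := by
  refine derivation_mem_of_mem_adjoin (famDer i) ?_ hF
  rintro _ ⟨l, rfl, h1, h2⟩
  refine ⟨Algebra.subset_adjoin ⟨l, rfl, h1, h2⟩,
    Algebra.subset_adjoin ⟨i :: l, rfl, ?_, h2.imp ?_ ?_⟩⟩
  · intro k hk
    rcases List.mem_cons.mp hk with rfl | hk
    · exact hi
    · exact h1 k hk
  · rintro ⟨k, hk, hk'⟩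
    exact ⟨k, List.mem_cons_of_mem _ hk, hk'⟩
  · rintro ⟨hk, hk'⟩
    exact ⟨List.mem_cons_of_mem _ hk, by simp; lia⟩

theorem weightAlg'_le_basicAlg {m : ℤ} (hm : m < 2 * p) (h : weightAlg (m - 1) ≤ basicAlg p) :
    weightAlg' m ≤ basicAlg p := by
  refine Algebra.adjoin_le ?_
  rintro _ ⟨l, rfl, h1 | ⟨h1, h2⟩⟩
  · exact h (famLog_mem_weightAlg h1.1 (by lia))
  -- Two entries larger than `p` would already exceed the weight `2p`. Removing an entry at most `p`
  -- leaves a list of order at least two and smaller weight, to be differentiated back.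
  have h3 : ∃ c ∈ l, ((c : ℕ+) : ℕ) ≤ p := by
    match l, h1 with
    | a :: b :: _ :: l', _ =>
      have hl' : 0 ≤ listWeight l' := by
        refine List.sum_nonneg ?_
        simp
      rw [listWeight_cons, listWeight_cons, listWeight_cons] at h2
      by_cases ha : (a : ℕ) ≤ p
      · exact ⟨a, by simp, ha⟩
      · exact ⟨b, by simp, by lia⟩
  obtain ⟨c, hc, hcp⟩ := h3
  have hperm := List.perm_cons_erase hc
  have hw := listWeight_perm hperm
  have hlen := hperm.length_eq
  have hc1 := c.pos
  rw [listWeight_cons] at hw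
  rw [List.length_cons] at hlen
  rw [SetLike.mem_coe, famLog_perm hperm, ← famDer_famLog]
  exact famDer_mem_basicAlg hcp (h (famLog_mem_weightAlg (by lia) (by lia)))

theorem weightAlg_le_basicAlg (hp : 2 ≤ p) (m : ℕ) (hm : m < 2 * p) :
    weightAlg m ≤ basicAlg p := by
  induction m with
  | zero =>
    refine Algebra.adjoin_le ?_
    rintro _ ⟨l, rfl, h1, h2⟩
    match l, h1 with
    | a :: _ :: l', _ =>
      have hl' : 0 ≤ listWeight l' := by
        refine List.sum_nonneg ?_
        simp
      have := a.pos
      rw [listWeight_cons, listWeight_cons] at h2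
      simp only [Nat.cast_zero] at h2
      lia
  | succ m ih =>
    have ih := ih (by lia)
    have hQ : weightAlg' (m + 1 : ℕ) ≤ basicAlg p :=
      weightAlg'_le_basicAlg (by lia) (by simpa using ih)
    -- For `n > p` the KP relation is applied to the pair `p`, `m + 1 - p`, which is basic, and is
    -- solved for `∂_1 ∂_n log τ`. The bound on the weight keeps the second time at most `p`.
    have hpair (n : ℕ+) (hn : (n : ℕ) = m) : famLog [n, 1] ∈ basicAlg p := by
      rcases le_or_gt (n : ℕ) p with hnp | hnp
      · refine Algebra.subset_adjoin ⟨_, rfl, ?_, Or.inr ⟨by simp, by simp⟩⟩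
        simp only [List.mem_cons, List.not_mem_nil, or_false]
        rintro i (rfl | rfl)
        · exact hnp
        · rw [PNat.one_coe]
          lia
      · obtain ⟨q, hq⟩ : ∃ q : ℕ+, (q : ℕ) = p := ⟨⟨p, by lia⟩, rfl⟩
        obtain ⟨r, hr⟩ : ∃ r : ℕ+, (r : ℕ) = m + 1 - p := ⟨⟨m + 1 - p, by lia⟩, rfl⟩
        have h1 := hQ ((show ((m + 1 : ℕ) : ℤ) = (q : ℕ) + (r : ℕ) by lia) ▸
          famLog_pair_sub_mem q r n (by lia))
        have h2 : famLog [r, q] ∈ basicAlg p := by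
          refine Algebra.subset_adjoin ⟨_, rfl, ?_, Or.inl ⟨q, by simp, hq⟩⟩
          simp only [List.mem_cons, List.not_mem_nil, or_false]
          rintro i (rfl | rfl) <;> lia
        have h3 := sub_mem h2 h1
        rw [sub_sub_cancel] at h3
        have h4 : ((q : ℕ) : ℂ) * (r : ℕ) / (n : ℕ) ≠ 0 := by
          refine div_ne_zero (mul_ne_zero ?_ ?_) ?_ <;> exact Nat.cast_ne_zero.mpr (PNat.ne_zero _)
        have h5 := (basicAlg p).smul_mem h3 (((q : ℕ) : ℂ) * (r : ℕ) / (n : ℕ))⁻¹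
        rwa [smul_smul, inv_mul_cancel₀ h4, one_smul] at h5
    refine Algebra.adjoin_le ?_
    rintro _ ⟨l, rfl, h1, h2⟩
    rcases h2.lt_or_eq with h2 | h2
    · exact ih (famLog_mem_weightAlg h1 (by push_cast at h2; lia))
    match l, h1 with
    | [k, i], _ =>
      have hi := i.pos
      have hk := k.pos
      rw [listWeight_cons, listWeight_cons, listWeight, List.map_nil, List.sum_nil] at h2
      obtain ⟨n, hn⟩ : ∃ n : ℕ+, (n : ℕ) = m := ⟨⟨m, by lia⟩, rfl⟩
      have h3 := hQ ((show ((m + 1 : ℕ) : ℤ) = (i : ℕ) + (k : ℕ) by lia) ▸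
          famLog_pair_sub_mem i k n (by lia))
      have h4 := add_mem h3 ((basicAlg p).smul_mem (hpair n hn) (((i : ℕ) : ℂ) * (k : ℕ) / (n : ℕ)))
      rwa [sub_add_cancel] at h4
    | a :: b :: c :: l', _ => exact hQ (Algebra.subset_adjoin ⟨_, rfl, Or.inr ⟨by simp, h2.le⟩⟩)

/-- Second derivatives along the first `p - 1` times are polynomials in the derivatives along basic
lists, modulo KP equations. -/
theorem exists_isKPEquation_sub (hp : 2 ≤ p) {i k : ℕ+} (hi : (i : ℕ) < p) (hk : (k : ℕ) < p) :
    ∃ E : DiffPoly, DiffPoly.IsKPEquation (MvPolynomial.X [i, k] - E) ∧ ∀ l ∈ E.vars, IsBasic p l := by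
  have h1 : famLog [i, k] ∈ basicAlg p := by
    refine weightAlg_le_basicAlg hp (i + k) (by lia) (famLog_mem_weightAlg (by simp) ?_)
    simp [listWeight]
  have h2 : {F | ∃ l, F = famLog l ∧ IsBasic p l} =
      Set.range fun l : {l // IsBasic p l} => famLog l.1 := by
    ext F
    simp [eq_comm, and_comm]
  rw [basicAlg, h2, Algebra.adjoin_range_eq_range_aeval] at h1
  obtain ⟨E, hE⟩ := h1
  refine ⟨MvPolynomial.rename Subtype.val E, fun τ hτ => ?_, fun l hl => ?_⟩
  · rw [DiffPoly.evalAt, map_sub, MvPolynomial.aeval_X, MvPolynomial.aeval_rename, sub_eq_zero]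
    have h3 := congrFun hE ⟨τ, hτ⟩
    refine h3.symm.trans ?_
    exact MvPolynomial.comp_aeval_apply (fun l : {l // IsBasic p l} => famLog l.1)
      (Pi.evalAlgHom ℂ (fun _ => MvPowerSeries ℕ+ ℂ)
        (⟨τ, hτ⟩ : {τ : MvPowerSeries ℕ+ ℂ // IsKPTau τ})) E
  · obtain ⟨l', -, rfl⟩ := Finset.mem_image.mp (MvPolynomial.vars_rename _ _ hl)
    exact l'.2

theorem pderiv_last_extendTimes (hp : 2 ≤ p) {i : ℕ+} (hi : (i : ℕ) = p)
    (f : MvPowerSeries (Fin (p - 1)) ℂ) : pderiv ℂ i (extendTimes p f) = 0 := by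
  refine pderiv_rename_of_notMem _ ?_ _
  rintro ⟨j, rfl⟩
  have := j.2
  rw [coe_timeEmb] at hi
  lia

theorem pderiv_extendTimes (i : Fin (p - 1)) (f : MvPowerSeries (Fin (p - 1)) ℂ) :
    pderiv ℂ (timeEmb (p - 1) i) (extendTimes p f) = extendTimes p (pderiv ℂ i f) :=
  pderiv_rename_apply _ _ _

theorem exists_eq_timeEmb {i : ℕ+} (hi : (i : ℕ) < p) : ∃ j : Fin (p - 1), i = timeEmb (p - 1) j := by
  have hi' := i.pos
  refine ⟨⟨i - 1, by lia⟩, PNat.eq ?_⟩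
  rw [coe_timeEmb]
  change (i : ℕ) = i - 1 + 1
  lia

/-- Derivatives along basic lists are determined by the second derivatives involving `t_1`. -/
theorem iterPderiv_eq_of_isBasic (hp : 2 ≤ p) {f f' : MvPowerSeries (Fin (p - 1)) ℂ}
    (h : ∀ j, pderiv ℂ (⟨0, by lia⟩ : Fin (p - 1)) (pderiv ℂ j f) =
      pderiv ℂ (⟨0, by lia⟩ : Fin (p - 1)) (pderiv ℂ j f')) {l : List ℕ+} (hl : IsBasic p l) :
    iterPderiv (extendTimes p f) l = iterPderiv (extendTimes p f') l := by
  by_cases hpl : ∃ i ∈ l, ((i : ℕ+) : ℕ) = p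
  · obtain ⟨i, hi, hip⟩ := hpl
    have h0 (f : MvPowerSeries (Fin (p - 1)) ℂ) : iterPderiv (extendTimes p f) l = 0 := by
      rw [iterPderiv_perm _ (List.perm_cons_erase hi)]
      change pderiv ℂ i (iterPderiv _ _) = 0
      rw [pderiv_iterPderiv, pderiv_last_extendTimes hp hip, iterPderiv_zero]
    rw [h0, h0]
  · obtain ⟨h1, h2⟩ := hl.2.resolve_left hpl
    have hperm := List.perm_cons_erase h1
    have hlen := hperm.length_eq
    rw [List.length_cons] at hlen
    obtain ⟨c, l', hl'⟩ : ∃ c l', l.erase 1 = c :: l' := List.exists_cons_of_length_pos (by lia)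
    rw [hl'] at hperm
    have hcl : c ∈ l := hperm.mem_iff.mpr (by simp)
    have hcp : (c : ℕ) < p := lt_of_le_of_ne (hl.1 c hcl) fun h => hpl ⟨c, hcl, h⟩
    obtain ⟨j, rfl⟩ := exists_eq_timeEmb hcp
    have h3 (f : MvPowerSeries (Fin (p - 1)) ℂ) : iterPderiv (extendTimes p f) l =
        iterPderiv (extendTimes p (pderiv ℂ (⟨0, by lia⟩ : Fin (p - 1)) (pderiv ℂ j f))) l' := by
      rw [iterPderiv_perm _ hperm, ← pderiv_extendTimes, ← pderiv_extendTimes,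
        ← pderiv_iterPderiv, ← pderiv_iterPderiv]
      rfl
    rw [h3, h3, h]

/-- Both series satisfy the same equation expressing `∂_i ∂_j` through basic derivatives. On
extensions independent of `t_p` the basic derivatives agree. -/
theorem pderiv_pderiv_eq_of_solvesKPUpTo (hp : 2 ≤ p) {f f' : MvPowerSeries (Fin (p - 1)) ℂ}
    (h : ∀ j, pderiv ℂ (⟨0, by lia⟩ : Fin (p - 1)) (pderiv ℂ j f) =
      pderiv ℂ (⟨0, by lia⟩ : Fin (p - 1)) (pderiv ℂ j f'))
    (hf : SolvesKPUpTo p f) (hf' : SolvesKPUpTo p f') (i j : Fin (p - 1)) :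
    pderiv ℂ i (pderiv ℂ j f) = pderiv ℂ i (pderiv ℂ j f') := by
  have hi := i.2
  have hj := j.2
  obtain ⟨E, hE, hEb⟩ := exists_isKPEquation_sub hp (i := timeEmb (p - 1) i)
    (k := timeEmb (p - 1) j) (by rw [coe_timeEmb]; lia) (by rw [coe_timeEmb]; lia)
  have hinv : DiffPoly.InvolvesOnly
      (MvPolynomial.X [timeEmb (p - 1) i, timeEmb (p - 1) j] - E) p := by
    intro l hl
    classical
    rcases Finset.mem_union.mp (MvPolynomial.vars_sub_subset _ hl) with hl | hl
    · rw [MvPolynomial.vars_X, Finset.mem_singleton] at hl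
      subst hl
      simp only [List.mem_cons, List.not_mem_nil, or_false]
      rintro k (rfl | rfl) <;> rw [coe_timeEmb] <;> lia
    · exact (hEb l hl).1
  have hval {f : MvPowerSeries (Fin (p - 1)) ℂ} (hf : SolvesKPUpTo p f) :
      extendTimes p (pderiv ℂ i (pderiv ℂ j f)) = E.evalAt (extendTimes p f) := by
    have h1 := hf _ hE hinv
    rw [DiffPoly.evalAt, map_sub, MvPolynomial.aeval_X, sub_eq_zero] at h1
    rw [← pderiv_extendTimes, ← pderiv_extendTimes]
    exact h1
  refine rename_injective (timeEmb (p - 1)) ?_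
  refine (hval hf).trans (Eq.trans ?_ (hval hf').symm)
  exact MvPolynomial.hom_congr_vars
    (f₁ := (MvPolynomial.aeval (iterPderiv (extendTimes p f))).toRingHom)
    (f₂ := (MvPolynomial.aeval (iterPderiv (extendTimes p f'))).toRingHom)
    (by ext x; simp) (fun l hl _ => by simpa using iterPderiv_eq_of_isBasic hp h (hEb l hl)) rfl

theorem eq_add_linear_of_pderiv_pderiv_eq {σ : Type*} [Fintype σ] {f g : MvPowerSeries σ ℂ}
    (h : ∀ i j, pderiv ℂ i (pderiv ℂ j f) = pderiv ℂ i (pderiv ℂ j g)) :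
    ∃ (a : ℂ) (b : σ → ℂ), f = g + C a + ∑ j, C (b j) * X j := by
  classical
  choose b hb using fun j => eq_add_C_of_pderiv_eq fun i => h i j
  obtain ⟨a, ha⟩ := eq_add_C_of_pderiv_eq (f := f) (g := g + ∑ j, C (b j) * X j) fun j => by
    rw [hb, map_add, map_sum, Finset.sum_eq_single j]
    · rw [Derivation.leibniz, pderiv_X_self, pderiv_C]
      simp
    · intro i _ hij
      rw [Derivation.leibniz, pderiv_X_of_ne hij, pderiv_C]
      simp
    · simp
  exact ⟨a, b, by rw [ha]; ring⟩

end Reduction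

/-! ### Explicit expansions for `p = 2, 3, 4`. -/

section Explicit

open MvPowerSeries

section Generic

variable {A : Type*} [CommRing A]

theorem C_mul_single_one_pow (w : A) (k : ℕ) :
    HahnSeries.C w * (HahnSeries.single 1 1 : LaurentSeries A) ^ k = HahnSeries.single (k : ℤ) w := by
  rw [HahnSeries.single_pow, HahnSeries.C_apply, HahnSeries.single_mul_single]
  simp

/-- A Laurent polynomial identity may be checked after multiplication by a power of `z⁻¹`. -/
theorem eq_of_single_one_pow_mul_eq (n : ℕ) {f g : LaurentSeries A}
    (h : (HahnSeries.single 1 1 : LaurentSeries A) ^ n * f = HahnSeries.single 1 1 ^ n * g) :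
    f = g := by
  have h1 : (HahnSeries.single (-1) 1 : LaurentSeries A) ^ n * HahnSeries.single 1 1 ^ n = 1 := by
    rw [← mul_pow, HahnSeries.single_mul_single, neg_add_cancel, one_mul]
    exact one_pow n
  rw [← one_mul f, ← one_mul g, ← h1, mul_assoc, mul_assoc, h]

theorem quadratic_expansion (a : A) :
    ((HahnSeries.single (-1) 1 + HahnSeries.single 1 a : LaurentSeries A)) ^ 2
      - HahnSeries.C (2 * a) - HahnSeries.single (-2) 1 = HahnSeries.single 2 (a ^ 2) := by
  set z : LaurentSeries A := HahnSeries.single (-1) 1 with hz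
  set s : LaurentSeries A := HahnSeries.single 1 1 with hs
  have hzs : s * z = 1 := by
    rw [hs, hz, HahnSeries.single_mul_single, add_neg_cancel, one_mul]
    rfl
  have hz2 : (HahnSeries.single (-2) 1 : LaurentSeries A) = z ^ 2 := by
    rw [hz, HahnSeries.single_pow]
    simp
  have hn (k : ℕ) (w : A) : (HahnSeries.single (k : ℤ) w : LaurentSeries A) =
    HahnSeries.C w * s ^ k := (C_mul_single_one_pow w k).symm
  have h1 := hn 1 a
  rw [Nat.cast_one, pow_one] at h1
  have h2 := hn 2
  push_cast at h2
  rw [hz2, h1, h2]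
  simp only [map_mul, map_pow, map_ofNat]
  linear_combination (2 * HahnSeries.C a) * hzs

/-- The subtracted multiples of `g` and `1` cancel the non-negative powers other than `z^3`, so the
left side contains `V_3'(g)`. The terms up to `s^3` are kept because an error in `O(s^4)` does not
affect the first derivatives. -/
theorem cubic_expansion (a b : A) :
    (HahnSeries.single (-1) 1 + HahnSeries.single 1 a + HahnSeries.single 2 b :
      LaurentSeries A) ^ 3 - HahnSeries.C (3 * a) * (HahnSeries.single (-1) 1 +
        HahnSeries.single 1 a + HahnSeries.single 2 b) - HahnSeries.C (3 * b) -
      HahnSeries.single (-3) 1 - (HahnSeries.single 2 (3 * a * b) +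
        HahnSeries.single 3 (3 * b ^ 2 + a ^ 3)) ∈ ordGE A 4 := by
  set z : LaurentSeries A := HahnSeries.single (-1) 1 with hz
  set s : LaurentSeries A := HahnSeries.single 1 1 with hs
  have hzs : s * z = 1 := by
    rw [hs, hz, HahnSeries.single_mul_single, add_neg_cancel, one_mul]
    rfl
  have hz3 : (HahnSeries.single (-3) 1 : LaurentSeries A) = z ^ 3 := by
    rw [hz, HahnSeries.single_pow]
    simp
  have hn (k : ℕ) (w : A) : (HahnSeries.single (k : ℤ) w : LaurentSeries A) =
    HahnSeries.C w * s ^ k := (C_mul_single_one_pow w k).symm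
  have h1 := hn 1 a
  rw [Nat.cast_one, pow_one] at h1
  have h2 := hn 2
  have h3 := hn 3
  have h4 := hn 4
  push_cast at h2 h3 h4
  -- The witness is the remaining part of the cube, divided by `s^4`.
  convert mul_mem_ordGE_of_le (single_mem_ordGE le_rfl (1 : A))
    (ofPowerSeries_mem (PowerSeries.C (3 * a ^ 2 * b) + PowerSeries.C (3 * a * b ^ 2) * PowerSeries.X +
      PowerSeries.C (b ^ 3) * PowerSeries.X ^ 2)) (show (4 : ℤ) ≤ 4 + 0 by simp) using 1
  refine eq_of_single_one_pow_mul_eq 3 ?_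
  rw [hz3, h1, h2, h2, h3, h4]
  simp only [map_mul, map_pow, map_ofNat, map_add, HahnSeries.ofPowerSeries_C (Γ := ℤ) (R := A),
    HahnSeries.ofPowerSeries_X (Γ := ℤ) (R := A), ← hs, map_one]
  generalize (HahnSeries.C a : LaurentSeries A) = a
  generalize (HahnSeries.C b : LaurentSeries A) = b
  have h5 : s * (z + a * s + b * s ^ 2) = 1 + a * s ^ 2 + b * s ^ 3 := by
    rw [mul_add, mul_add, hzs]
    ring
  have h6 : s ^ 3 * z ^ 3 = 1 := by rw [← mul_pow, hzs, one_pow]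
  calc _ = (s * (z + a * s + b * s ^ 2)) ^ 3 - 3 * a * s ^ 2 * (s * (z + a * s + b * s ^ 2)) -
        3 * b * s ^ 3 - s ^ 3 * z ^ 3 - s ^ 3 * (3 * a * b * s ^ 2 + (3 * b ^ 2 + a ^ 3) * s ^ 3) := by
        ring
    _ = _ := by
        rw [h5, h6]
        ring

theorem quartic_expansion (a b c : A) :
    (HahnSeries.single (-1) 1 + HahnSeries.single 1 a + HahnSeries.single 2 b +
      HahnSeries.single 3 c : LaurentSeries A) ^ 4 - HahnSeries.C (4 * a) *
        (HahnSeries.single (-1) 1 + HahnSeries.single 1 a + HahnSeries.single 2 b +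
          HahnSeries.single 3 c) ^ 2 - HahnSeries.C (4 * b) *
        (HahnSeries.single (-1) 1 + HahnSeries.single 1 a + HahnSeries.single 2 b +
          HahnSeries.single 3 c) + HahnSeries.C (2 * a ^ 2 - 4 * c) -
      HahnSeries.single (-4) 1 - (HahnSeries.single 2 (4 * a * c + 2 * b ^ 2) +
        HahnSeries.single 3 (8 * b * c + 4 * a ^ 2 * b) +
        HahnSeries.single 4 (6 * c ^ 2 + 4 * a ^ 2 * c + 8 * a * b ^ 2 + a ^ 4)) ∈ ordGE A 5 := by
  set z : LaurentSeries A := HahnSeries.single (-1) 1 with hz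
  set s : LaurentSeries A := HahnSeries.single 1 1 with hs
  have hzs : s * z = 1 := by
    rw [hs, hz, HahnSeries.single_mul_single, add_neg_cancel, one_mul]
    rfl
  have hz4 : (HahnSeries.single (-4) 1 : LaurentSeries A) = z ^ 4 := by
    rw [hz, HahnSeries.single_pow]
    simp
  have hn (k : ℕ) (w : A) : (HahnSeries.single (k : ℤ) w : LaurentSeries A) =
    HahnSeries.C w * s ^ k := (C_mul_single_one_pow w k).symm
  have h1 := hn 1 a
  rw [Nat.cast_one, pow_one] at h1
  have h2 := hn 2
  have h3 := hn 3
  have h4 := hn 4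
  have h5 := hn 5
  push_cast at h2 h3 h4 h5
  -- The witness is again the exact remainder, here divided by `s^5`.
  convert mul_mem_ordGE_of_le (single_mem_ordGE le_rfl (1 : A))
    (ofPowerSeries_mem (PowerSeries.C (16 * a * b * c + 4 * b ^ 3 + 4 * a ^ 3 * b) +
      PowerSeries.C (8 * a * c ^ 2 + 12 * b ^ 2 * c + 4 * a ^ 3 * c + 6 * a ^ 2 * b ^ 2) *
        PowerSeries.X +
      PowerSeries.C (12 * b * c ^ 2 + 12 * a ^ 2 * b * c + 4 * a * b ^ 3) * PowerSeries.X ^ 2 +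
      PowerSeries.C (4 * c ^ 3 + 6 * a ^ 2 * c ^ 2 + 12 * a * b ^ 2 * c + b ^ 4) *
        PowerSeries.X ^ 3 +
      PowerSeries.C (12 * a * b * c ^ 2 + 4 * b ^ 3 * c) * PowerSeries.X ^ 4 +
      PowerSeries.C (4 * a * c ^ 3 + 6 * b ^ 2 * c ^ 2) * PowerSeries.X ^ 5 +
      PowerSeries.C (4 * b * c ^ 3) * PowerSeries.X ^ 6 + PowerSeries.C (c ^ 4) * PowerSeries.X ^ 7))
    (show (5 : ℤ) ≤ 5 + 0 by simp) using 1
  refine eq_of_single_one_pow_mul_eq 4 ?_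
  rw [hz4, h1, h2, h2, h3, h3, h4, h5]
  simp only [map_mul, map_pow, map_ofNat, map_add, map_sub, HahnSeries.ofPowerSeries_C (Γ := ℤ) (R := A),
    HahnSeries.ofPowerSeries_X (Γ := ℤ) (R := A), ← hs, map_one]
  generalize (HahnSeries.C a : LaurentSeries A) = a
  generalize (HahnSeries.C b : LaurentSeries A) = b
  generalize (HahnSeries.C c : LaurentSeries A) = c
  have h6 : s * (z + a * s + b * s ^ 2 + c * s ^ 3) = 1 + a * s ^ 2 + b * s ^ 3 + c * s ^ 4 := by
    rw [mul_add, mul_add, mul_add, hzs]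
    ring
  have h7 : s ^ 4 * z ^ 4 = 1 := by rw [← mul_pow, hzs, one_pow]
  calc _ = (s * (z + a * s + b * s ^ 2 + c * s ^ 3)) ^ 4 -
        4 * a * s ^ 2 * (s * (z + a * s + b * s ^ 2 + c * s ^ 3)) ^ 2 -
        4 * b * s ^ 3 * (s * (z + a * s + b * s ^ 2 + c * s ^ 3)) +
        (2 * a ^ 2 - 4 * c) * s ^ 4 - s ^ 4 * z ^ 4 -
        s ^ 4 * ((4 * a * c + 2 * b ^ 2) * s ^ 2 + (8 * b * c + 4 * a ^ 2 * b) * s ^ 3 +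
          (6 * c ^ 2 + 4 * a ^ 2 * c + 8 * a * b ^ 2 + a ^ 4) * s ^ 4) := by
        ring
    _ = _ := by
        rw [h6, h7]
        ring

end Generic

variable {τ : MvPowerSeries ℕ+ ℂ}

theorem locusSpectral_two : locusSpectral 2 = HahnSeries.single (-1) 1 +
    HahnSeries.single 1 (C (1 / 2 : ℂ) * X (0 : Fin 1)) := by
  rw [locusSpectral, spectral]
  congr 1
  refine (Fin.sum_univ_one _).trans ?_
  simp [timeEmb]

theorem locusSpectral_three : locusSpectral 3 = HahnSeries.single (-1) 1 +
    HahnSeries.single 1 (C (2 / 3 : ℂ) * X (1 : Fin 2)) +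
    HahnSeries.single 2 (C (1 / 3 : ℂ) * X (0 : Fin 2)) := by
  rw [locusSpectral, spectral, add_assoc]
  congr 1
  refine (Fin.sum_univ_two _).trans ((add_comm _ _).trans ?_)
  change HahnSeries.single (((3 : ℕ) : ℤ) - (2 : ℕ)) (C (((2 : ℕ) : ℂ) / (3 : ℕ)) * X (1 : Fin 2)) +
    HahnSeries.single (((3 : ℕ) : ℤ) - (1 : ℕ)) (C (((1 : ℕ) : ℂ) / (3 : ℕ)) * X (0 : Fin 2)) = _
  norm_num

theorem locusSpectral_four : locusSpectral 4 = HahnSeries.single (-1) 1 +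
    HahnSeries.single 1 (C (3 / 4 : ℂ) * X (2 : Fin 3)) +
    HahnSeries.single 2 (C (2 / 4 : ℂ) * X (1 : Fin 3)) +
    HahnSeries.single 3 (C (1 / 4 : ℂ) * X (0 : Fin 3)) := by
  rw [locusSpectral, spectral, add_assoc, add_assoc]
  congr 1
  refine (Fin.sum_univ_three _).trans ?_
  change HahnSeries.single (((4 : ℕ) : ℤ) - (1 : ℕ)) (C (((1 : ℕ) : ℂ) / (4 : ℕ)) * X (0 : Fin 3)) +
    HahnSeries.single (((4 : ℕ) : ℤ) - (2 : ℕ)) (C (((2 : ℕ) : ℂ) / (4 : ℕ)) * X (1 : Fin 3)) +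
    HahnSeries.single (((4 : ℕ) : ℤ) - (3 : ℕ)) (C (((3 : ℕ) : ℂ) / (4 : ℕ)) * X (2 : Fin 3)) = _
  norm_num
  abel

variable {p : ℕ}

/-- Since `θ(g)` has degree one, `R θ(g)` is `O(s^p)` and does not reach the coefficient of
`s^(j+1)`, as `j + 1 < p`. -/
theorem pderiv_logSeries_restrictTau_eq (hp : 2 ≤ p) (hτ : IsInvariantTau p τ)
    {Y T R : LaurentSeries (MvPowerSeries (Fin (p - 1)) ℂ)} (hY : Y ∈ polyIn (locusSpectral p))
    (hT : T ∈ ordGE _ 1) (hR : R ∈ ordGE _ (p + 1))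
    (h : Y - HahnSeries.single (-(p : ℤ)) 1 = T + R) (j : Fin (p - 1)) :
    pderiv ℂ j (logSeries (restrictTau p τ)) = -(T * euler _ (locusSpectral p)).coeff (j + 1) := by
  have hj := j.2
  rw [pderiv_logSeries_restrictTau hτ.1.1]
  refine (killCompl_pderiv_logSeries hp hτ hY (h ▸ add_mem hT (ordGE_anti (by lia) hR))
    (show (j : ℕ) < p by lia)).trans ?_
  have hg := mem_ordGE_of_sub_mem (locusSpectral_sub_mem p)
  rw [h, add_mul, HahnSeries.coeff_add,
    mul_mem_ordGE hR (euler_mem_ordGE hg) _ (show ((j : ℕ) : ℤ) + 1 < _ by lia), add_zero]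

theorem logSeries_restrictTau_two (hτ : IsInvariantTau 2 τ) :
    logSeries (restrictTau 2 τ) = -(C (1 / 12 : ℂ) * X (0 : Fin 1) ^ 3) := by
  refine pderiv.ext (fun j => ?_) ?_
  · have hg := locusSpectral_two
    have hgp := self_mem_polyIn (locusSpectral 2)
    have h := quadratic_expansion (C (1 / 2 : ℂ) * X (0 : Fin 1))
    rw [← hg, ← add_zero (HahnSeries.single 2 _)] at h
    refine (pderiv_logSeries_restrictTau_eq le_rfl hτ
      (sub_mem (pow_mem hgp 2) (C_mem_polyIn _ _)) (single_mem_ordGE (by simp) _)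
      (zero_mem _) h j).trans ?_
    rw [hg]
    match j with
    | (0 : Fin 1) =>
      simp [HahnSeries.coeff_single_mul]
      simp only [c_eq_algebraMap]
      algebra
  · rw [constantCoeff_logSeries ((constantCoeff_restrictTau _ _).trans hτ.1.1)]
    simp

theorem logSeries_restrictTau_three (hτ : IsInvariantTau 3 τ) :
    logSeries (restrictTau 3 τ) =
      -(C (1 / 3 : ℂ) * X (0 : Fin 2) ^ 2 * X (1 : Fin 2)) -
        C (2 / 27 : ℂ) * X (1 : Fin 2) ^ 4 := by
  have hg := locusSpectral_three
  have hgp := self_mem_polyIn (locusSpectral 3)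
  have h := cubic_expansion (C (2 / 3 : ℂ) * X (1 : Fin 2)) (C (1 / 3 : ℂ) * X (0 : Fin 2))
  rw [← hg] at h
  refine pderiv.ext (fun j => ?_) ?_
  · refine (pderiv_logSeries_restrictTau_eq (by lia) hτ
      (sub_mem (sub_mem (pow_mem hgp 3) (mul_mem (C_mem_polyIn _ _) hgp)) (C_mem_polyIn _ _))
      (add_mem (single_mem_ordGE (by simp) _) (single_mem_ordGE (by simp) _)) h
      (add_sub_cancel _ _).symm j).trans ?_
    rw [hg]
    match j with
    | (0 : Fin 2) =>
      simp [HahnSeries.coeff_single_mul, add_mul]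
      simp only [c_eq_algebraMap]
      algebra
    | (1 : Fin 2) =>
      simp [HahnSeries.coeff_single_mul, add_mul]
      simp only [c_eq_algebraMap]
      algebra
  · rw [constantCoeff_logSeries ((constantCoeff_restrictTau _ _).trans hτ.1.1)]
    simp

theorem logSeries_restrictTau_four (hτ : IsInvariantTau 4 τ) :
    logSeries (restrictTau 4 τ) =
      -(C (3 / 8 : ℂ) * X (0 : Fin 3) ^ 2 * X (2 : Fin 3))
      - C (1 / 2 : ℂ) * X (0 : Fin 3) * X (1 : Fin 3) ^ 2
      - C (9 / 16 : ℂ) * X (1 : Fin 3) ^ 2 * X (2 : Fin 3) ^ 2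
      - C (81 / 1280 : ℂ) * X (2 : Fin 3) ^ 5 := by
  have hg := locusSpectral_four
  have hgp := self_mem_polyIn (locusSpectral 4)
  have h := quartic_expansion (C (3 / 4 : ℂ) * X (2 : Fin 3)) (C (2 / 4 : ℂ) * X (1 : Fin 3))
    (C (1 / 4 : ℂ) * X (0 : Fin 3))
  rw [← hg] at h
  refine pderiv.ext (fun j => ?_) ?_
  · refine (pderiv_logSeries_restrictTau_eq (by lia) hτ
      (add_mem (sub_mem (sub_mem (pow_mem hgp 4) (mul_mem (C_mem_polyIn _ _) (pow_mem hgp 2)))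
        (mul_mem (C_mem_polyIn _ _) hgp)) (C_mem_polyIn _ _))
      (add_mem (add_mem (single_mem_ordGE (by simp) _) (single_mem_ordGE (by simp) _))
        (single_mem_ordGE (by simp) _)) h (add_sub_cancel _ _).symm j).trans ?_
    rw [hg]
    match j with
    | (0 : Fin 3) =>
      simp [HahnSeries.coeff_single_mul, add_mul]
      simp only [c_eq_algebraMap]
      algebra
    | (1 : Fin 3) =>
      simp [HahnSeries.coeff_single_mul, add_mul]
      simp only [c_eq_algebraMap]
      algebra
    | (2 : Fin 3) =>
      simp [HahnSeries.coeff_single_mul, add_mul]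
      simp only [c_eq_algebraMap]
      algebra
  · rw [constantCoeff_logSeries ((constantCoeff_restrictTau _ _).trans hτ.1.1)]
    simp

end Explicit

end TopTau

end

/-! ### The theorem. -/

theorem lemma3p7 :
    (∀ (p : ℕ) (hp : 2 ≤ p),
      (∃! θ : Fin (p - 1) → TopTau.TimePoly p, TopTau.IsTheta p θ) ∧
      ∀ (θ : Fin (p - 1) → TopTau.TimePoly p), TopTau.IsTheta p θ →
      ∀ (τ : MvPowerSeries ℕ+ ℂ), TopTau.IsInvariantTau p τ →
        (TopTau.SecondOrderSystem p hp θ (TopTau.logSeries (TopTau.restrictTau p τ)) ∧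
          TopTau.SolvesKPUpTo p (TopTau.logSeries (TopTau.restrictTau p τ)) ∧
          ∀ f : MvPowerSeries (Fin (p - 1)) ℂ,
            TopTau.SecondOrderSystem p hp θ f → TopTau.SolvesKPUpTo p f →
              ∃ (a : ℂ) (b : Fin (p - 1) → ℂ),
                f = TopTau.logSeries (TopTau.restrictTau p τ) + MvPowerSeries.C a +
                  ∑ j, MvPowerSeries.C (b j) * MvPowerSeries.X j) ∧
        (TopTau.FirstOrderSystem p θ (TopTau.logSeries (TopTau.restrictTau p τ)) ∧
          ∀ f : MvPowerSeries (Fin (p - 1)) ℂ, TopTau.FirstOrderSystem p θ f →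
            ∃ a : ℂ, f = TopTau.logSeries (TopTau.restrictTau p τ) + MvPowerSeries.C a)) ∧
    (∀ τ : MvPowerSeries ℕ+ ℂ, TopTau.IsInvariantTau 2 τ →
      TopTau.logSeries (TopTau.restrictTau 2 τ) =
        -(MvPowerSeries.C (1 / 12 : ℂ) * MvPowerSeries.X (0 : Fin 1) ^ 3)) ∧
    (∀ τ : MvPowerSeries ℕ+ ℂ, TopTau.IsInvariantTau 3 τ →
      TopTau.logSeries (TopTau.restrictTau 3 τ) =
        -(MvPowerSeries.C (1 / 3 : ℂ) *
            MvPowerSeries.X (0 : Fin 2) ^ 2 * MvPowerSeries.X (1 : Fin 2))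
        - MvPowerSeries.C (2 / 27 : ℂ) * MvPowerSeries.X (1 : Fin 2) ^ 4) ∧
    (∀ τ : MvPowerSeries ℕ+ ℂ, TopTau.IsInvariantTau 4 τ →
      TopTau.logSeries (TopTau.restrictTau 4 τ) =
        -(MvPowerSeries.C (3 / 8 : ℂ) *
            MvPowerSeries.X (0 : Fin 3) ^ 2 * MvPowerSeries.X (2 : Fin 3))
        - MvPowerSeries.C (1 / 2 : ℂ) *
            MvPowerSeries.X (0 : Fin 3) * MvPowerSeries.X (1 : Fin 3) ^ 2
        - MvPowerSeries.C (9 / 16 : ℂ) *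
            MvPowerSeries.X (1 : Fin 3) ^ 2 * MvPowerSeries.X (2 : Fin 3) ^ 2
        - MvPowerSeries.C (81 / 1280 : ℂ) * MvPowerSeries.X (2 : Fin 3) ^ 5) := by
  refine ⟨fun p hp => ⟨TopTau.existsUnique_isTheta hp, fun θ hθ τ hτ => ?_⟩,
    fun τ hτ => TopTau.logSeries_restrictTau_two hτ,
    fun τ hτ => TopTau.logSeries_restrictTau_three hτ,
    fun τ hτ => TopTau.logSeries_restrictTau_four hτ⟩
  have h2 := TopTau.secondOrderSystem_logSeries hp hθ hτ
  have hKP := TopTau.solvesKPUpTo_logSeries hp hτ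
  have h1 := TopTau.firstOrderSystem_logSeries hp hθ hτ
  refine ⟨⟨h2, hKP, fun f hf hfKP => ?_⟩, h1, fun f hf => ?_⟩
  · exact TopTau.eq_add_linear_of_pderiv_pderiv_eq
      (TopTau.pderiv_pderiv_eq_of_solvesKPUpTo hp (fun j => (hf j).trans (h2 j).symm) hfKP hKP)
  · exact TopTau.eq_add_C_of_pderiv_eq fun j => (hf j).trans (h1 j).symm
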